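/- A planar map is a connected graph (loops and multiple edges allowed) embedded in the oriented sphere, considered up to orientation-preserving homeomorphism. Consider tetravalent planar maps with $n\ge 1$ vertices (every vertex has degree $4$) equipped with a spanning tree $T$; the edges not in $T$ are called unvisited. Let $c_n$ be the number of such maps with, in addition, a distinguished face and a distinguished (unoriented) unvisited edge, counted up to isomorphism. Then for all $n\ge 1$ $$c_n=\frac{(3n)!}{n!\,n!\,(n+1)!}=\frac{(3n)!}{n!\,(2n+1)!}\times\frac{(2n+2)!}{(n+1)!\,(n+2)!}\times(n+2)\times\frac12 ,$$ where the factors have the following meaning. 1. $\frac{(3n)!}{n!(2n+1)!}$ is the number of rooted plane ternary trees with $n$ inner vertices; each of them has $2n+2$ leaves, the root leaf included. 2. $\frac{(2n+2)!}{(n+1)!(n+2)!}$ is the number of systems of $n+1$ non-crossing arches connecting $2n+2$ ordered points in pairs. Given a tetravalent planar map with $n$ vertices, a spanning tree and a distinguished oriented unvisited edge, cut every unvisited edge into two leaves. The spanning tree becomes a rooted ternary tree with $n$ inner vertices whose root leaf is the origin of the distinguished oriented edge, and the unvisited edges match its $2n+2$ leaves, numbered in order around the tree starting from the root leaf, by a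 system of $n+1$ non-crossing arches. This defines a bijection from the isomorphism classes of such maps onto the pairs (rooted ternary tree with $n$ inner vertices, system of $n+1$ non-crossing arches). 3. Every tetravalent planar map with $n$ vertices has $n+2$ faces, and the number of isomorphism classes of maps as in 2 with moreover a distinguished face is $n+2$ times the number of those without. 4. Distinguishing an unoriented rather than an oriented unvisited edge (a face being distinguished in both cases) multiplies the number of isomorphism classes by $\frac12$. Moreover, whichever face is chosen as origin, every face can be reached from it by crossing only unvisited edges, and every unvisited edge separates a face at distance $m$ from a face at distance $m+1$ from the origin for some $m\ge0$, where the distance is the minimal number of unvisited edges crossed. Let $F(\alpha)=\sum_{n\ge1}c_n\alpha^n$ and $\alpha^\star=\frac1{27}$. For real $\alpha$ the series converges if and only if $|\alpha|\le\alpha^\star$, and there is a constant $c\ne0$ such that $$F(\alpha^\star)-F(\alpha)\sim c\,(\alpha^\star-\alpha)\log(\alpha^\star-\alpha)\qquad(\alpha\to\alpha^\star,\ \alpha<\alpha^\star).$$ Hence the critical exponent $\gamma$, defined by $F(\alpha^\star)-F(\alpha)\approx(\alpha^\star-\alpha)^{-\gamma}$ in the sense that $-\gamma=\lim_{\alpha\uparrow\alpha^\star}\frac{\log|F(\alpha^\star)-F(\alpha)|}{\log(\alpha^\star-\alpha)}$,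 equals $-1$. -/

import Mathlib

open Equiv Filter Topology Asymptotics

namespace SpanningTreeMaps

/-- A connected map (a graph, loops and multiple edges allowed, cellularly embedded in an oriented
closed surface), given by its set `D` of half-edges: `σ` sends a half-edge to the next one around
its vertex, and `α` sends a half-edge to the other half of its edge. -/
structure CombMap (D : Type*) where
  σ : Perm D
  α : Perm D
  α_invol : ∀ d, α (α d) = d
  α_fixedPointFree : ∀ d, α d ≠ d
  connected : ∀ d d' : D, ∃ g ∈ Subgroup.closure ({σ, α} : Set (Perm D)), g d = d'

namespace CombMap

variable {D : Type*} (M : CombMap D)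

/-- Vertices are the cycles of `σ`. -/
def Vertex : Type _ := Quotient (Perm.SameCycle.setoid M.σ)

/-- Edges are the cycles of `α`. -/
def Edge : Type _ := Quotient (Perm.SameCycle.setoid M.α)

/-- Faces are the cycles of `σ ∘ α`. -/
def Face : Type _ := Quotient (Perm.SameCycle.setoid (M.σ * M.α))

/-- The vertex of a half-edge. -/
def vertex (d : D) : M.Vertex := Quotient.mk _ d

/-- The edge containing a half-edge. -/
def edge (d : D) : M.Edge := Quotient.mk _ d

/-- The face on a fixed side (say the left one) of the half-edge `d`; the face on the other side of
the same edge is `M.face (M.α d)`. -/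
def face (d : D) : M.Face := Quotient.mk _ d

/-- The surface is a sphere: `V - E + F = 2`. -/
def IsPlanar : Prop := Nat.card M.Vertex + Nat.card M.Face = Nat.card M.Edge + 2

/-- Every vertex is incident to exactly four half-edges. -/
def IsTetravalent : Prop := ∀ v : M.Vertex, Nat.card {d : D // M.vertex d = v} = 4

/-- The simple graph on the vertices underlying a set `T` of edges. -/
def edgeSetGraph (T : Set M.Edge) : SimpleGraph M.Vertex :=
  SimpleGraph.fromRel fun u v => ∃ d, M.edge d ∈ T ∧ M.vertex d = u ∧ M.vertex (M.α d) = v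

/-- `T` is a spanning tree: it has no loop and no two parallel edges, and the simple graph that it
forms on all the vertices of the map is a tree. -/
structure IsSpanningTree (T : Set M.Edge) : Prop where
  no_loop : ∀ d, M.edge d ∈ T → M.vertex d ≠ M.vertex (M.α d)
  no_parallel : ∀ d d', M.edge d ∈ T → M.edge d' ∈ T → M.vertex d = M.vertex d' →
    M.vertex (M.α d) = M.vertex (M.α d') → d = d'
  isTree : (M.edgeSetGraph T).IsTree

/-- The graph on the faces in which two faces are adjacent when they are separated by an edge that
is not in `T`. -/
def faceGraph (T : Set M.Edge) : SimpleGraph M.Face :=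
  SimpleGraph.fromRel fun f g => ∃ d, M.edge d ∉ T ∧ M.face d = f ∧ M.face (M.α d) = g

end CombMap

/-- A tetravalent planar map with `n` vertices (hence `4 * n` half-edges, here labelled by
`Fin (4 * n)`), with a spanning tree. The edges of the map outside the tree are the unvisited
edges. -/
structure TreeMap (n : ℕ) where
  map : CombMap (Fin (4 * n))
  planar : map.IsPlanar
  tetravalent : map.IsTetravalent
  tree : Set map.Edge
  isSpanningTree : map.IsSpanningTree tree

variable {n : ℕ}

/-- The relabelling `φ` of the half-edges is an (orientation-preserving) isomorphism of maps which
carries spanning tree to spanning tree. -/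
structure TreeMap.IsIso (M M' : TreeMap n) (φ : Perm (Fin (4 * n))) : Prop where
  map_σ : ∀ d, φ (M.map.σ d) = M'.map.σ (φ d)
  map_α : ∀ d, φ (M.map.α d) = M'.map.α (φ d)
  map_tree : ∀ d, M.map.edge d ∈ M.tree ↔ M'.map.edge (φ d) ∈ M'.tree

theorem TreeMap.IsIso.refl (M : TreeMap n) : M.IsIso M 1 :=
  ⟨fun _ => rfl, fun _ => rfl, fun _ => Iff.rfl⟩

theorem TreeMap.IsIso.symm {M M' : TreeMap n} {φ : Perm (Fin (4 * n))} (h : M.IsIso M' φ) :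
    M'.IsIso M φ.symm where
  map_σ d := by rw [Equiv.symm_apply_eq, h.map_σ, Equiv.apply_symm_apply]
  map_α d := by rw [Equiv.symm_apply_eq, h.map_α, Equiv.apply_symm_apply]
  map_tree d := by rw [h.map_tree, Equiv.apply_symm_apply]

theorem TreeMap.IsIso.trans {M M' M'' : TreeMap n} {φ ψ : Perm (Fin (4 * n))}
    (h : M.IsIso M' φ) (h' : M'.IsIso M'' ψ) : M.IsIso M'' (φ.trans ψ) where
  map_σ d := by simp [h.map_σ, h'.map_σ]
  map_α d := by simp [h.map_α, h'.map_α]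
  map_tree d := by rw [h.map_tree, h'.map_tree]; rfl

/-- A tetravalent planar map with `n` vertices and a spanning tree, with a distinguished face and a
distinguished (unoriented) unvisited edge. -/
structure FaceEdgeTreeMap (n : ℕ) extends TreeMap n where
  origin : map.Face
  marked : map.Edge
  unvisited : marked ∉ tree

/-- The same objects with the distinguished unvisited edge oriented, i.e. with one of its two
half-edges distinguished. -/
structure FaceRootTreeMap (n : ℕ) extends TreeMap n where
  origin : map.Face
  root : Fin (4 * n)
  unvisited : map.edge root ∉ tree

/-- A tetravalent planar map with `n` vertices and a spanning tree, with a distinguished oriented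
unvisited edge only. -/
structure RootTreeMap (n : ℕ) extends TreeMap n where
  root : Fin (4 * n)
  unvisited : map.edge root ∉ tree

/-- Equality up to isomorphism. -/
instance FaceEdgeTreeMap.setoid (n : ℕ) : Setoid (FaceEdgeTreeMap n) where
  r M M' := ∃ φ, M.toTreeMap.IsIso M'.toTreeMap φ ∧
    (∀ d, M.map.face d = M.origin ↔ M'.map.face (φ d) = M'.origin) ∧
    (∀ d, M.map.edge d = M.marked ↔ M'.map.edge (φ d) = M'.marked)
  iseqv :=
    { refl := fun M => ⟨1, TreeMap.IsIso.refl _, fun _ => Iff.rfl, fun _ => Iff.rfl⟩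
      symm := fun ⟨φ, h, hf, he⟩ => ⟨φ.symm, h.symm,
        fun d => by rw [hf, Equiv.apply_symm_apply], fun d => by rw [he, Equiv.apply_symm_apply]⟩
      trans := fun ⟨φ, h, hf, he⟩ ⟨ψ, h', hf', he'⟩ => ⟨φ.trans ψ, h.trans h',
        fun d => (hf d).trans (hf' _), fun d => (he d).trans (he' _)⟩ }

/-- Equality up to isomorphism. -/
instance FaceRootTreeMap.setoid (n : ℕ) : Setoid (FaceRootTreeMap n) where
  r M M' := ∃ φ, M.toTreeMap.IsIso M'.toTreeMap φ ∧
    (∀ d, M.map.face d = M.origin ↔ M'.map.face (φ d) = M'.origin) ∧ φ M.root = M'.root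
  iseqv :=
    { refl := fun M => ⟨1, TreeMap.IsIso.refl _, fun _ => Iff.rfl, rfl⟩
      symm := fun ⟨φ, h, hf, hr⟩ => ⟨φ.symm, h.symm,
        fun d => by rw [hf, Equiv.apply_symm_apply], by rw [Equiv.symm_apply_eq, hr]⟩
      trans := fun ⟨φ, h, hf, hr⟩ ⟨ψ, h', hf', hr'⟩ => ⟨φ.trans ψ, h.trans h',
        fun d => (hf d).trans (hf' _), by rw [Equiv.trans_apply, hr, hr']⟩ }

/-- Equality up to isomorphism. -/
instance RootTreeMap.setoid (n : ℕ) : Setoid (RootTreeMap n) where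
  r M M' := ∃ φ, M.toTreeMap.IsIso M'.toTreeMap φ ∧ φ M.root = M'.root
  iseqv :=
    { refl := fun M => ⟨1, TreeMap.IsIso.refl _, rfl⟩
      symm := fun ⟨φ, h, hr⟩ => ⟨φ.symm, h.symm, by rw [Equiv.symm_apply_eq, hr]⟩
      trans := fun ⟨φ, h, hr⟩ ⟨ψ, h', hr'⟩ => ⟨φ.trans ψ, h.trans h',
        by rw [Equiv.trans_apply, hr, hr']⟩ }

/-- Rooted plane ternary trees: every inner vertex has three ordered children. -/
inductive TernaryTree : Type
  | leaf : TernaryTree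
  | node : TernaryTree → TernaryTree → TernaryTree → TernaryTree

/-- The number of inner vertices. -/
def TernaryTree.inner : TernaryTree → ℕ
  | .leaf => 0
  | .node a b c => a.inner + b.inner + c.inner + 1

/-- The number of leaves, the root leaf (at the far end of the root edge) not included. -/
def TernaryTree.leaves : TernaryTree → ℕ
  | .leaf => 1
  | .node a b c => a.leaves + b.leaves + c.leaves

/-- Systems of `k` non-crossing arches which match in pairs the points `0, …, 2 * k - 1` placed in
this order on a line (or circle): `i` is matched with `f i`. -/
def ArchSystem (k : ℕ) : Type :=
  {f : Perm (Fin (2 * k)) // (∀ i, f (f i) = i) ∧ (∀ i, f i ≠ i) ∧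
    ¬ ∃ i j, i < j ∧ j < f i ∧ f i < f j}

/-- `M.Unfolds d t L`: when all unvisited edges are cut into two leaves, the part of the spanning
tree seen from the half-edge `d` (looking away from the vertex of `d`) is the ternary tree `t`, and
the half-edges ending at its leaves, in the order given by the rotation `σ`, are `L`. -/
inductive TreeMap.Unfolds (M : TreeMap n) : Fin (4 * n) → TernaryTree → List (Fin (4 * n)) → Prop
  | leaf (d : Fin (4 * n)) : M.map.edge d ∉ M.tree → Unfolds M d .leaf [d]
  | node (d : Fin (4 * n)) (a b c : TernaryTree) (A B C : List (Fin (4 * n))) :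
      M.map.edge d ∈ M.tree →
      Unfolds M (M.map.σ (M.map.α d)) a A →
      Unfolds M (M.map.σ (M.map.σ (M.map.α d))) b B →
      Unfolds M (M.map.σ (M.map.σ (M.map.σ (M.map.α d)))) c C →
      Unfolds M d (.node a b c) (A ++ B ++ C)

/-- `M` is made of the rooted ternary tree `t` and the arch system `f`: when all unvisited edges are
cut into two leaves, the spanning tree becomes the ternary tree `t`, the distinguished half-edge
being the root leaf; and, if the `2 * (n + 1)` leaves are numbered in their order around the tree
starting from the root leaf, then the unvisited edges are the arches of `f`. -/
def RootTreeMap.IsMadeOf (M : RootTreeMap n) (t : TernaryTree) (f : ArchSystem (n + 1)) : Prop :=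
  ∃ (a b c : TernaryTree) (A B C : List (Fin (4 * n))) (ℓ : Fin (2 * (n + 1)) → Fin (4 * n)),
    t = .node a b c ∧
    M.toTreeMap.Unfolds (M.map.σ M.root) a A ∧
    M.toTreeMap.Unfolds (M.map.σ (M.map.σ M.root)) b B ∧
    M.toTreeMap.Unfolds (M.map.σ (M.map.σ (M.map.σ M.root))) c C ∧
    List.ofFn ℓ = M.root :: (A ++ B ++ C) ∧
    ∀ i, M.map.α (ℓ i) = ℓ (f.1 i)

/-- The number of tetravalent planar maps with `n` vertices, a spanning tree, a distinguished face
and a distinguished unvisited edge. -/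
noncomputable def count (n : ℕ) : ℕ := Nat.card (Quotient (FaceEdgeTreeMap.setoid n))

/-- The generating function of these maps, with a weight `x` per vertex (`n ≥ 1` vertices). -/
noncomputable def genFun (x : ℝ) : ℝ := ∑' n : ℕ, (count (n + 1) : ℝ) * x ^ (n + 1)

/-- At `a` (approached from below) the function `F` has the critical exponent `γ`, i.e.
`F a - F x` behaves as `(a - x) ^ (-γ)` up to factors of lower order such as logarithms. -/
def HasCriticalExponent (F : ℝ → ℝ) (a γ : ℝ) : Prop :=
  Tendsto (fun x => Real.log |F a - F x| / Real.log (a - x)) (𝓝[<] a) (𝓝 (-γ))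

end SpanningTreeMaps

/-! The count rests on one description of a rooted map. Erasing the pairing `α` of the unvisited
half-edges leaves the tree alone: the rotation `σ` and an involution `τ` that agrees with `α` on
tree edges and fixes the unvisited half-edges. Such a pair is a plane tree (`IsPlaneTree`), and `σ *
τ` has a single cycle, the contour of the tree. Numbering half-edges along the contour makes the
plane tree rigid and determined by its ternary shape (`IsPlaneTree.exists_equiv`). What remains of
the map is the pairing of the leaves, a fixed-point-free involution.

Planarity of the map is equivalent to the absence of crossings. Faces and unvisited edges form a
connected multigraph with `n + 1` edges, and by Euler's formula the map is planar exactly when it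
has `n + 2` faces, that is, when this multigraph is a tree, that is, when every unvisited edge
separates the faces. An arch cuts the contour into two arcs. If no arch crosses it, the faces met on
the two arcs are separated by it; conversely a crossing arch joins the two sides
(`CombMap.card_face_of_not_crossing`, `CombMap.not_crossing_of_card_face`). Conversely, a model of
each ternary tree built from addresses is glued along any arch system, so the correspondence is
onto.

Ternary trees are counted through forests, arch systems through Dyck words. A rooted map has no
nontrivial automorphism, so choosing a face contributes exactly `n + 2`. Since the faces form a
tree, the two sides of an unvisited edge are at different distances from the origin face; hence a
marked edge has a canonical orientation and no automorphism reverses it, which gives the factor `1 /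
2`.

For the analysis, Stirling's formula gives `coeff n / 27 ^ n ~ C / (n * (n + 1))` with `C > 0`. The
model series with coefficients `1 / ((n + 1) * (n + 2))` has an explicit `(1 - y) * log (1 - y)`
singularity at `y = 1`, and an Abelian comparison transfers it to the generating function. -/

namespace SpanningTreeMaps

/-! ### Asymptotics of the coefficients and the logarithmic singularity -/

/-- The number `(3 * n)! / (n ! * n ! * (n + 1)!)`, in `ℝ`. -/
noncomputable def coeff (n : ℕ) : ℝ :=
  ((3 * n).factorial : ℝ) / (n.factorial * n.factorial * (n + 1).factorial)

theorem coeff_nonneg (n : ℕ) : 0 ≤ coeff n := by unfold coeff; positivity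

theorem tendsto_sub_nhdsLT (a : ℝ) : Tendsto (fun x : ℝ => a - x) (𝓝[<] a) (𝓝[>] 0) := by
  refine tendsto_nhdsWithin_iff.2 ⟨?_, ?_⟩
  · have : Tendsto (fun x : ℝ => a - x) (𝓝 a) (𝓝 (a - a)) :=
      (continuous_const.sub continuous_id).tendsto a
    rw [sub_self] at this
    exact this.mono_left nhdsWithin_le_nhds
  · filter_upwards [self_mem_nhdsWithin] with y hy
    simpa using hy

/-- In the quotient of Stirling sequences the factors `(n / e) ^ (3 * n)` cancel and `3 ^ (3 * n)`
leaves `27 ^ n`. The identity is therefore exact, and the limit `√π` of `stirlingSeq` is all that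
the asymptotics need. -/
theorem coeff_eq_stirlingSeq (n : ℕ) (hn : n ≠ 0) :
    coeff n / 27 ^ n * (n * (n + 1)) =
      √3 / 2 * (Stirling.stirlingSeq (3 * n) / Stirling.stirlingSeq n ^ 3) := by
  have hn' : (0 : ℝ) < n := by positivity
  have h6 : √(2 * ((3 * n : ℕ) : ℝ)) = √3 * √(2 * n) := by
    rw [← Real.sqrt_mul (by norm_num)]; push_cast; congr 1; ring
  have h2 : √(2 * (n : ℝ)) ^ 2 = 2 * n := Real.sq_sqrt (by positivity)
  have h3 : √(3 : ℝ) ^ 2 = 3 := Real.sq_sqrt (by positivity)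
  have hs : 0 < √(2 * (n : ℝ)) := by positivity
  have hp : (((3 * n : ℕ) : ℝ) / Real.exp 1) ^ (3 * n) =
      27 ^ n * ((n / Real.exp 1) ^ n) ^ 3 := by
    push_cast
    rw [mul_div_assoc, mul_pow, pow_mul, ← pow_mul _ n 3, mul_comm n 3]; norm_num
  unfold coeff Stirling.stirlingSeq
  rw [h6, hp, Nat.factorial_succ]
  have hq : 0 < ((n : ℝ) / Real.exp 1) ^ n := by positivity
  generalize ((n : ℝ) / Real.exp 1) ^ n = q at *
  generalize √(2 * (n : ℝ)) = s at *
  have hf : (0 : ℝ) < n.factorial := by positivity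
  push_cast
  field_simp
  rw [h2, mul_comm]

theorem tendsto_coeff : ∃ C : ℝ, 0 < C ∧
    Tendsto (fun n : ℕ => coeff (n + 1) / 27 ^ (n + 1) * (((n : ℝ) + 1) * (n + 2))) atTop
      (𝓝 C) := by
  refine ⟨√3 / 2 * (√Real.pi / √Real.pi ^ 3), by positivity, ?_⟩
  have h1 : Tendsto (fun n : ℕ => √3 / 2 * (Stirling.stirlingSeq (3 * (n + 1)) /
      Stirling.stirlingSeq (n + 1) ^ 3)) atTop (𝓝 (√3 / 2 * (√Real.pi / √Real.pi ^ 3))) := by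
    have hs := Stirling.tendsto_stirlingSeq_sqrt_pi
    refine Tendsto.const_mul _ (Tendsto.div ?_ ((hs.comp (tendsto_add_atTop_nat 1)).pow 3)
      (by positivity))
    exact hs.comp (tendsto_atTop_mono (fun n => by simp only [id]; omega) tendsto_id)
  refine h1.congr fun n => ?_
  rw [← coeff_eq_stirlingSeq (n + 1) n.succ_ne_zero]
  push_cast
  congr 1
  ring

/-- The comparison sequence `1 / ((n + 1) * (n + 2))`. -/
noncomputable def invPronic (n : ℕ) : ℝ := 1 / (((n : ℝ) + 1) * (n + 2))

theorem invPronic_pos (n : ℕ) : 0 < invPronic n := by unfold invPronic; positivity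

theorem hasSum_invPronic : HasSum invPronic 1 := by
  have h : ∀ n : ℕ, ∑ i ∈ Finset.range n, invPronic i = 1 - 1 / ((n : ℝ) + 1) := by
    intro n
    induction n with
    | zero => simp
    | succ n ih =>
      rw [Finset.sum_range_succ, ih, invPronic]
      push_cast
      field_simp
      ring
  rw [hasSum_iff_tendsto_nat_of_nonneg (fun n => (invPronic_pos n).le)]
  simp_rw [h]
  simpa using (tendsto_one_div_add_atTop_nhds_zero_nat (𝕜 := ℝ)).const_sub 1

/-- Partial fractions `1 / (n + 1) - 1 / (n + 2)` turn the power series part into two shifted copies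
of the series of `-log (1 - y)`; the shift costs the division by `y` and the removal of the first
term. -/
theorem hasSum_invPronic_mul {y : ℝ} (h0 : 0 < y) (h1 : y < 1) :
    HasSum (fun n => invPronic n * (1 - y ^ (n + 1))) (-((1 - y) * Real.log (1 - y)) / y) := by
  have hl := Real.hasSum_pow_div_log_of_abs_lt_one (x := y) (by rw [abs_of_pos h0]; exact h1)
  have hl' := ((hasSum_nat_add_iff' 1).2 hl).div_const y
  have h := (hasSum_invPronic.sub (hl.sub hl'))
  have e1 : (fun n => invPronic n * (1 - y ^ (n + 1))) = fun n : ℕ =>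
      invPronic n - (y ^ (n + 1) / ((n : ℝ) + 1) - y ^ (n + 1 + 1) / (((n + 1 : ℕ) : ℝ) + 1) / y) := by
    funext n
    unfold invPronic
    push_cast
    field_simp
    ring
  have e2 : -((1 - y) * Real.log (1 - y)) / y = 1 - (-Real.log (1 - y) -
      (-Real.log (1 - y) - ∑ i ∈ Finset.range 1, y ^ (i + 1) / ((i : ℝ) + 1)) / y) := by
    simp
    field_simp
    ring
  rw [e1, e2]
  exact h

/-- An Abelian comparison with `C * invPronic`. The tail of the difference is a small multiple of
the model sum. The finitely many other terms are `O(1 - y)` by Bernoulli's inequality, which is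
negligible against `(1 - y) * log (1 - y)`. -/
theorem isEquivalent_tsum_mul_one_sub_pow {b : ℕ → ℝ} {C : ℝ} (hC : 0 < C)
    (hb : Tendsto (fun n => b n * (((n : ℝ) + 1) * (n + 2))) atTop (𝓝 C)) (hs : Summable b) :
    (fun y : ℝ => ∑' n, b n * (1 - y ^ (n + 1))) ~[𝓝[<] 1]
      fun y => C * (-((1 - y) * Real.log (1 - y))) / y := by
  have hU : ∀ y : ℝ, 0 < y → y < 1 → ∀ n : ℕ, 0 ≤ 1 - y ^ (n + 1) ∧
      1 - y ^ (n + 1) ≤ (n + 1) * (1 - y) ∧ 1 - y ^ (n + 1) ≤ 1 := by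
    intro y h0 h1 n
    refine ⟨sub_nonneg.2 (pow_le_one₀ h0.le h1.le), ?_, ?_⟩
    · have := one_add_mul_le_pow (a := y - 1) (by linarith) (n + 1)
      push_cast at this
      rw [add_sub_cancel] at this
      linarith
    · have : 0 < y ^ (n + 1) := by positivity
      linarith
  have hIoo : ∀ᶠ y : ℝ in 𝓝[<] 1, y ∈ Set.Ioo (0 : ℝ) 1 := Ioo_mem_nhdsLT (by norm_num)
  refine IsLittleO.isEquivalent ?_
  rw [isLittleO_iff]
  intro ε hε
  -- Tail and head will each cost `δ` times the model sum, hence the half.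
  set δ := ε * C / 2 with hδ
  have hδ0 : 0 < δ := by positivity
  obtain ⟨N, hN⟩ := eventually_atTop.1 ((Metric.tendsto_nhds.1 hb) δ hδ0)
  set g : ℕ → ℝ := fun n => if n < N then |b n - C * invPronic n| * (n + 1) else 0 with hg
  have hgs : Summable g := summable_of_hasFiniteSupport
    ((Set.finite_lt_nat N).subset fun n hn => by
      by_contra h
      simp only [Set.mem_ofPred_eq] at h
      simp [hg, h] at hn)
  have hlog : ∀ᶠ y : ℝ in 𝓝[<] 1, (∑' n, g n) / δ ≤ -Real.log (1 - y) := by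
    have : Tendsto (fun y : ℝ => -Real.log (1 - y)) (𝓝[<] 1) atTop :=
      tendsto_neg_atBot_atTop.comp (Real.tendsto_log_nhdsGT_zero.comp (tendsto_sub_nhdsLT 1))
    exact this.eventually_ge_atTop _
  filter_upwards [hIoo, hlog] with y ⟨h0, h1⟩ hy
  have hsum := hasSum_invPronic_mul h0 h1
  have hbs : Summable fun n => b n * (1 - y ^ (n + 1)) :=
    Summable.of_norm_bounded hs.abs fun n => by
      rw [norm_mul, Real.norm_eq_abs, Real.norm_eq_abs, abs_of_nonneg (hU y h0 h1 n).1]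
      exact mul_le_of_le_one_right (abs_nonneg _) (hU y h0 h1 n).2.2
  have hd := hbs.hasSum.sub (hsum.mul_left C)
  have hpt : ∀ n, ‖b n * (1 - y ^ (n + 1)) - C * (invPronic n * (1 - y ^ (n + 1)))‖ ≤
      δ * (invPronic n * (1 - y ^ (n + 1))) + g n * (1 - y) := by
    intro n
    obtain ⟨hu0, hu1, -⟩ := hU y h0 h1 n
    have hi := invPronic_pos n
    rw [← mul_assoc, ← sub_mul, norm_mul, Real.norm_eq_abs, Real.norm_eq_abs, abs_of_nonneg hu0]
    by_cases hn : n < N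
    · have : g n * (1 - y) = |b n - C * invPronic n| * ((n + 1) * (1 - y)) := by
        simp only [hg, if_pos hn]; ring
      rw [this]
      have := mul_le_mul_of_nonneg_left hu1 (abs_nonneg (b n - C * invPronic n))
      have : 0 ≤ δ * (invPronic n * (1 - y ^ (n + 1))) := by positivity
      linarith
    · have hb' := hN n (not_lt.1 hn)
      have hg0 : g n = 0 := by simp only [hg, if_neg hn]
      rw [hg0, zero_mul, add_zero, ← mul_assoc]
      refine mul_le_mul_of_nonneg_right ?_ hu0
      rw [Real.dist_eq] at hb'
      have : b n - C * invPronic n = (b n * (((n : ℝ) + 1) * (n + 2)) - C) * invPronic n := by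
        unfold invPronic; field_simp
      rw [this, abs_mul, abs_of_pos hi]
      exact mul_le_mul_of_nonneg_right hb'.le hi.le
  have hmaj := (hsum.mul_left δ).add (hgs.hasSum.mul_right (1 - y))
  have hle := tsum_of_norm_bounded hmaj hpt
  rw [hd.tsum_eq] at hle
  have hy1 : 0 < 1 - y := by linarith
  have hA : (∑' n, g n) * (1 - y) ≤ δ * (-((1 - y) * Real.log (1 - y)) / y) := by
    rw [div_le_iff₀ hδ0] at hy
    have hG : 0 ≤ ∑' n, g n := tsum_nonneg fun n => by
      simp only [hg]; split_ifs <;> positivity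
    have h2 : (∑' n, g n) * (1 - y) ≤ δ * (-((1 - y) * Real.log (1 - y))) := by nlinarith
    -- Dividing a nonnegative quantity by `y < 1` only enlarges it.
    refine h2.trans (mul_le_mul_of_nonneg_left ?_ hδ0.le)
    rw [le_div_iff₀ h0]
    refine mul_le_of_le_one_right ?_ h1.le
    have : 0 ≤ δ * (-((1 - y) * Real.log (1 - y))) := le_trans (by positivity) h2
    exact nonneg_of_mul_nonneg_right this hδ0
  have hnn : 0 ≤ -((1 - y) * Real.log (1 - y)) / y := by
    have : 0 ≤ ∑' n, g n := tsum_nonneg fun n => by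
      simp only [hg]; split_ifs <;> positivity
    exact nonneg_of_mul_nonneg_right (le_trans (by positivity) hA) hδ0
  have hfin : ‖C * (-((1 - y) * Real.log (1 - y))) / y‖ =
      C * (-((1 - y) * Real.log (1 - y)) / y) := by
    rw [mul_div_assoc, Real.norm_of_nonneg (by positivity)]
  simp only [Pi.sub_apply]
  rw [hfin, mul_div_assoc]
  refine hle.trans ?_
  calc _ ≤ δ * (-((1 - y) * Real.log (1 - y)) / y) + δ * (-((1 - y) * Real.log (1 - y)) / y) := by
        gcongr
    _ = _ := by rw [hδ]; ring

theorem summable_coeff_div : Summable fun n => coeff (n + 1) / 27 ^ (n + 1) := by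
  obtain ⟨C, -, hC⟩ := tendsto_coeff
  obtain ⟨K, hK⟩ := hC.bddAbove_range
  refine Summable.of_nonneg_of_le (fun n => div_nonneg (coeff_nonneg _) (by positivity))
    (fun n => ?_) (hasSum_invPronic.summable.mul_left K)
  have := hK (Set.mem_range_self n)
  unfold invPronic
  rw [mul_one_div, le_div_iff₀ (by positivity)]
  exact this

/-- Inside and on the circle of radius `1 / 27` the coefficients are dominated by a multiple of the
telescoping `invPronic`. Outside, terms tending to zero would make the normalized coefficients tend
to zero, because `n ^ 2` is negligible against `|27 * x| ^ n`; but their limit is positive. -/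
theorem summable_coeff_iff (x : ℝ) :
    Summable (fun n => coeff (n + 1) * x ^ (n + 1)) ↔ |x| ≤ 1 / 27 := by
  have he : ∀ n, coeff (n + 1) * x ^ (n + 1) =
      coeff (n + 1) / 27 ^ (n + 1) * (27 * x) ^ (n + 1) := fun n => by
    rw [mul_pow]; field_simp
  constructor
  · intro hs
    by_contra! hx
    have hx' : 1 < |27 * x| := by rw [abs_mul]; norm_num; linarith
    obtain ⟨C, hC0, hC⟩ := tendsto_coeff
    have h1 := (hs.tendsto_atTop_zero).abs
    have h2 : Tendsto (fun n : ℕ => (((n + 1 : ℕ) : ℝ) + 1) ^ 2 / |27 * x| ^ (n + 1)) atTop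
        (𝓝 0) := by
      have h3 := tendsto_pow_const_div_const_pow_of_one_lt 2 hx'
      have h4 := (h3.comp (tendsto_add_atTop_nat 2)).mul_const |27 * x|
      rw [zero_mul] at h4
      refine h4.congr fun n => ?_
      have : |27 * x| ≠ 0 := by positivity
      simp only [Function.comp]
      rw [pow_succ _ (n + 1)]
      push_cast
      field_simp
      ring
    have h3 := h1.mul h2
    rw [abs_zero, zero_mul] at h3
    have h4 : C ≤ 0 := by
      refine le_of_tendsto_of_tendsto' hC h3 fun n => ?_
      have hq : 0 < |27 * x| ^ (n + 1) := by positivity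
      rw [he, abs_mul, abs_pow, abs_of_nonneg (div_nonneg (coeff_nonneg _) (by positivity))]
      rw [mul_assoc, mul_div_cancel₀ _ hq.ne']
      refine mul_le_mul_of_nonneg_left ?_ (div_nonneg (coeff_nonneg _) (by positivity))
      push_cast
      nlinarith
    linarith
  · intro hx
    refine Summable.of_norm_bounded summable_coeff_div fun n => ?_
    rw [he, norm_mul, Real.norm_of_nonneg (div_nonneg (coeff_nonneg _) (by positivity)), norm_pow]
    refine mul_le_of_le_one_right (div_nonneg (coeff_nonneg _) (by positivity))
      (pow_le_one₀ (norm_nonneg _) ?_)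
    rw [Real.norm_eq_abs, abs_mul]
    norm_num
    linarith

/-- With `y = 27 * x` one has `1 - y = 27 * (1 / 27 - x)`, which gives the constant `-27 * C`; the
extra `log 27` and the denominator `y` disappear in the limit. -/
theorem isEquivalent_tsum_coeff : ∃ c : ℝ, c ≠ 0 ∧
    (fun x : ℝ => (∑' n, coeff (n + 1) * (1 / 27 : ℝ) ^ (n + 1)) - ∑' n, coeff (n + 1) * x ^ (n + 1))
      ~[𝓝[<] (1 / 27)] fun x : ℝ => c * ((1 / 27 - x) * Real.log (1 / 27 - x)) := by
  obtain ⟨C, hC0, hC⟩ := tendsto_coeff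
  refine ⟨-(27 * C), by simpa using hC0.ne', ?_⟩
  have hmul : Tendsto (fun x : ℝ => 27 * x) (𝓝[<] (1 / 27)) (𝓝[<] 1) := by
    refine tendsto_nhdsWithin_iff.2 ⟨?_, ?_⟩
    · have : Tendsto (fun x : ℝ => 27 * x) (𝓝 (1 / 27)) (𝓝 (27 * (1 / 27))) :=
        (continuous_const.mul continuous_id).tendsto _
      norm_num at this
      norm_num
      exact this.mono_left nhdsWithin_le_nhds
    · filter_upwards [self_mem_nhdsWithin] with x hx
      simp only [Set.mem_Iio] at hx ⊢
      linarith
  have h1 := (isEquivalent_tsum_mul_one_sub_pow hC0 hC summable_coeff_div).comp_tendsto hmul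
  have hIoo : ∀ᶠ x : ℝ in 𝓝[<] (1 / 27), x ∈ Set.Ioo (0 : ℝ) (1 / 27) :=
    Ioo_mem_nhdsLT (by norm_num)
  have h2 : (fun x : ℝ => (∑' n, coeff (n + 1) * (1 / 27 : ℝ) ^ (n + 1)) -
      ∑' n, coeff (n + 1) * x ^ (n + 1)) =ᶠ[𝓝[<] (1 / 27)]
      (fun y : ℝ => ∑' n, coeff (n + 1) / 27 ^ (n + 1) * (1 - y ^ (n + 1))) ∘ fun x => 27 * x := by
    filter_upwards [hIoo] with x hx
    have hs := (summable_coeff_iff x).2 (by rw [abs_of_pos hx.1]; exact hx.2.le)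
    have hs' := (summable_coeff_iff (1 / 27)).2 (by norm_num)
    rw [← hs'.tsum_sub hs]
    refine tsum_congr fun n => ?_
    rw [mul_pow, one_div, inv_pow]
    field_simp
  refine h2.isEquivalent.trans (h1.trans ?_)
  have hlog : Tendsto (fun x : ℝ => Real.log (1 / 27 - x)) (𝓝[<] (1 / 27)) atBot :=
    Real.tendsto_log_nhdsGT_zero.comp (tendsto_sub_nhdsLT _)
  have hratio : Tendsto (fun x : ℝ => (1 + Real.log 27 / Real.log (1 / 27 - x)) / (27 * x))
      (𝓝[<] (1 / 27)) (𝓝 1) := by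
    have h3 : Tendsto (fun x : ℝ => 1 + Real.log 27 / Real.log (1 / 27 - x)) (𝓝[<] (1 / 27))
        (𝓝 (1 + 0)) := tendsto_const_nhds.add (hlog.const_div_atBot _)
    have h4 := h3.div (hmul.mono_right nhdsWithin_le_nhds) one_ne_zero
    rw [add_zero, div_one] at h4
    exact h4
  refine isEquivalent_of_tendsto_one (hratio.congr' ?_)
  filter_upwards [hIoo, hlog.eventually_lt_atBot 0] with x hx hl
  have hpos : 0 < 1 / 27 - x := by linarith [hx.2]
  have hl' : Real.log (1 - 27 * x) = Real.log (1 / 27 - x) + Real.log 27 := by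
    rw [← Real.log_mul hpos.ne' (by norm_num)]
    congr 1; ring
  have hx0 := hx.1
  simp only [Function.comp, Pi.div_apply]
  rw [hl']
  have hne := hl.ne
  generalize Real.log (1 / 27 - x) = l at *
  have hpos' : 1 - 27 * x ≠ 0 := by linarith
  have hpos2 := hpos.ne'
  rw [show (1 : ℝ) - 27 * x = 27 * (1 / 27 - x) by ring]
  generalize (1 / 27 - x) = z at *
  field_simp

/-- Taking logarithms of the product `c * (a - x) * log (a - x)`, only `log (a - x)` survives the
division: `log c` is constant and `log |log (a - x)|` is of lower order. -/
theorem hasCriticalExponent_of_isEquivalent {F : ℝ → ℝ} {a c : ℝ} (hc : c ≠ 0)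
    (h : (fun x => F a - F x) ~[𝓝[<] a] fun x => c * ((a - x) * Real.log (a - x))) :
    HasCriticalExponent F a (-1) := by
  have hlog : Tendsto (fun x : ℝ => Real.log (a - x)) (𝓝[<] a) atBot :=
    Real.tendsto_log_nhdsGT_zero.comp (tendsto_sub_nhdsLT a)
  have hloglog : Tendsto (fun x : ℝ => Real.log (Real.log (a - x)) / Real.log (a - x)) (𝓝[<] a)
      (𝓝 0) := by
    have h1 : Tendsto (fun t : ℝ => Real.log t / t) atTop (𝓝 0) :=
      Real.isLittleO_log_id_atTop.tendsto_div_nhds_zero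
    have h2 := (h1.comp (tendsto_neg_atBot_atTop.comp hlog)).neg
    rw [neg_zero] at h2
    refine h2.congr fun x => ?_
    simp only [Function.comp, Real.log_neg_eq_log, div_neg, neg_neg]
  have hne : ∀ᶠ x in 𝓝[<] a, c * ((a - x) * Real.log (a - x)) ≠ 0 := by
    filter_upwards [hlog.eventually_lt_atBot 0, self_mem_nhdsWithin] with x hl hx
    have : a - x ≠ 0 := (sub_pos.2 hx).ne'
    have := hl.ne
    positivity
  have hquot := (isEquivalent_iff_tendsto_one hne).1 h
  have hlq : Tendsto (fun x => Real.log ((F a - F x) / (c * ((a - x) * Real.log (a - x)))))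
      (𝓝[<] a) (𝓝 0) := by
    have := (Real.continuousAt_log one_ne_zero).tendsto.comp hquot
    rwa [Real.log_one] at this
  have hlim : Tendsto (fun x => (Real.log ((F a - F x) / (c * ((a - x) * Real.log (a - x)))) +
      Real.log c) / Real.log (a - x) + 1 + Real.log (Real.log (a - x)) / Real.log (a - x))
      (𝓝[<] a) (𝓝 (0 + 1 + 0)) :=
    (Tendsto.add ((hlq.add tendsto_const_nhds).div_atBot hlog) tendsto_const_nhds).add hloglog
  unfold HasCriticalExponent
  rw [neg_neg]
  simp only [zero_add, add_zero] at hlim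
  refine hlim.congr' ?_
  filter_upwards [hlog.eventually_lt_atBot 0, self_mem_nhdsWithin, hne,
    hquot.eventually_ne one_ne_zero] with x hl hx hd hq
  have hax : a - x ≠ 0 := (sub_pos.2 hx).ne'
  have hl' := hl.ne
  simp only [Pi.div_apply] at hq
  have hF : F a - F x ≠ 0 := fun h0 => hq (by rw [h0, zero_div])
  -- `Real.log` ignores signs, so the formulas remain valid for negative `c` and for `log (a - x) <
  -- 0`.
  rw [Real.log_abs, Real.log_div hF hd, Real.log_mul hc (by positivity), Real.log_mul hax hl']
  field_simp
  ring

/-! ### Counting ternary trees through forests -/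

/-- Ordered forests of `m` ternary trees with `k` inner vertices in total. -/
def TernaryForest (m k : ℕ) : Type :=
  {l : List TernaryTree // l.length = m ∧ (l.map TernaryTree.inner).sum = k}

namespace TernaryForest

instance : Unique (TernaryForest 0 0) where
  default := ⟨[], rfl, rfl⟩
  uniq := fun ⟨_, h, _⟩ => Subtype.ext (List.length_eq_zero_iff.1 h)

instance (k : ℕ) : IsEmpty (TernaryForest 0 (k + 1)) :=
  ⟨fun ⟨l, h, h'⟩ => by simp [List.length_eq_zero_iff.1 h] at h'⟩

/-- In a nonempty forest without inner vertices, the first tree is a leaf. -/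
def succZeroEquiv (m : ℕ) : TernaryForest (m + 1) 0 ≃ TernaryForest m 0 where
  toFun := fun ⟨l, h⟩ => ⟨l.tail, by
    obtain ⟨h, h'⟩ := h
    cases l with
    | nil => simp at h
    | cons t l => simp_all⟩
  invFun := fun ⟨l, h⟩ => ⟨.leaf :: l, by simp [h, TernaryTree.inner]⟩
  left_inv := fun ⟨l, h⟩ => by
    obtain ⟨h, h'⟩ := h
    match l, h, h' with
    | .leaf :: l, h, h' => rfl
    | .node a b c :: l, h, h' => simp [TernaryTree.inner] at h'
  right_inv := fun ⟨l, h⟩ => rfl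

/-- The first tree of a forest is a leaf, or its root can be removed. -/
def succSuccEquiv (m k : ℕ) :
    TernaryForest (m + 1) (k + 1) ≃ TernaryForest m (k + 1) ⊕ TernaryForest (m + 3) k where
  toFun := fun
    | ⟨.leaf :: l, h⟩ => .inl ⟨l, by simpa [TernaryTree.inner] using h⟩
    | ⟨.node a b c :: l, h⟩ => .inr ⟨a :: b :: c :: l, by
        simp [TernaryTree.inner] at h ⊢; omega⟩
  invFun := fun
    | .inl ⟨l, h⟩ => ⟨.leaf :: l, by simpa [TernaryTree.inner] using h⟩
    | .inr ⟨a :: b :: c :: l, h⟩ => ⟨.node a b c :: l, by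
        simp [TernaryTree.inner] at h ⊢; omega⟩
  left_inv := fun
    | ⟨.leaf :: l, h⟩ => rfl
    | ⟨.node a b c :: l, h⟩ => rfl
  right_inv := fun
    | .inl ⟨l, h⟩ => rfl
    | .inr ⟨a :: b :: c :: l, h⟩ => rfl

instance finite : ∀ k m : ℕ, Finite (TernaryForest m k)
  | 0, 0 => inferInstance
  | k + 1, 0 => inferInstance
  | 0, m + 1 => have := finite 0 m; Finite.of_equiv _ (succZeroEquiv m).symm
  | k + 1, m + 1 =>
    have := finite (k + 1) m
    have := finite k (m + 3)
    Finite.of_equiv _ (succSuccEquiv m k).symm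

theorem card_zero (m : ℕ) : Nat.card (TernaryForest m 0) = 1 := by
  induction m with
  | zero => simp
  | succ m ih => rw [Nat.card_congr (succZeroEquiv m), ih]

theorem card_succ_succ (m k : ℕ) : Nat.card (TernaryForest (m + 1) (k + 1)) =
    Nat.card (TernaryForest m (k + 1)) + Nat.card (TernaryForest (m + 3) k) := by
  rw [Nat.card_congr (succSuccEquiv m k), Nat.card_sum]

-- This is the ballot-type formula for forests, with denominators cleared. The recurrence of
-- `card_succ_succ` lowers either the number of trees or the number of inner vertices, hence the
-- nested induction; counting forests rather than trees is what makes the recurrence linear.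
open Nat in
theorem card_mul_factorial (k m : ℕ) :
    Nat.card (TernaryForest (m + 1) k) * (k ! * (m + 1 + 2 * k)!) = (m + 1) * (m + 3 * k)! := by
  induction k generalizing m with
  | zero => simp [card_zero, Nat.factorial_succ]
  | succ k ih =>
    induction m with
    | zero =>
      have h := ih 2
      rw [card_succ_succ]
      simp only [Nat.card_of_isEmpty, zero_add]
      rw [show 2 + 1 + 2 * k = 2 * k + 3 by ring, show 2 + 3 * k = 3 * k + 2 by ring] at h
      rw [show 1 + 2 * (k + 1) = 2 * k + 3 by ring, show 3 * (k + 1) = 3 * k + 2 + 1 by ring,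
        Nat.factorial_succ k, Nat.factorial_succ (3 * k + 2)]
      linear_combination (k + 1) * h
    | succ m ihm =>
      have h := ih (m + 3)
      rw [card_succ_succ]
      rw [show m + 1 + 2 * (k + 1) = m + 2 * k + 3 by ring,
        show m + 3 * (k + 1) = m + 3 * k + 3 by ring] at ihm
      rw [show m + 3 + 1 + 2 * k = m + 2 * k + 3 + 1 by ring,
        show m + 3 + 3 * k = m + 3 * k + 3 by ring, Nat.factorial_succ (m + 2 * k + 3)] at h
      rw [show m + 1 + 1 + 2 * (k + 1) = m + 2 * k + 3 + 1 by ring,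
        show m + 1 + 3 * (k + 1) = m + 3 * k + 3 + 1 by ring,
        Nat.factorial_succ (m + 2 * k + 3), Nat.factorial_succ (m + 3 * k + 3)]
      rw [Nat.factorial_succ k] at ihm ⊢
      linear_combination (k + 1) * h + (m + 2 * k + 4) * ihm

/-- A forest with one tree is a tree. -/
def oneEquiv (n : ℕ) : {t : TernaryTree // t.inner = n} ≃ TernaryForest 1 n where
  toFun := fun ⟨t, h⟩ => ⟨[t], by simpa using h⟩
  invFun := fun
    | ⟨[t], h⟩ => ⟨t, by simpa using h⟩
  left_inv := fun ⟨t, h⟩ => rfl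
  right_inv := fun
    | ⟨[t], h⟩ => rfl

end TernaryForest

namespace TernaryTree

instance (n : ℕ) : Finite {t : TernaryTree // t.inner = n} :=
  Finite.of_equiv _ (TernaryForest.oneEquiv n).symm

theorem card_inner_eq (n : ℕ) : (Nat.card {t : TernaryTree // t.inner = n} : ℚ) =
    (3 * n).factorial / (n.factorial * (2 * n + 1).factorial) := by
  have h := TernaryForest.card_mul_factorial n 0
  rw [← Nat.card_congr (TernaryForest.oneEquiv n)] at h
  rw [eq_div_iff (by positivity)]
  simp only [zero_add, one_mul] at h
  rw [add_comm 1] at h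
  exact_mod_cast h

theorem leaves_eq (t : TernaryTree) : t.leaves = 2 * t.inner + 1 := by
  induction t with
  | leaf => rfl
  | node a b c iha ihb ihc => simp only [leaves, inner]; omega

end TernaryTree

/-! ### Non-crossing arch systems and Dyck words -/

/-- The height change of a step. -/
def stepSign : DyckStep → ℤ
  | .U => 1
  | .D => -1

theorem stepSign_U : stepSign .U = 1 := rfl
theorem stepSign_D : stepSign .D = -1 := rfl

/-- The height reached after `j` steps. -/
def height {m : ℕ} (w : Fin m → DyckStep) (j : ℕ) : ℤ := ∑ i with i.val < j, stepSign (w i)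

section height

variable {m : ℕ} (w : Fin m → DyckStep)

theorem height_zero : height w 0 = 0 := by simp [height]

theorem height_succ (i : Fin m) : height w (i + 1) = height w i + stepSign (w i) := by
  have : (Finset.univ.filter fun x : Fin m => x.val < i + 1) =
      insert i (Finset.univ.filter fun x : Fin m => x.val < i) := by
    ext x; simp only [Finset.mem_filter, Finset.mem_univ, true_and, Finset.mem_insert, Fin.ext_iff]
    omega
  unfold height
  rw [this, Finset.sum_insert (by simp), add_comm]

theorem height_add {a b : ℕ} (hab : a ≤ b) :
    height w b = height w a + ∑ i with a ≤ i.val ∧ i.val < b, stepSign (w i) := by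
  unfold height
  rw [← Finset.sum_union]
  · congr 1
    ext x; simp only [Finset.mem_filter, Finset.mem_univ, true_and, Finset.mem_union]
    omega
  · rw [Finset.disjoint_left]
    intro x; simp only [Finset.mem_filter, Finset.mem_univ, true_and]
    omega

theorem height_of_le {j : ℕ} (hj : m ≤ j) : height w j = height w m := by
  rw [height_add w hj, Finset.sum_eq_zero, add_zero]
  intro x hx
  simp at hx
  omega

theorem count_take_ofFn (j : ℕ) :
    (((List.ofFn w).take j).count .U : ℤ) - ((List.ofFn w).take j).count .D = height w j := by
  induction j with
  | zero => simp [height_zero]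
  | succ j ih =>
    by_cases hj : j < m
    · rw [List.take_succ_eq_append_getElem (by simpa using hj), height_succ w ⟨j, hj⟩, ← ih]
      rcases h : w ⟨j, hj⟩ <;> simp [h, stepSign] <;> ring
    · rw [height_of_le w (by omega : m ≤ j + 1), ← height_of_le w (by omega : m ≤ j), ← ih,
        List.take_of_length_le (by simp; omega), List.take_of_length_le (by simp; omega)]

/-- Up-step `i` and down-step `j` face each other. -/
def FacingSteps (i j : Fin m) : Prop :=
  i < j ∧ height w i = height w (j + 1) ∧ ∀ l : ℕ, i.val < l → l ≤ j.val → height w i < height w l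

variable {w}

theorem stepSign_cases (s : DyckStep) : s = .U ∧ stepSign s = 1 ∨ s = .D ∧ stepSign s = -1 := by
  cases s <;> simp [stepSign]

theorem FacingSteps.left_eq {i j : Fin m} (h : FacingSteps w i j) : w i = .U := by
  obtain ⟨h1, h2, h3⟩ := h
  have := h3 (i + 1) (by omega) h1
  rw [height_succ] at this
  rcases stepSign_cases (w i) with h | h <;> [exact h.1; omega]

theorem FacingSteps.right_eq {i j : Fin m} (h : FacingSteps w i j) : w j = .D := by
  obtain ⟨h1, h2, h3⟩ := h
  have := h3 j h1 le_rfl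
  rw [height_succ] at h2
  rcases stepSign_cases (w j) with h | h <;> [omega; exact h.1]

theorem FacingSteps.right_unique {i j j' : Fin m} (h : FacingSteps w i j)
    (h' : FacingSteps w i j') : j = j' := by
  wlog hlt : j < j' generalizing j j'
  · rcases lt_trichotomy j j' with h1 | h1 | h1
    · exact this h h' h1
    · exact h1
    · exact (this h' h h1).symm
  have := h'.2.2 (j + 1) (by have := h.1; omega) hlt
  have := h.2.1
  omega

theorem FacingSteps.left_unique {i i' j : Fin m} (h : FacingSteps w i j)
    (h' : FacingSteps w i' j) : i = i' := by
  wlog hlt : i < i' generalizing i i'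
  · rcases lt_trichotomy i i' with h1 | h1 | h1
    · exact this h h' h1
    · exact h1
    · exact (this h' h h1).symm
  have := h.2.2 i' hlt (by have := h'.1; omega)
  have := h.2.1
  have := h'.2.1
  omega

theorem FacingSteps.partner_unique {i j j' : Fin m} (h : FacingSteps w i j ∨ FacingSteps w j i)
    (h' : FacingSteps w i j' ∨ FacingSteps w j' i) : j = j' := by
  rcases h with h | h <;> rcases h' with h' | h'
  · exact h.right_unique h'
  · have := h.left_eq; rw [h'.right_eq] at this; cases this
  · have := h'.left_eq; rw [h.right_eq] at this; cases this
  · exact h.left_unique h'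

/-- The partner is the step ending at the first later time when the height is back to at most its
value before `i`. Such a time exists because the walk ends at height zero, and the heights are equal
there because steps have size one. -/
theorem exists_facingSteps_right (hend : height w m = 0) (hnn : ∀ j, 0 ≤ height w j) {i : Fin m}
    (hi : w i = .U) : ∃ j, FacingSteps w i j := by
  have hi1 : height w (i + 1) = height w i + 1 := by rw [height_succ, hi, stepSign_U]
  have hex : ∃ l, i.val < l ∧ height w l ≤ height w i := ⟨m, i.2, by rw [hend]; exact hnn _⟩
  classical
  obtain ⟨h1, h2⟩ := Nat.find_spec hex
  have hmin := fun l => Nat.find_min hex (m := l)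
  have hle : Nat.find hex ≤ m := Nat.find_min' hex ⟨i.2, by rw [hend]; exact hnn _⟩
  generalize Nat.find hex = l at *
  have hne : l ≠ i + 1 := fun h => by rw [h] at h2; omega
  have hlt : ∀ k, i.val < k → k < l → height w i < height w k := fun k hk hkl => by
    by_contra! hc
    exact hmin k hkl ⟨hk, hc⟩
  refine ⟨⟨l - 1, by omega⟩, ?_, ?_, ?_⟩
  · show i.val < l - 1; omega
  · have hs := height_succ w ⟨l - 1, by omega⟩
    have hp := hlt (l - 1) (by omega) (by omega)
    simp only [show l - 1 + 1 = l by omega] at hs ⊢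
    rcases stepSign_cases (w ⟨l - 1, by omega⟩) with h | h <;> omega
  · intro k hk hkl
    exact hlt k hk (by simp only at hkl; omega)

/-- The partner starts at the last time not after `j` when the height was at most the value reached
after `j`; time zero is such a time. -/
theorem exists_facingSteps_left (hnn : ∀ j, 0 ≤ height w j) {j : Fin m} (hj : w j = .D) :
    ∃ i, FacingSteps w i j := by
  have hj1 : height w (j + 1) = height w j - 1 := by rw [height_succ, hj, stepSign_D]; rfl
  classical
  have h0 : height w 0 ≤ height w (j + 1) := by rw [height_zero]; exact hnn _
  have h1 := Nat.findGreatest_spec (P := fun l => height w l ≤ height w (j + 1))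
    (Nat.zero_le j.val) h0
  have h2 := fun k => Nat.findGreatest_is_greatest (P := fun l => height w l ≤ height w (j + 1))
    (n := j.val) (k := k)
  have h3 := Nat.findGreatest_le (P := fun l => height w l ≤ height w (j + 1)) j.val
  generalize Nat.findGreatest (fun l => height w l ≤ height w (j + 1)) j.val = i at *
  have hne : i ≠ j := fun h => by rw [h] at h1; omega
  have hs := height_succ w ⟨i, by omega⟩
  have h4 := h2 (i + 1) (by omega) (by omega)
  have heq : height w i = height w (j + 1) := by
    simp only at hs
    rcases stepSign_cases (w ⟨i, by omega⟩) with h | h <;> omega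
  refine ⟨⟨i, by omega⟩, ?_, heq, ?_⟩
  · show i < j.val; omega
  · intro l hl hlj
    have := h2 l hl hlj
    simp only
    omega

end height

namespace ArchSystem

variable {k : ℕ}

/-- Openings of arches are up-steps, closings are down-steps. -/
def word (f : ArchSystem k) (i : Fin (2 * k)) : DyckStep := if i < f.1 i then .U else .D

theorem lt_or_lt (f : ArchSystem k) (i : Fin (2 * k)) : i < f.1 i ∨ f.1 i < i :=
  lt_or_gt_of_ne (f.2.2.1 i).symm

theorem word_apply (f : ArchSystem k) (i : Fin (2 * k)) :
    f.word (f.1 i) = .U ∧ f.word i = .D ∨ f.word (f.1 i) = .D ∧ f.word i = .U := by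
  unfold word
  rw [f.2.1]
  rcases f.lt_or_lt i with h | h <;> simp [h, h.not_gt]

/-- Every closing point of `S` is sent injectively by `f` to an opening point of `S`. -/
theorem sum_nonneg (f : ArchSystem k) (S : Finset (Fin (2 * k)))
    (hS : ∀ i ∈ S, f.1 i < i → f.1 i ∈ S) : 0 ≤ ∑ i ∈ S, stepSign (f.word i) := by
  have h : ∀ i, stepSign (f.word i) =
      (if i < f.1 i then 1 else 0) - (if f.1 i < i then 1 else 0) := fun i => by
    unfold word
    rcases f.lt_or_lt i with h | h <;> simp [h, h.not_gt, stepSign]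
  simp only [h, Finset.sum_sub_distrib, Finset.sum_boole]
  have := Finset.card_le_card_of_injOn (s := S.filter fun i => f.1 i < i)
    (t := S.filter fun i => i < f.1 i) f.1 (fun i hi => by
      simp only [Finset.coe_filter, Set.mem_ofPred_eq] at hi ⊢
      exact ⟨hS i hi.1 hi.2, by rw [f.2.1]; exact hi.2⟩) f.1.injective.injOn
  simp only [sub_nonneg]
  exact_mod_cast this

theorem sum_eq_zero (f : ArchSystem k) (S : Finset (Fin (2 * k)))
    (hS : ∀ i ∈ S, f.1 i ∈ S) : ∑ i ∈ S, stepSign (f.word i) = 0 :=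
  Finset.sum_involution (fun i _ => f.1 i) (fun i _ => by
      rcases f.word_apply i with h | h <;> rw [h.1, h.2] <;> rfl)
    (fun i _ _ => f.2.2.1 i) (fun i hi => hS i hi) (fun i _ => f.2.1 i)

theorem height_word_nonneg (f : ArchSystem k) (j : ℕ) : 0 ≤ height f.word j := by
  refine f.sum_nonneg _ fun i hi hlt => ?_
  simp only [Finset.mem_filter, Finset.mem_univ, true_and] at hi ⊢
  omega

theorem height_word_end (f : ArchSystem k) : height f.word (2 * k) = 0 :=
  f.sum_eq_zero _ fun i _ => by simp

theorem not_crossing (f : ArchSystem k) {i j : Fin (2 * k)} (h1 : i < j) (h2 : j < f.1 i)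
    (h3 : f.1 i < f.1 j) : False :=
  f.2.2.2 ⟨i, j, h1, h2, h3⟩

/-- By non-crossing, the points strictly under an arch are matched among themselves, so the height
is the same at both ends. A closing point under the arch has its opening under it too, so the height
never falls back in between. -/
theorem facingSteps (f : ArchSystem k) {i : Fin (2 * k)} (hi : i < f.1 i) :
    FacingSteps f.word i (f.1 i) := by
  have hiU : f.word i = .U := if_pos hi
  have hfD : f.word (f.1 i) = .D := by
    rcases f.word_apply i with h | h <;> [(rw [h.2] at hiU; cases hiU); exact h.1]
  have hi1 : height f.word (i + 1) = height f.word i + 1 := by rw [height_succ, hiU, stepSign_U]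
  have key : ∀ m : Fin (2 * k), i < m → m < f.1 i → i < f.1 m := by
    intro m h1 h2
    by_contra! hc
    have hne : f.1 m ≠ i := fun h => by rw [← h, f.2.1] at h2; exact h2.false
    refine f.not_crossing (lt_of_le_of_ne hc hne) ?_ ?_ <;> rw [f.2.1] <;> assumption
  refine ⟨hi, ?_, ?_⟩
  · have h1 := height_add f.word (show i.val + 1 ≤ f.1 i from hi)
    rw [f.sum_eq_zero, add_zero] at h1
    · rw [height_succ, hfD, stepSign_D]
      omega
    · intro m hm
      simp only [Finset.mem_filter, Finset.mem_univ, true_and] at hm ⊢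
      have h2 := key m hm.1 hm.2
      refine ⟨h2, ?_⟩
      by_contra! hc
      have hne : f.1 i ≠ f.1 m := fun h => by
        have := f.1.injective h; omega
      exact f.not_crossing hm.1 hm.2 (lt_of_le_of_ne hc hne)
  · intro l hl hlf
    have h1 := height_add f.word (show i.val + 1 ≤ l from hl)
    have := f.sum_nonneg (Finset.univ.filter fun x => i.val + 1 ≤ x.val ∧ x.val < l) ?_
    · omega
    · intro m hm hlt
      simp only [Finset.mem_filter, Finset.mem_univ, true_and] at hm ⊢
      have := key m hm.1 (by omega)
      omega

theorem facingSteps_or (f : ArchSystem k) (i : Fin (2 * k)) :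
    FacingSteps f.word i (f.1 i) ∨ FacingSteps f.word (f.1 i) i := by
  rcases f.lt_or_lt i with h | h
  · exact .inl (f.facingSteps h)
  · have := f.facingSteps (i := f.1 i) (by rwa [f.2.1])
    rw [f.2.1] at this
    exact .inr this

theorem word_injective : Function.Injective (word (k := k)) := by
  intro f g h
  refine Subtype.ext (Equiv.ext fun i => ?_)
  have hf := f.facingSteps_or i
  rw [h] at hf
  exact FacingSteps.partner_unique hf (g.facingSteps_or i)

/-- Matching each step with the step facing it gives the arches. For a crossing `i < j < f i < f j`,
the first arch forces the height after `f i` below that before `j`, and the second forces the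
opposite. -/
theorem exists_word_eq (w : Fin (2 * k) → DyckStep) (hnn : ∀ j, 0 ≤ height w j)
    (hend : height w (2 * k) = 0) : ∃ f : ArchSystem k, f.word = w := by
  have hex : ∀ i, ∃ j, FacingSteps w i j ∨ FacingSteps w j i := fun i => by
    rcases stepSign_cases (w i) with h | h
    · obtain ⟨j, hj⟩ := exists_facingSteps_right hend hnn h.1
      exact ⟨j, .inl hj⟩
    · obtain ⟨j, hj⟩ := exists_facingSteps_left hnn h.1
      exact ⟨j, .inr hj⟩
  choose f hf using hex
  have hinv : ∀ i, f (f i) = i := fun i => FacingSteps.partner_unique (hf (f i)) (hf i).symm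
  have hlt : ∀ i, i < f i → FacingSteps w i (f i) := fun i hi =>
    (hf i).resolve_right fun h => (hi.trans h.1).false
  refine ⟨⟨Function.Involutive.toPerm f hinv, hinv, fun i h => ?_, ?_⟩, ?_⟩
  · have := hf i
    change f i = i at h
    rw [h] at this
    rcases this with h | h <;> exact h.1.false
  · rintro ⟨i, j, h1, h2, h3⟩
    change j < f i at h2
    change f i < f j at h3
    have hi := hlt i (h1.trans h2)
    have hj := hlt j (h2.trans h3)
    have e1 := hi.2.1
    have e2 := hi.2.2 j h1 h2.le
    have e3 := hj.2.2 (f i + 1) (by omega) h3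
    omega
  · funext i
    unfold word
    change (if i < f i then _ else _) = _
    rcases hf i with h | h
    · rw [if_pos h.1, h.left_eq]
    · rw [if_neg h.1.not_gt, h.right_eq]

/-- The Dyck word of an arch system. -/
def toDyckWord (f : ArchSystem k) : {p : DyckWord // p.semilength = k} :=
  have hcount : (List.ofFn f.word).count .U = (List.ofFn f.word).count .D := by
    have := count_take_ofFn f.word (2 * k)
    rw [f.height_word_end, List.take_of_length_le (by simp)] at this
    omega
  ⟨⟨List.ofFn f.word, hcount, fun i => by
      have := count_take_ofFn f.word i
      have := f.height_word_nonneg i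
      omega⟩, by
    have h := DyckWord.two_mul_semilength_eq_length (p := ⟨List.ofFn f.word, hcount, fun i => by
      have := count_take_ofFn f.word i
      have := f.height_word_nonneg i
      omega⟩)
    simp only [List.length_ofFn] at h
    omega⟩

theorem toDyckWord_bijective : Function.Bijective (toDyckWord (k := k)) := by
  constructor
  · intro f g h
    have := congrArg (fun p => p.1.toList) h
    exact word_injective (List.ofFn_injective this)
  · rintro ⟨p, hp⟩
    have hlen := p.two_mul_semilength_eq_length
    rw [hp] at hlen
    set w : Fin (2 * k) → DyckStep := fun i => p.toList[i] with hw
    have hof : List.ofFn w = p.toList := by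
      refine List.ext_getElem (by simp [hlen]) fun i h1 h2 => by simp [hw]
    obtain ⟨f, hf⟩ := exists_word_eq w (fun j => by
        rw [← count_take_ofFn, hof]
        have := p.count_D_le_count_U j
        omega)
      (by
        rw [← count_take_ofFn, hof, List.take_of_length_le (by omega)]
        have := p.count_U_eq_count_D
        omega)
    refine ⟨f, Subtype.ext (DyckWord.ext ?_)⟩
    show List.ofFn f.word = _
    rw [hf, hof]

instance : Finite (ArchSystem k) := by unfold ArchSystem; infer_instance

theorem card_eq_catalan (k : ℕ) : Nat.card (ArchSystem k) = catalan k := by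
  rw [Nat.card_congr (Equiv.ofBijective _ toDyckWord_bijective), Nat.card_eq_fintype_card,
    DyckWord.card_dyckWord_semilength_eq_catalan]

theorem card_eq (n : ℕ) : (Nat.card (ArchSystem (n + 1)) : ℚ) =
    (2 * n + 2).factorial / ((n + 1).factorial * (n + 2).factorial) := by
  rw [card_eq_catalan, eq_div_iff (by positivity)]
  have h1 := succ_mul_catalan_eq_centralBinom (n + 1)
  have h2 := Nat.choose_mul_factorial_mul_factorial (show n + 1 ≤ 2 * (n + 1) by omega)
  rw [← Nat.centralBinom_eq_two_mul_choose, ← h1, show 2 * (n + 1) - (n + 1) = n + 1 by omega] at h2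
  rw [Nat.factorial_succ (n + 1)]
  rw [show 2 * n + 2 = 2 * (n + 1) by ring]
  norm_cast
  rw [← h2]
  ring

end ArchSystem

/-! ### Plane trees as pairs of permutations, and their contour -/

section PlaneTree

variable {D : Type*} (σ τ : Perm D)

/-- A plane tree with vertices of degree four, given by its half-edges: `σ` is the rotation around
the vertices, `τ` exchanges the two halves of an inner edge and fixes the leaves, `h` is the
distance from the vertex of the root leaf `r`. -/
structure IsPlaneTree (h : D → ℕ) (r : D) : Prop where
  tau_tau : ∀ x, τ (τ x) = x
  sigma_four : ∀ x, σ (σ (σ (σ x))) = x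
  sigma_ne : ∀ x, σ x ≠ x
  sigma_two_ne : ∀ x, σ (σ x) ≠ x
  height_sigma : ∀ x, h (σ x) = h x
  height_tau : ∀ x, τ x = x ∨ h (τ x) = h x + 1 ∨ h x = h (τ x) + 1
  outward : ∀ x, h (τ x) = h x + 1 →
    (τ (σ (τ x)) = σ (τ x) ∨ h (τ (σ (τ x))) = h (τ x) + 1) ∧
    (τ (σ (σ (τ x))) = σ (σ (τ x)) ∨ h (τ (σ (σ (τ x)))) = h (τ x) + 1) ∧
    (τ (σ (σ (σ (τ x)))) = σ (σ (σ (τ x))) ∨ h (τ (σ (σ (σ (τ x))))) = h (τ x) + 1)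
  tau_root : τ r = r
  height_root : h r = 0
  transitive : ∀ S : Set D, r ∈ S → (∀ x ∈ S, σ x ∈ S) → (∀ x ∈ S, τ x ∈ S) → ∀ x, x ∈ S

/-- The part of the plane tree seen from `d` is `t`. -/
def HasShape : TernaryTree → D → Prop
  | .leaf, d => τ d = d
  | .node a b c, d => τ d ≠ d ∧ HasShape a (σ (τ d)) ∧ HasShape b (σ (σ (τ d))) ∧
      HasShape c (σ (σ (σ (τ d))))

/-- The list of half-edges met when walking around the part of the plane tree seen from `d`. -/
def contour : TernaryTree → D → List D
  | .leaf, d => [d]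
  | .node a b c, d => d :: (contour a (σ (τ d)) ++ contour b (σ (σ (τ d))) ++
      contour c (σ (σ (σ (τ d)))) ++ [τ d])

/-- The list of leaves met when walking around the part of the plane tree seen from `d`. -/
def leafList : TernaryTree → D → List D
  | .leaf, d => [d]
  | .node a b c, d => leafList a (σ (τ d)) ++ leafList b (σ (σ (τ d))) ++
      leafList c (σ (σ (σ (τ d))))

/-- The plane tree with root leaf `r` is `t`. -/
def HasRootShape : TernaryTree → D → Prop
  | .leaf, _ => False
  | .node a b c, r => HasShape σ τ a (σ r) ∧ HasShape σ τ b (σ (σ r)) ∧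
      HasShape σ τ c (σ (σ (σ r)))

/-- The list of half-edges met when walking around the plane tree from the root leaf. -/
def rootContour : TernaryTree → D → List D
  | .leaf, _ => []
  | .node a b c, r => r :: (contour σ τ a (σ r) ++ contour σ τ b (σ (σ r)) ++
      contour σ τ c (σ (σ (σ r))))

/-- The list of leaves met when walking around the plane tree from the root leaf. -/
def rootLeafList : TernaryTree → D → List D
  | .leaf, _ => []
  | .node a b c, r => r :: (leafList σ τ a (σ r) ++ leafList σ τ b (σ (σ r)) ++
      leafList σ τ c (σ (σ (σ r))))

variable {σ τ} {h : D → ℕ} {r : D}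

theorem HasShape.unique : ∀ {t t' : TernaryTree} {d : D}, HasShape σ τ t d → HasShape σ τ t' d →
    t = t'
  | .leaf, .leaf, _, _, _ => rfl
  | .leaf, .node _ _ _, _, h, h' => absurd h h'.1
  | .node _ _ _, .leaf, _, h, h' => absurd h' h.1
  | .node _ _ _, .node _ _ _, _, h, h' => by
    rw [h.2.1.unique h'.2.1, h.2.2.1.unique h'.2.2.1, h.2.2.2.unique h'.2.2.2]

theorem HasRootShape.unique {t t' : TernaryTree} (h : HasRootShape σ τ t r)
    (h' : HasRootShape σ τ t' r) : t = t' := by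
  cases t with
  | leaf => exact h.elim
  | node a b c =>
    cases t' with
    | leaf => exact h'.elim
    | node a' b' c' => rw [h.1.unique h'.1, h.2.1.unique h'.2.1, h.2.2.unique h'.2.2]

/-- Walking away from the root strictly increases `h`, which is bounded because `D` is finite; the
induction is on the number of levels that remain. -/
theorem IsPlaneTree.exists_hasShape [Finite D] (H : IsPlaneTree σ τ h r) (d : D)
    (hd : τ d = d ∨ h (τ d) = h d + 1) : ∃ t, HasShape σ τ t d := by
  obtain ⟨B, hB⟩ := (Set.finite_range h).bddAbove
  have hB : ∀ x, h x ≤ B := fun x => hB ⟨x, rfl⟩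
  obtain ⟨N, hN⟩ : ∃ N, B ≤ N + h d := ⟨B, by omega⟩
  induction N generalizing d with
  | zero =>
    rcases hd with hd | hd
    · exact ⟨.leaf, hd⟩
    · have := hB (τ d); omega
  | succ N ih =>
    rcases hd with hd | hd
    · exact ⟨.leaf, hd⟩
    · obtain ⟨h1, h2, h3⟩ := H.outward d hd
      have hs := H.height_sigma
      obtain ⟨a, ha⟩ := ih _ (by rwa [hs]) (by simp only [hs]; omega)
      obtain ⟨b, hb⟩ := ih _ (by rwa [hs, hs]) (by simp only [hs]; omega)
      obtain ⟨c, hc⟩ := ih _ (by rwa [hs, hs, hs]) (by simp only [hs]; omega)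
      exact ⟨.node a b c, fun h0 => by rw [h0] at hd; omega, ha, hb, hc⟩

/-- The permutation `σ * τ` walks around the tree: it enters the subtree through `d`, visits the
children in turn, comes back through `τ d` and leaves at `σ d`. A node adds its two halves `d` and
`τ d` to three child contours, so the length `4 * t.inner + 1` is reproduced. -/
theorem iterate_contour (hσ : ∀ x, σ (σ (σ (σ x))) = x) (hτ : ∀ x, τ (τ x) = x)
    {t : TernaryTree} {d : D} (ht : HasShape σ τ t d) :
    contour σ τ t d = List.iterate (σ * τ) d (4 * t.inner + 1) ∧
      (σ * τ)^[4 * t.inner + 1] d = σ d := by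
  induction t generalizing d with
  | leaf =>
    change τ d = d at ht
    simp [contour, TernaryTree.inner, ht]
  | node a b c iha ihb ihc =>
    obtain ⟨-, ha, hb, hc⟩ := ht
    obtain ⟨a1, a2⟩ := iha ha
    obtain ⟨b1, b2⟩ := ihb hb
    obtain ⟨c1, c2⟩ := ihc hc
    have hn : 4 * (TernaryTree.node a b c).inner + 1 =
        1 + ((4 * a.inner + 1) + ((4 * b.inner + 1) + ((4 * c.inner + 1) + 1))) := by
      simp only [TernaryTree.inner]; ring
    rw [hn]
    generalize 4 * a.inner + 1 = na at *
    generalize 4 * b.inner + 1 = nb at *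
    generalize 4 * c.inner + 1 = nc at *
    constructor
    · rw [contour, a1, b1, c1, List.iterate_add, List.iterate_add, List.iterate_add,
        List.iterate_add]
      simp only [List.iterate, Function.iterate_one, Perm.mul_apply, List.append_assoc,
        List.cons_append, List.nil_append]
      rw [a2, b2, c2, hσ]
    · rw [show 1 + (na + (nb + (nc + 1))) = 1 + (nc + (nb + (na + 1))) by ring,
        Function.iterate_add_apply, Function.iterate_add_apply, Function.iterate_add_apply,
        Function.iterate_add_apply, Function.iterate_one, Perm.mul_apply, Perm.mul_apply, a2, b2,
        c2, hσ, hτ]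

theorem iterate_rootContour (hσ : ∀ x, σ (σ (σ (σ x))) = x) (hτ : ∀ x, τ (τ x) = x)
    (hr : τ r = r) {t : TernaryTree} (ht : HasRootShape σ τ t r) :
    rootContour σ τ t r = List.iterate (σ * τ) r (4 * t.inner) ∧ (σ * τ)^[4 * t.inner] r = r := by
  cases t with
  | leaf => exact ht.elim
  | node a b c =>
    obtain ⟨ha, hb, hc⟩ := ht
    obtain ⟨a1, a2⟩ := iterate_contour hσ hτ ha
    obtain ⟨b1, b2⟩ := iterate_contour hσ hτ hb
    obtain ⟨c1, c2⟩ := iterate_contour hσ hτ hc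
    rw [show 4 * (TernaryTree.node a b c).inner =
        1 + ((4 * a.inner + 1) + ((4 * b.inner + 1) + (4 * c.inner + 1))) by
      simp only [TernaryTree.inner]; ring]
    generalize 4 * a.inner + 1 = na at *
    generalize 4 * b.inner + 1 = nb at *
    generalize 4 * c.inner + 1 = nc at *
    constructor
    · rw [rootContour, a1, b1, c1, List.iterate_add, List.iterate_add, List.iterate_add]
      simp only [List.iterate, Function.iterate_one, Perm.mul_apply, List.append_assoc,
        List.cons_append, List.nil_append, hr]
      rw [a2, b2]
    · rw [show 1 + (na + (nb + nc)) = nc + (nb + (na + 1)) by ring,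
        Function.iterate_add_apply, Function.iterate_add_apply, Function.iterate_add_apply,
        Function.iterate_one, Perm.mul_apply, hr, a2, b2, c2, hσ]

theorem tau_mem_contour (hτ : ∀ x, τ (τ x) = x) {t : TernaryTree} {d : D}
    (ht : HasShape σ τ t d) {x : D} (hx : x ∈ contour σ τ t d) : τ x ∈ contour σ τ t d := by
  induction t generalizing d with
  | leaf =>
    change τ d = d at ht
    simp only [contour, List.mem_singleton] at hx ⊢
    rw [hx, ht]
  | node a b c iha ihb ihc =>
    obtain ⟨-, ha, hb, hc⟩ := ht
    simp only [contour, List.mem_cons, List.mem_append, List.not_mem_nil, or_false] at hx ⊢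
    rcases hx with rfl | ((hx | hx) | hx) | rfl
    · simp
    · simp [iha ha hx]
    · simp [ihb hb hx]
    · simp [ihc hc hx]
    · simp [hτ]

theorem tau_mem_rootContour (hτ : ∀ x, τ (τ x) = x) (hr : τ r = r) {t : TernaryTree}
    (ht : HasRootShape σ τ t r) {x : D} (hx : x ∈ rootContour σ τ t r) :
    τ x ∈ rootContour σ τ t r := by
  cases t with
  | leaf => exact ht.elim
  | node a b c =>
    obtain ⟨ha, hb, hc⟩ := ht
    simp only [rootContour, List.mem_cons, List.mem_append] at hx ⊢
    rcases hx with rfl | (hx | hx) | hx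
    · simp [hr]
    · simp [tau_mem_contour hτ ha hx]
    · simp [tau_mem_contour hτ hb hx]
    · simp [tau_mem_contour hτ hc hx]

theorem IsPlaneTree.eq_or_lt_of_mem_contour (H : IsPlaneTree σ τ h r) {t : TernaryTree} {d : D}
    (hd : τ d = d ∨ h (τ d) = h d + 1) (ht : HasShape σ τ t d) {x : D}
    (hx : x ∈ contour σ τ t d) : x = d ∨ h d < h x := by
  induction t generalizing d with
  | leaf => exact .inl (by simpa [contour] using hx)
  | node a b c iha ihb ihc =>
    obtain ⟨h0, ha, hb, hc⟩ := ht
    have hd := hd.resolve_left h0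
    obtain ⟨o1, o2, o3⟩ := H.outward d hd
    have hs := H.height_sigma
    simp only [contour, List.mem_cons, List.mem_append, List.not_mem_nil, or_false] at hx
    rcases hx with rfl | ((hx | hx) | hx) | rfl
    · exact .inl rfl
    · right; rcases iha (by rwa [hs]) ha hx with rfl | h1
      · rw [hs]; omega
      · rw [hs] at h1; omega
    · right; rcases ihb (by rwa [hs, hs]) hb hx with rfl | h1
      · rw [hs, hs]; omega
      · rw [hs, hs] at h1; omega
    · right; rcases ihc (by rwa [hs, hs, hs]) hc hx with rfl | h1
      · rw [hs, hs, hs]; omega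
      · rw [hs, hs, hs] at h1; omega
    · right; omega

theorem IsPlaneTree.sigma_three_ne (H : IsPlaneTree σ τ h r) (x : D) : σ (σ (σ x)) ≠ x :=
  fun h0 => H.sigma_ne x (by conv_rhs => rw [← H.sigma_four x, h0])

theorem IsPlaneTree.outward_of_height_eq_zero (H : IsPlaneTree σ τ h r) {x : D} (hx : h x = 0) :
    τ x = x ∨ h (τ x) = h x + 1 := by
  rcases H.height_tau x with h1 | h1 | h1
  · exact .inl h1
  · exact .inr h1
  · omega

theorem IsPlaneTree.exists_hasRootShape [Finite D] (H : IsPlaneTree σ τ h r) :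
    ∃ t, HasRootShape σ τ t r := by
  have hs := H.height_sigma
  have hr := H.height_root
  obtain ⟨a, ha⟩ := H.exists_hasShape (σ r) (H.outward_of_height_eq_zero (by rw [hs, hr]))
  obtain ⟨b, hb⟩ := H.exists_hasShape (σ (σ r)) (H.outward_of_height_eq_zero (by rw [hs, hs, hr]))
  obtain ⟨c, hc⟩ := H.exists_hasShape (σ (σ (σ r)))
    (H.outward_of_height_eq_zero (by rw [hs, hs, hs, hr]))
  exact ⟨.node a b c, ha, hb, hc⟩

variable {t : TernaryTree}

/-- The contour is stable under `τ` by its shape and under `σ * τ` by periodicity, hence under `σ =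
(σ * τ) * τ`, and transitivity applies. -/
theorem IsPlaneTree.mem_rootContour (H : IsPlaneTree σ τ h r) (ht : HasRootShape σ τ t r) (x : D) :
    x ∈ rootContour σ τ t r := by
  obtain ⟨h1, h2⟩ := iterate_rootContour H.sigma_four H.tau_tau H.tau_root ht
  have hτ : ∀ x ∈ rootContour σ τ t r, τ x ∈ rootContour σ τ t r := fun x =>
    tau_mem_rootContour H.tau_tau H.tau_root ht
  have h0 : r ∈ rootContour σ τ t r := by
    cases t with
    | leaf => exact ht.elim
    | node a b c => simp [rootContour]
  refine H.transitive {x | x ∈ rootContour σ τ t r} h0 (fun x hx => ?_) hτ x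
  have hx' := hτ x hx
  show σ x ∈ rootContour σ τ t r
  rw [h1, List.mem_iterate] at h0 hx' ⊢
  obtain ⟨m, hm, hx'⟩ := hx'
  have hσ : σ x = (σ * τ)^[m + 1] r := by
    rw [Function.iterate_succ_apply', ← hx', Perm.mul_apply, H.tau_tau]
  rcases Nat.lt_or_ge (m + 1) (4 * t.inner) with hlt | hge
  · exact ⟨m + 1, hlt, hσ⟩
  · refine ⟨0, by omega, ?_⟩
    rw [hσ, show m + 1 = 4 * t.inner by omega, h2]
    rfl

/-- An early return to `r` would place `r` in the contour of a child subtree. There every half-edge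
is either higher than the root vertex or the first one, which is `σ r`, `σ (σ r)` or `σ (σ (σ r))`.
-/
theorem IsPlaneTree.minimalPeriod_eq (H : IsPlaneTree σ τ h r) (ht : HasRootShape σ τ t r) :
    Function.minimalPeriod (σ * τ) r = 4 * t.inner := by
  obtain ⟨h1, h2⟩ := iterate_rootContour H.sigma_four H.tau_tau H.tau_root ht
  have hpos : 0 < t.inner := by
    cases t with
    | leaf => exact ht.elim
    | node a b c => simp [TernaryTree.inner]
  refine le_antisymm (Function.IsPeriodicPt.minimalPeriod_le (by omega) h2) ?_
  by_contra! hlt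
  have hp0 : 0 < Function.minimalPeriod (σ * τ) r :=
    Function.IsPeriodicPt.minimalPeriod_pos (n := 4 * t.inner) (by omega) h2
  have hp := Function.iterate_minimalPeriod (f := σ * τ) (x := r)
  generalize Function.minimalPeriod (σ * τ) r = p at *
  obtain ⟨p, rfl⟩ : ∃ q, p = q + 1 := ⟨p - 1, by omega⟩
  have hs := H.height_sigma
  have hr := H.height_root
  cases t with
  | leaf => exact ht.elim
  | node a b c =>
    have hget : (rootContour σ τ (.node a b c) r)[p + 1]'(by rw [h1]; simpa using hlt) = r := by
      simp only [h1, List.getElem_iterate]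
      exact hp
    simp only [rootContour, List.getElem_cons_succ] at hget
    have hmem := List.mem_of_getElem hget
    simp only [List.mem_append] at hmem
    obtain ⟨ha, hb, hc⟩ := ht
    rcases hmem with (hm | hm) | hm
    · rcases H.eq_or_lt_of_mem_contour (H.outward_of_height_eq_zero (by rw [hs, hr])) ha hm with e | e
      · exact H.sigma_ne r e.symm
      · omega
    · rcases H.eq_or_lt_of_mem_contour (H.outward_of_height_eq_zero (by rw [hs, hs, hr])) hb hm
        with e | e
      · exact H.sigma_two_ne r e.symm
      · omega
    · rcases H.eq_or_lt_of_mem_contour (H.outward_of_height_eq_zero (by rw [hs, hs, hs, hr])) hc hm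
        with e | e
      · exact H.sigma_three_ne r e.symm
      · omega

/-- The half-edges of a plane tree, numbered along the contour. -/
noncomputable def IsPlaneTree.posEquiv (H : IsPlaneTree σ τ h r) (ht : HasRootShape σ τ t r) :
    Fin (4 * t.inner) ≃ D :=
  Equiv.ofBijective (fun i => (σ * τ)^[i.val] r) <| by
    constructor
    · intro i j hij
      have := Function.iterate_injOn_Iio_minimalPeriod (f := σ * τ) (x := r)
        (by rw [H.minimalPeriod_eq ht]; exact i.2) (by rw [H.minimalPeriod_eq ht]; exact j.2) hij
      exact Fin.ext this
    · intro x
      have hx := H.mem_rootContour ht x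
      rw [(iterate_rootContour H.sigma_four H.tau_tau H.tau_root ht).1, List.mem_iterate] at hx
      obtain ⟨m, hm, rfl⟩ := hx
      exact ⟨⟨m, hm⟩, rfl⟩

theorem IsPlaneTree.posEquiv_apply (H : IsPlaneTree σ τ h r) (ht : HasRootShape σ τ t r)
    (i : Fin (4 * t.inner)) : H.posEquiv ht i = (σ * τ)^[i.val] r := rfl

theorem IsPlaneTree.card_eq (H : IsPlaneTree σ τ h r) (ht : HasRootShape σ τ t r) :
    Nat.card D = 4 * t.inner := by
  rw [← Nat.card_congr (H.posEquiv ht), Nat.card_fin]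

theorem IsPlaneTree.rootContour_eq_ofFn (H : IsPlaneTree σ τ h r) (ht : HasRootShape σ τ t r) :
    rootContour σ τ t r = List.ofFn (H.posEquiv ht) := by
  rw [(iterate_rootContour H.sigma_four H.tau_tau H.tau_root ht).1]
  refine List.ext_getElem (by simp) fun i h1 h2 => ?_
  simp [H.posEquiv_apply]

theorem leafList_eq_filter [DecidableEq D] (hτ : ∀ x, τ (τ x) = x) {d : D}
    (ht : HasShape σ τ t d) :
    leafList σ τ t d = (contour σ τ t d).filter fun x => τ x = x := by
  induction t generalizing d with
  | leaf =>
    change τ d = d at ht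
    simp [leafList, contour, ht]
  | node a b c iha ihb ihc =>
    obtain ⟨h0, ha, hb, hc⟩ := ht
    have h0' : d ≠ τ d := fun h => h0 h.symm
    simp [leafList, contour, iha ha, ihb hb, ihc hc, h0, hτ, h0']

theorem rootLeafList_eq_filter [DecidableEq D] (hτ : ∀ x, τ (τ x) = x) (hr : τ r = r)
    (ht : HasRootShape σ τ t r) :
    rootLeafList σ τ t r = (rootContour σ τ t r).filter fun x => τ x = x := by
  cases t with
  | leaf => exact ht.elim
  | node a b c =>
    obtain ⟨ha, hb, hc⟩ := ht
    simp [rootLeafList, rootContour, leafList_eq_filter hτ ha, leafList_eq_filter hτ hb,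
      leafList_eq_filter hτ hc, hr]

theorem length_leafList (t : TernaryTree) (d : D) : (leafList σ τ t d).length = t.leaves := by
  induction t generalizing d with
  | leaf => rfl
  | node a b c iha ihb ihc => simp [leafList, iha, ihb, ihc, TernaryTree.leaves, add_assoc]

theorem length_rootLeafList (ht : HasRootShape σ τ t r) :
    (rootLeafList σ τ t r).length = 2 * (t.inner + 1) := by
  cases t with
  | leaf => exact ht.elim
  | node a b c =>
    have := (TernaryTree.node a b c).leaves_eq
    simp only [TernaryTree.leaves] at this
    simp only [rootLeafList, List.length_cons, List.length_append, length_leafList]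
    omega

theorem HasRootShape.exists_leaf_enum (ht : HasRootShape σ τ t r) :
    ∃ ℓ : Fin (2 * (t.inner + 1)) → D, List.ofFn ℓ = rootLeafList σ τ t r := by
  refine ⟨fun i => (rootLeafList σ τ t r)[i]'(by rw [length_rootLeafList ht]; exact i.2), ?_⟩
  exact List.ext_getElem (by rw [List.length_ofFn, length_rootLeafList ht])
    fun i h1 h2 => List.getElem_ofFn _

variable {m : ℕ} {ℓ : Fin m → D}

/-- The leaf list is the contour filtered by `τ x = x`, so the order of the leaves is that of their
contour positions. Comparisons of arches can thus be made on positions. -/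
theorem IsPlaneTree.strictMono_pos (H : IsPlaneTree σ τ h r) (ht : HasRootShape σ τ t r)
    (hℓ : List.ofFn ℓ = rootLeafList σ τ t r) :
    StrictMono fun i => (H.posEquiv ht).symm (ℓ i) := by
  classical
  have hp : (rootContour σ τ t r).Pairwise fun x y =>
      (H.posEquiv ht).symm x < (H.posEquiv ht).symm y := by
    rw [H.rootContour_eq_ofFn ht, List.pairwise_ofFn]
    intro i j hij
    simpa using hij
  have := hp.filter fun x => decide (τ x = x)
  rw [← rootLeafList_eq_filter H.tau_tau H.tau_root ht, ← hℓ, List.pairwise_ofFn] at this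
  exact fun i j hij => this hij

theorem IsPlaneTree.leaf_enum_injective (H : IsPlaneTree σ τ h r) (ht : HasRootShape σ τ t r)
    (hℓ : List.ofFn ℓ = rootLeafList σ τ t r) : Function.Injective ℓ := fun _ _ hij =>
  (H.strictMono_pos ht hℓ).injective (congrArg (H.posEquiv ht).symm hij)

theorem IsPlaneTree.exists_leaf_enum_eq_iff (H : IsPlaneTree σ τ h r) (ht : HasRootShape σ τ t r)
    (hℓ : List.ofFn ℓ = rootLeafList σ τ t r) (x : D) : (∃ i, ℓ i = x) ↔ τ x = x := by
  classical
  have : x ∈ List.ofFn ℓ ↔ τ x = x := by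
    rw [hℓ, rootLeafList_eq_filter H.tau_tau H.tau_root ht]
    simp [H.mem_rootContour ht x]
  rw [← this, List.mem_ofFn]

end PlaneTree

/-! ### Trees among multigraphs: counting edges and separating edges -/

section Multigraph

variable {V U : Type*} [Finite V] {G : SimpleGraph V} {a b : U → V}

/-- Here `U` is the edge set of a multigraph whose underlying simple graph is `G`. Connectedness
requires at least `|V| - 1 = |U|` simple edges, so there is no loop or double edge and `G` is a
tree; the component of `a u` after removing `u` is the required set. -/
theorem isTree_and_separating_of_card_eq [Finite U]
    (hG : ∀ f g, G.Adj f g ↔ f ≠ g ∧ ∃ u, s(a u, b u) = s(f, g)) (hc : G.Connected)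
    (hcard : Nat.card V = Nat.card U + 1) :
    G.IsTree ∧ ∀ u, ∃ S : Set V, a u ∈ S ∧ b u ∉ S ∧ ∀ u' ≠ u, (a u' ∈ S ↔ b u' ∈ S) := by
  have hex : ∀ e : G.edgeSet, ∃ u, s(a u, b u) = e.1 := by
    rintro ⟨⟨f, g⟩, he⟩
    exact ((hG f g).1 he).2
  choose φ hφ using hex
  have hinj : Function.Injective φ := fun e e' h => Subtype.ext (by rw [← hφ, ← hφ, h])
  have h1 := hc.card_vert_le_card_edgeSet_add_one
  have h2 := Nat.card_le_card_of_injective φ hinj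
  have hbij := hinj.bijective_of_nat_card_le (by omega)
  have htree : G.IsTree := SimpleGraph.isTree_iff_connected_and_card.2 ⟨hc, by omega⟩
  refine ⟨htree, fun u => ?_⟩
  have hadj : ∀ u, G.Adj (a u) (b u) := fun u => by
    obtain ⟨e, rfl⟩ := hbij.2 u
    rw [← SimpleGraph.mem_edgeSet, hφ]
    exact e.2
  have hbr := SimpleGraph.isAcyclic_iff_forall_adj_isBridge.1 htree.isAcyclic (hadj u)
  rw [SimpleGraph.isBridge_iff] at hbr
  refine ⟨{x | (G.deleteEdges {s(a u, b u)}).Reachable (a u) x}, SimpleGraph.Reachable.refl _,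
    hbr, fun u' hu' => ?_⟩
  have hadj' : (G.deleteEdges {s(a u, b u)}).Adj (a u') (b u') := by
    rw [SimpleGraph.deleteEdges_adj]
    refine ⟨hadj u', fun h => hu' ?_⟩
    obtain ⟨e, rfl⟩ := hbij.2 u
    obtain ⟨e', rfl⟩ := hbij.2 u'
    rw [Set.mem_singleton_iff, hφ, hφ] at h
    rw [Subtype.ext h]
  exact ⟨fun h => h.trans hadj'.reachable, fun h => h.trans hadj'.symm.reachable⟩

/-- A set crossed by `u` alone excludes that `u` is a loop or has a parallel edge, and makes `u` a
bridge. So `G` is a tree whose edges are in bijection with `U`. -/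
theorem card_eq_of_separating
    (hG : ∀ f g, G.Adj f g ↔ f ≠ g ∧ ∃ u, s(a u, b u) = s(f, g)) (hc : G.Connected)
    (hsep : ∀ u, ∃ S : Set V, ¬ (a u ∈ S ↔ b u ∈ S) ∧ ∀ u' ≠ u, (a u' ∈ S ↔ b u' ∈ S)) :
    Nat.card V = Nat.card U + 1 := by
  have hne : ∀ u, a u ≠ b u := fun u h => by
    obtain ⟨S, h1, -⟩ := hsep u
    rw [h] at h1
    exact h1 Iff.rfl
  let φ : U → G.edgeSet := fun u => ⟨s(a u, b u), (hG _ _).2 ⟨hne u, u, rfl⟩⟩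
  have hinj : Function.Injective φ := fun u u' h => by
    by_contra hu
    obtain ⟨S, h1, h2⟩ := hsep u
    have h3 := h2 u' (Ne.symm hu)
    have h4 : s(a u, b u) = s(a u', b u') := congrArg Subtype.val h
    rcases Sym2.eq_iff.1 h4 with ⟨h5, h6⟩ | ⟨h5, h6⟩
    · rw [h5, h6] at h1; exact h1 h3
    · rw [h5, h6] at h1; exact h1 h3.symm
  have hsurj : Function.Surjective φ := by
    rintro ⟨⟨f, g⟩, he⟩
    obtain ⟨-, u, hu⟩ := (hG f g).1 he
    exact ⟨u, Subtype.ext hu⟩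
  have hac : G.IsAcyclic := by
    rw [SimpleGraph.isAcyclic_iff_forall_isBridge]
    intro e he
    obtain ⟨u, rfl⟩ : ∃ u, s(a u, b u) = e := (hsurj ⟨e, he⟩).imp fun u hu => congrArg Subtype.val hu
    rw [SimpleGraph.isBridge_iff]
    obtain ⟨S, h1, h2⟩ := hsep u
    have key : ∀ {x y}, (G.deleteEdges {s(a u, b u)}).Walk x y → (x ∈ S ↔ y ∈ S) := by
      intro x y w
      induction w with
      | nil => exact Iff.rfl
      | cons hadj _ ih =>
        refine Iff.trans ?_ ih
        rw [SimpleGraph.deleteEdges_adj] at hadj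
        obtain ⟨-, u', hu'⟩ := (hG _ _).1 hadj.1
        have h3 : u' ≠ u := fun h => hadj.2 (by rw [← hu', h]; rfl)
        have h4 := h2 u' h3
        rcases Sym2.eq_iff.1 hu' with ⟨h5, h6⟩ | ⟨h5, h6⟩
        · rwa [h5, h6] at h4
        · rw [h5, h6] at h4; exact h4.symm
    rintro ⟨w⟩
    exact h1 (key w)
  have := (SimpleGraph.isTree_iff_connected_and_card.1 ⟨hc, hac⟩).2
  rw [← this, Nat.card_congr (Equiv.ofBijective φ ⟨hinj, hsurj⟩)]

end Multigraph

/-! ### Parents in a tree, cycles of permutations -/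

/-- Both neighbours extend a geodesic from `u` to a path ending at `v`; paths in a tree are unique,
so the penultimate vertices agree. -/
theorem IsTree.eq_of_dist_add_one {V : Type*} {G : SimpleGraph V} (hG : G.IsTree) {u v w w' : V}
    (hw : G.Adj w v) (hw' : G.Adj w' v) (h : G.dist u v = G.dist u w + 1)
    (h' : G.dist u v = G.dist u w' + 1) : w = w' := by
  obtain ⟨p, hp⟩ := hG.connected.exists_walk_length_eq_dist u w
  obtain ⟨p', hp'⟩ := hG.connected.exists_walk_length_eq_dist u w'
  have h1 : (p.concat hw).IsPath := SimpleGraph.Walk.isPath_of_length_eq_dist _ (by simp [hp, h])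
  have h2 : (p'.concat hw').IsPath :=
    SimpleGraph.Walk.isPath_of_length_eq_dist _ (by simp [hp', h'])
  have := (hG.isAcyclic.subsingleton_path u v).elim ⟨_, h1⟩ ⟨_, h2⟩
  have h3 : p.concat hw = p'.concat hw' := congrArg Subtype.val this
  rw [← SimpleGraph.Walk.penultimate_concat p hw, h3, SimpleGraph.Walk.penultimate_concat]

theorem sameCycle_iff_of_invariant {D : Type*} {π : Perm D} {p : D → Prop}
    (hp : ∀ x, p x ↔ p (π x)) {x y : D} (h : π.SameCycle x y) : p x ↔ p y := by
  obtain ⟨n, rfl⟩ := h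
  induction n generalizing x with
  | zero => simp
  | succ n ih => rw [zpow_add_one, Perm.mul_apply, ← ih, ← hp]
  | pred n ih =>
    have h1 : π (π⁻¹ x) = x := π.apply_symm_apply x
    rw [zpow_sub_one, Perm.mul_apply, ← ih, hp (π⁻¹ x), h1]

theorem sameCycle_iff_of_forall_imp {D : Type*} [Finite D] {π : Perm D} {p : D → Prop}
    (hp : ∀ x, p x → p (π x)) {x y : D} (h : π.SameCycle x y) : p x ↔ p y := by
  have key : ∀ {x y}, π.SameCycle x y → p x → p y := by
    intro x y h hx
    obtain ⟨n, rfl⟩ := h.exists_nat_pow_eq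
    induction n with
    | zero => exact hx
    | succ n ih => rw [pow_succ', Perm.mul_apply]; exact hp _ (ih ⟨n, by simp⟩)
  exact ⟨key h, key h.symm⟩

theorem minimalPeriod_eq_card_sameCycle {D : Type*} [Finite D] (π : Perm D) (x : D) :
    Function.minimalPeriod π x = Nat.card {y // π.SameCycle x y} := by
  have hpos : 0 < Function.minimalPeriod π x := by
    refine Function.IsPeriodicPt.minimalPeriod_pos (n := orderOf π) (orderOf_pos π) ?_
    show π^[orderOf π] x = x
    rw [← Perm.coe_pow, pow_orderOf_eq_one]
    rfl
  let φ : Fin (Function.minimalPeriod π x) → {y // π.SameCycle x y} :=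
    fun i => ⟨π^[i.val] x, i.val, by rw [zpow_natCast, Perm.coe_pow]⟩
  have hφ : Function.Bijective φ := by
    constructor
    · intro i j hij
      exact Fin.ext (Function.iterate_injOn_Iio_minimalPeriod i.2 j.2 (congrArg Subtype.val hij))
    · rintro ⟨y, hy⟩
      obtain ⟨n, rfl⟩ := hy.exists_nat_pow_eq
      refine ⟨⟨n % Function.minimalPeriod π x, Nat.mod_lt _ hpos⟩, Subtype.ext ?_⟩
      show π^[n % Function.minimalPeriod π x] x = (π ^ n) x
      rw [Function.iterate_mod_minimalPeriod_eq, Perm.coe_pow]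
  rw [← Nat.card_congr (Equiv.ofBijective φ hφ), Nat.card_fin]

/-- The period divides `4`, so excluding periods `1` and `2` suffices. -/
theorem minimalPeriod_eq_four_iff {D : Type*} {π : Perm D} {x : D} :
    Function.minimalPeriod π x = 4 ↔
      π x ≠ x ∧ π (π x) ≠ x ∧ π (π (π (π x))) = x := by
  constructor
  · intro h
    refine ⟨fun h0 => ?_, fun h0 => ?_, ?_⟩
    · have := Function.IsPeriodicPt.minimalPeriod_le (f := π) (n := 1) one_pos h0; omega
    · have := Function.IsPeriodicPt.minimalPeriod_le (f := π) (n := 2) two_pos h0; omega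
    · have := Function.iterate_minimalPeriod (f := π) (x := x)
      rw [h] at this
      exact this
  · rintro ⟨h1, h2, h4⟩
    have hd : Function.minimalPeriod π x ∣ 4 :=
      Function.IsPeriodicPt.minimalPeriod_dvd (f := π) (n := 4) h4
    have hle := Nat.le_of_dvd (by norm_num) hd
    have h0 := Function.iterate_minimalPeriod (f := π) (x := x)
    generalize Function.minimalPeriod π x = p at *
    interval_cases p
    · omega
    · exact absurd h0 h1
    · exact absurd h0 h2
    · omega
    · rfl

theorem eq_of_sameCycle_of_four {D : Type*} {π : Perm D} (h4 : ∀ x, π (π (π (π x))) = x)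
    {x y : D} (h : π.SameCycle x y) : y = x ∨ y = π x ∨ y = π (π x) ∨ y = π (π (π x)) := by
  refine (sameCycle_iff_of_invariant (p := fun y => y = x ∨ y = π x ∨ y = π (π x) ∨ y = π (π (π x)))
    (fun y => ?_) h).1 (.inl rfl)
  constructor
  · rintro (rfl | rfl | rfl | rfl) <;> simp [h4]
  · rintro (h | h | h | h)
    · right; right; right; apply π.injective; rw [h, h4]
    · left; exact π.injective h
    · right; left; exact π.injective h
    · right; right; left; exact π.injective h

/-! ### Tetravalent maps, and the plane tree of a spanning tree -/

namespace CombMap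

variable {D : Type*} (M : CombMap D)

theorem vertex_eq_iff {x y : D} : M.vertex x = M.vertex y ↔ M.σ.SameCycle x y :=
  Quotient.eq (r := Perm.SameCycle.setoid M.σ)

theorem face_eq_iff {x y : D} : M.face x = M.face y ↔ (M.σ * M.α).SameCycle x y :=
  Quotient.eq (r := Perm.SameCycle.setoid (M.σ * M.α))

theorem edge_eq_iff {x y : D} : M.edge x = M.edge y ↔ y = x ∨ y = M.α x := by
  refine (Quotient.eq (r := Perm.SameCycle.setoid M.α)).trans ⟨fun h => ?_, ?_⟩
  · refine (sameCycle_iff_of_invariant (p := fun y => y = x ∨ y = M.α x)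
      (fun y => ?_) h).1 (.inl rfl)
    constructor
    · rintro (rfl | rfl) <;> simp [M.α_invol]
    · rintro (h | h)
      · right; rw [← h, M.α_invol]
      · left; exact M.α.injective h
  · rintro (rfl | rfl)
    · exact Perm.SameCycle.refl _ _
    · exact Perm.sameCycle_apply_right.2 (Perm.SameCycle.refl _ _)

theorem vertex_surjective : Function.Surjective M.vertex := Quotient.mk_surjective

theorem edge_surjective : Function.Surjective M.edge := Quotient.mk_surjective

theorem face_surjective : Function.Surjective M.face := Quotient.mk_surjective

instance [Finite D] : Finite M.Vertex := Finite.of_surjective _ M.vertex_surjective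

instance [Finite D] : Finite M.Edge := Finite.of_surjective _ M.edge_surjective

instance [Finite D] : Finite M.Face := Finite.of_surjective _ M.face_surjective

theorem vertex_σ (x : D) : M.vertex (M.σ x) = M.vertex x :=
  M.vertex_eq_iff.2 (Perm.sameCycle_apply_left.2 (Perm.SameCycle.refl _ _))

theorem face_σ_α (x : D) : M.face (M.σ (M.α x)) = M.face x :=
  M.face_eq_iff.2 (Perm.sameCycle_apply_left (f := M.σ * M.α) |>.2 (Perm.SameCycle.refl _ _))

theorem edge_α (x : D) : M.edge (M.α x) = M.edge x :=
  (M.edge_eq_iff.2 (.inr rfl)).symm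

theorem card_of_card_fiber {A B : Type*} [Finite A] [Finite B] (f : A → B) (k : ℕ)
    (h : ∀ b, Nat.card {a // f a = b} = k) : Nat.card A = k * Nat.card B := by
  have := Fintype.ofFinite B
  rw [← Nat.card_congr (Equiv.sigmaFiberEquiv f), Nat.card_sigma, Finset.sum_congr rfl fun b _ => h b]
  simp [Nat.card_eq_fintype_card, mul_comm]

theorem card_edge_subtype [Finite D] (P : M.Edge → Prop) :
    Nat.card {x // P (M.edge x)} = 2 * Nat.card {e // P e} := by
  refine card_of_card_fiber (fun x : {x // P (M.edge x)} => (⟨M.edge x, x.2⟩ : {e // P e})) 2 ?_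
  rintro ⟨e, he⟩
  obtain ⟨d, rfl⟩ := M.edge_surjective e
  have e1 : {a : {x // P (M.edge x)} // (⟨M.edge a, a.2⟩ : {e // P e}) = ⟨M.edge d, he⟩} ≃
      ({d, M.α d} : Set D) :=
    { toFun := fun a => ⟨a.1.1, by
        have := M.edge_eq_iff.1 (congrArg Subtype.val a.2).symm
        simpa using this⟩
      invFun := fun a => ⟨⟨a.1, by
          rcases a with ⟨_, rfl | rfl⟩ <;> simpa [edge_α] using he⟩, by
          rcases a with ⟨_, rfl | rfl⟩ <;> simp [edge_α]⟩
      left_inv := fun a => rfl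
      right_inv := fun a => rfl }
  rw [Nat.card_congr e1, Nat.card_coe_set_eq, Set.ncard_pair (M.α_fixedPointFree d).symm]

theorem card_edge [Finite D] : Nat.card D = 2 * Nat.card M.Edge := by
  have := M.card_edge_subtype fun _ => True
  rwa [Nat.card_congr (Equiv.subtypeUnivEquiv fun _ => trivial),
    Nat.card_congr (Equiv.subtypeUnivEquiv fun _ => trivial)] at this

theorem isTetravalent_iff [Finite D] : M.IsTetravalent ↔
    ∀ x, M.σ x ≠ x ∧ M.σ (M.σ x) ≠ x ∧ M.σ (M.σ (M.σ (M.σ x))) = x := by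
  simp only [← minimalPeriod_eq_four_iff, minimalPeriod_eq_card_sameCycle]
  unfold IsTetravalent
  rw [M.vertex_surjective.forall]
  refine forall_congr' fun x => ?_
  rw [Nat.card_congr (Equiv.subtypeEquivRight fun y => eq_comm.trans M.vertex_eq_iff)]

variable {M}

theorem IsTetravalent.card_vertex [Finite D] (h : M.IsTetravalent) :
    Nat.card D = 4 * Nat.card M.Vertex :=
  card_of_card_fiber M.vertex 4 h

/-- Counting half-edges by vertices and by edges gives `E = 2 * V`, so Euler's relation becomes a
condition on the number of faces. -/
theorem IsTetravalent.isPlanar_iff [Finite D] (h : M.IsTetravalent) :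
    M.IsPlanar ↔ Nat.card M.Face = Nat.card M.Vertex + 2 := by
  have h1 := h.card_vertex
  have h2 := M.card_edge
  unfold IsPlanar
  omega

variable (M) (T : Set M.Edge)

open Classical in
/-- The involution which exchanges the two halves of each edge in `T`. -/
noncomputable def involOn : Perm D :=
  Function.Involutive.toPerm (fun x => if M.edge x ∈ T then M.α x else x) fun x => by
    by_cases h : M.edge x ∈ T <;> simp [h, edge_α, M.α_invol]

variable {M T}

theorem involOn_of_mem {x : D} (h : M.edge x ∈ T) : M.involOn T x = M.α x := if_pos h

theorem involOn_of_notMem {x : D} (h : M.edge x ∉ T) : M.involOn T x = x := if_neg h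

theorem involOn_eq_self_iff {x : D} : M.involOn T x = x ↔ M.edge x ∉ T := by
  refine ⟨fun h h' => ?_, involOn_of_notMem⟩
  rw [involOn_of_mem h'] at h
  exact M.α_fixedPointFree x h

theorem involOn_involOn (x : D) : M.involOn T (M.involOn T x) = x :=
  (M.involOn T).symm_apply_apply x

theorem edgeSetGraph_adj {u v : M.Vertex} : (M.edgeSetGraph T).Adj u v ↔
    u ≠ v ∧ ∃ d, M.edge d ∈ T ∧ M.vertex d = u ∧ M.vertex (M.α d) = v := by
  unfold edgeSetGraph
  rw [SimpleGraph.fromRel_adj]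
  refine and_congr_right fun _ => ⟨?_, fun h => .inl h⟩
  rintro (h | ⟨d, h1, h2, h3⟩)
  · exact h
  · exact ⟨M.α d, by rwa [edge_α], h3, by rwa [M.α_invol]⟩

theorem faceGraph_adj {f g : M.Face} : (M.faceGraph T).Adj f g ↔
    f ≠ g ∧ ∃ d, M.edge d ∉ T ∧ M.face d = f ∧ M.face (M.α d) = g := by
  unfold faceGraph
  rw [SimpleGraph.fromRel_adj]
  refine and_congr_right fun _ => ⟨?_, fun h => .inl h⟩
  rintro (h | ⟨d, h1, h2, h3⟩)
  · exact h
  · exact ⟨M.α d, by rwa [edge_α], h3, by rwa [M.α_invol]⟩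

/-- The rotation system of a spanning tree of a tetravalent map is a plane tree. -/
theorem IsSpanningTree.isPlaneTree [Finite D] (hT : M.IsSpanningTree T) (h4 : M.IsTetravalent)
    {r : D} (hr : M.edge r ∉ T) : IsPlaneTree M.σ (M.involOn T)
      (fun x => (M.edgeSetGraph T).dist (M.vertex r) (M.vertex x)) r := by
  have h4' := M.isTetravalent_iff.1 h4
  have hadj : ∀ x, M.edge x ∈ T → (M.edgeSetGraph T).Adj (M.vertex x) (M.vertex (M.α x)) :=
    fun x hx => edgeSetGraph_adj.2 ⟨hT.no_loop x hx, x, hx, rfl, rfl⟩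
  have htau : ∀ x, M.involOn T x = x ∨
      (M.edgeSetGraph T).dist (M.vertex r) (M.vertex (M.involOn T x)) =
        (M.edgeSetGraph T).dist (M.vertex r) (M.vertex x) + 1 ∨
      (M.edgeSetGraph T).dist (M.vertex r) (M.vertex x) =
        (M.edgeSetGraph T).dist (M.vertex r) (M.vertex (M.involOn T x)) + 1 := fun x => by
    by_cases hx : M.edge x ∈ T
    · rw [involOn_of_mem hx]
      right
      exact (hT.isTree.dist_eq_dist_add_one_of_adj (M.vertex r) (hadj x hx)).symm
    · exact .inl (involOn_of_notMem hx)
  -- A vertex has only one half-edge towards the root: a second one would lead to the same parent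
  -- vertex, hence be a parallel tree edge.
  have hout : ∀ x y, (M.edgeSetGraph T).dist (M.vertex r) (M.vertex (M.involOn T x)) =
        (M.edgeSetGraph T).dist (M.vertex r) (M.vertex x) + 1 →
      M.vertex y = M.vertex (M.involOn T x) → y ≠ M.involOn T x →
      M.involOn T y = y ∨ (M.edgeSetGraph T).dist (M.vertex r) (M.vertex (M.involOn T y)) =
        (M.edgeSetGraph T).dist (M.vertex r) (M.vertex (M.involOn T x)) + 1 := by
    intro x y hx hy hne
    by_cases hyT : M.edge y ∈ T
    · by_cases hxT : M.edge x ∈ T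
      · rw [← hy]
        refine (htau y).imp_right fun h => h.resolve_right fun h => hne ?_
        have e1 := hadj x hxT
        have e2 := hadj y hyT
        rw [involOn_of_mem hxT] at hx hy ⊢
        rw [involOn_of_mem hyT] at h
        rw [hy] at e2 h
        have h5 := IsTree.eq_of_dist_add_one hT.isTree e1 e2.symm hx h
        refine hT.no_parallel y (M.α x) hyT (by rwa [edge_α]) hy ?_
        rw [M.α_invol, h5]
      · rw [involOn_of_notMem hxT] at hx
        omega
    · exact .inl (involOn_of_notMem hyT)
  refine
    { tau_tau := involOn_involOn
      sigma_four := fun x => (h4' x).2.2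
      sigma_ne := fun x => (h4' x).1
      sigma_two_ne := fun x => (h4' x).2.1
      height_sigma := fun x => by rw [vertex_σ]
      height_tau := htau
      outward := fun x hx => ⟨hout x _ hx (M.vertex_σ _) (h4' _).1,
        hout x _ hx (by rw [vertex_σ, vertex_σ]) (h4' _).2.1,
        hout x _ hx (by rw [vertex_σ, vertex_σ, vertex_σ]) fun h => (h4' (M.involOn T x)).1 ?_⟩
      tau_root := involOn_of_notMem hr
      height_root := SimpleGraph.dist_self
      transitive := fun S hrS hσ hτ x => ?_ }
  · conv_rhs => rw [← (h4' (M.involOn T x)).2.2, h]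
  · have hcyc : ∀ {x y}, M.vertex x = M.vertex y → (x ∈ S ↔ y ∈ S) := fun h =>
      sameCycle_iff_of_forall_imp (p := (· ∈ S)) hσ (M.vertex_eq_iff.1 h)
    obtain ⟨w⟩ := hT.isTree.connected (M.vertex r) (M.vertex x)
    have key : ∀ {u v : M.Vertex}, (M.edgeSetGraph T).Walk u v →
        (∀ y, M.vertex y = u → y ∈ S) → ∀ y, M.vertex y = v → y ∈ S := by
      intro u v w
      induction w with
      | nil => exact fun h => h
      | cons hadj _ ih =>
        intro h
        refine ih fun y hy => ?_
        obtain ⟨-, d, hd, h1, h2⟩ := edgeSetGraph_adj.1 hadj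
        have h3 := hτ d (h d h1)
        rw [involOn_of_mem hd] at h3
        exact (hcyc (h2.trans hy.symm)).1 h3
    exact key w (fun y hy => (hcyc hy.symm).1 hrS) x rfl

end CombMap

/-! ### Planarity is equivalent to the absence of crossings -/

section PlaneTree

variable {D : Type*} {σ τ : Perm D} {h : D → ℕ} {r : D} {t : TernaryTree}

theorem IsPlaneTree.posEquiv_symm_psi (H : IsPlaneTree σ τ h r) (ht : HasRootShape σ τ t r) (x : D) :
    ((H.posEquiv ht).symm (σ (τ x)) : ℕ) =
      if ((H.posEquiv ht).symm x : ℕ) + 1 < 4 * t.inner then ((H.posEquiv ht).symm x : ℕ) + 1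
      else 0 := by
  obtain ⟨i, rfl⟩ := (H.posEquiv ht).surjective x
  have hx : σ (τ (H.posEquiv ht i)) = (σ * τ)^[i.val + 1] r := by
    rw [Function.iterate_succ_apply', ← H.posEquiv_apply ht, Perm.mul_apply]
  rw [Equiv.symm_apply_apply]
  split_ifs with h1
  · have : (H.posEquiv ht) ⟨i + 1, h1⟩ = σ (τ (H.posEquiv ht i)) := by
      rw [hx, H.posEquiv_apply]
    rw [← this, Equiv.symm_apply_apply]
  · have hp := (iterate_rootContour H.sigma_four H.tau_tau H.tau_root ht).2
    have h2 : i.val + 1 = 4 * t.inner := by omega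
    rw [h2, hp] at hx
    have h3 : (H.posEquiv ht) ⟨0, by omega⟩ = σ (τ (H.posEquiv ht i)) := hx.symm
    rw [← h3, Equiv.symm_apply_apply]

theorem IsPlaneTree.psi_transitive (H : IsPlaneTree σ τ h r) (ht : HasRootShape σ τ t r)
    {p : D → Prop} (hp : ∀ x, p x → p (σ (τ x))) {x : D} (hx : p x) (y : D) : p y := by
  have hn : ∀ n x, p x → p ((σ * τ)^[n] x) := by
    intro n
    induction n with
    | zero => exact fun x hx => hx
    | succ n ih => exact fun x hx => by rw [Function.iterate_succ_apply']; exact hp _ (ih _ hx)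
  obtain ⟨i, rfl⟩ := (H.posEquiv ht).surjective x
  obtain ⟨j, rfl⟩ := (H.posEquiv ht).surjective y
  have h1 := hn (4 * t.inner - i.val) _ hx
  rw [H.posEquiv_apply, ← Function.iterate_add_apply, Nat.sub_add_cancel i.2.le,
    (iterate_rootContour H.sigma_four H.tau_tau H.tau_root ht).2] at h1
  exact hn j _ h1

end PlaneTree

namespace CombMap

variable {D : Type*} {M : CombMap D} {T : Set M.Edge} {h : D → ℕ} {r : D}
  {t : TernaryTree}

/-- Walk along the contour. At a tree half-edge the face does not change; at an unvisited half-edge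
`x` one passes from the face of `x` to that of `M.α x`. The contour visits every half-edge, hence
every face, whether or not the map is planar. -/
theorem faceGraph_connected (H : IsPlaneTree M.σ (M.involOn T) h r)
    (ht : HasRootShape M.σ (M.involOn T) t r) : (M.faceGraph T).Connected := by
  have key : ∀ x y, (M.faceGraph T).Reachable (M.face x) (M.face y) := by
    intro x
    have hα : ∀ y, M.edge y ∉ T → (M.faceGraph T).Reachable (M.face x) (M.face y) →
        (M.faceGraph T).Reachable (M.face x) (M.face (M.α y)) := fun y hy hr => by
      by_cases he : M.face y = M.face (M.α y)
      · rwa [← he]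
      · exact hr.trans (SimpleGraph.Adj.reachable (faceGraph_adj.2 ⟨he, y, hy, rfl, rfl⟩))
    refine H.psi_transitive ht (p := fun y => (M.faceGraph T).Reachable (M.face x) (M.face y))
      (fun y hy => ?_) (SimpleGraph.Reachable.refl _)
    by_cases hyT : M.edge y ∈ T
    · rwa [involOn_of_mem hyT, face_σ_α]
    · rw [involOn_of_notMem hyT]
      have := hα y hyT hy
      rwa [← M.face_σ_α (M.α y), M.α_invol] at this
  have : Nonempty M.Face := ⟨M.face r⟩
  refine ⟨fun f g => ?_⟩
  obtain ⟨x, rfl⟩ := M.face_surjective f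
  obtain ⟨y, rfl⟩ := M.face_surjective g
  exact key x y

/-- The unvisited half-edges are the `2 * (t.inner + 1)` leaves. -/
theorem card_compl_edges [Finite D] (H : IsPlaneTree M.σ (M.involOn T) h r)
    (ht : HasRootShape M.σ (M.involOn T) t r) : Nat.card {e // e ∉ T} = t.inner + 1 := by
  obtain ⟨ℓ, hℓ⟩ := ht.exists_leaf_enum
  have h1 := M.card_edge_subtype fun e => e ∉ T
  have e1 : Fin (2 * (t.inner + 1)) ≃ {x // M.edge x ∉ T} :=
    Equiv.ofBijective (fun i => ⟨ℓ i, by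
        rw [← involOn_eq_self_iff, ← H.exists_leaf_enum_eq_iff ht hℓ]; exact ⟨i, rfl⟩⟩)
      ⟨fun i j hij => H.leaf_enum_injective ht hℓ (congrArg Subtype.val hij), fun ⟨x, hx⟩ => by
        rw [← involOn_eq_self_iff, ← H.exists_leaf_enum_eq_iff ht hℓ] at hx
        obtain ⟨i, hi⟩ := hx
        exact ⟨i, Subtype.ext hi⟩⟩
  rw [← Nat.card_congr e1, Nat.card_fin] at h1
  omega

/-- This presents `faceGraph` as the simple graph of a multigraph with one edge for each unvisited
edge, the form required by the multigraph lemmas; `out` only chooses an orientation. -/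
theorem faceGraph_adj_iff_exists_edge (f g : M.Face) : (M.faceGraph T).Adj f g ↔ f ≠ g ∧
    ∃ u : {e // e ∉ T}, s(M.face u.1.out, M.face (M.α u.1.out)) = s(f, g) := by
  rw [faceGraph_adj]
  have hout : ∀ e : M.Edge, M.edge e.out = e := fun e => Quotient.out_eq _
  refine and_congr_right fun _ => ⟨?_, ?_⟩
  · rintro ⟨d, hd, rfl, rfl⟩
    refine ⟨⟨M.edge d, hd⟩, ?_⟩
    rcases M.edge_eq_iff.1 (hout (M.edge d)).symm with h | h
    · simp only [h]
    · simp only [h, M.α_invol]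
      exact Sym2.eq_swap
  · rintro ⟨⟨e, he⟩, hu⟩
    rcases Sym2.eq_iff.1 hu with ⟨h1, h2⟩ | ⟨h1, h2⟩
    · exact ⟨e.out, by rwa [hout], h1, h2⟩
    · exact ⟨M.α e.out, by rwa [edge_α, hout], h2, by rwa [M.α_invol]⟩

/-- In a planar map, the faces and the edges outside a spanning tree form a tree. -/
theorem faceGraph_isTree_and_separating [Finite D] (H : IsPlaneTree M.σ (M.involOn T) h r)
    (ht : HasRootShape M.σ (M.involOn T) t r) (hF : Nat.card M.Face = t.inner + 2) :
    (M.faceGraph T).IsTree ∧ ∀ d, M.edge d ∉ T → ∃ S : Set M.Face,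
      ¬ (M.face d ∈ S ↔ M.face (M.α d) ∈ S) ∧
      ∀ x, M.edge x ∉ T → x ≠ d → x ≠ M.α d → (M.face x ∈ S ↔ M.face (M.α x) ∈ S) := by
  have hout : ∀ e : M.Edge, M.edge e.out = e := fun e => Quotient.out_eq _
  obtain ⟨h1, h2⟩ := isTree_and_separating_of_card_eq (M.faceGraph_adj_iff_exists_edge (T := T))
    (faceGraph_connected H ht) (by rw [hF, card_compl_edges H ht])
  refine ⟨h1, fun d hd => ?_⟩
  obtain ⟨S, hS1, hS2, hS3⟩ := h2 ⟨M.edge d, hd⟩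
  refine ⟨S, ?_, fun x hx hxd hxd' => ?_⟩
  · rcases M.edge_eq_iff.1 (hout (M.edge d)).symm with h | h
    · simp only [h] at hS1 hS2; tauto
    · simp only [h, M.α_invol] at hS1 hS2; tauto
  · have h3 := hS3 ⟨M.edge x, hx⟩ fun h => by
      rcases M.edge_eq_iff.1 (congrArg Subtype.val h).symm with h | h <;> contradiction
    rcases M.edge_eq_iff.1 (hout (M.edge x)).symm with h | h
    · simpa only [h] using h3
    · simp only [h, M.α_invol] at h3; exact h3.symm

variable {ℓ : Fin (2 * (t.inner + 1)) → D} {f : Perm (Fin (2 * (t.inner + 1)))}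

theorem edge_leaf_notMem (H : IsPlaneTree M.σ (M.involOn T) h r)
    (ht : HasRootShape M.σ (M.involOn T) t r)
    (hℓ : List.ofFn ℓ = rootLeafList M.σ (M.involOn T) t r) (i : Fin (2 * (t.inner + 1))) :
    M.edge (ℓ i) ∉ T := by
  rw [← involOn_eq_self_iff, ← H.exists_leaf_enum_eq_iff ht hℓ]
  exact ⟨i, rfl⟩

/-- A combinatorial Jordan argument. With `n + 2` faces the edge at `ℓ i` separates the faces into
two sides, and the side changes along the contour only at `ℓ i` and `ℓ (f i)`. A crossing arch `j`
would be a passage between the two sides. -/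
theorem not_crossing_of_card_face [Finite D] (H : IsPlaneTree M.σ (M.involOn T) h r)
    (ht : HasRootShape M.σ (M.involOn T) t r)
    (hℓ : List.ofFn ℓ = rootLeafList M.σ (M.involOn T) t r) (hf : ∀ i, M.α (ℓ i) = ℓ (f i))
    (hF : Nat.card M.Face = t.inner + 2) : ¬ ∃ i j, i < j ∧ j < f i ∧ f i < f j := by
  rintro ⟨i, j, hij, hji, hfij⟩
  have hmono := H.strictMono_pos ht hℓ
  have hleaf := edge_leaf_notMem H ht hℓ
  obtain ⟨S, hS1, hS2⟩ := (faceGraph_isTree_and_separating H ht hF).2 (ℓ i) (hleaf i)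
  rw [hf] at hS1 hS2
  have hstep : ∀ x, x ≠ ℓ i → x ≠ ℓ (f i) →
      (M.face x ∈ S ↔ M.face (M.σ (M.involOn T x)) ∈ S) := by
    intro x h1 h2
    by_cases hx : M.edge x ∈ T
    · rw [involOn_of_mem hx, face_σ_α]
    · rw [involOn_of_notMem hx, hS2 x hx h1 h2]
      conv_rhs => rw [← M.α_invol x, face_σ_α]
  have hne : ∀ k : Fin (4 * t.inner), ∀ i', k.val ≠ (H.posEquiv ht).symm (ℓ i') →
      (H.posEquiv ht) k ≠ ℓ i' := fun k i' hk h0 => hk (by rw [← h0, Equiv.symm_apply_apply])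
  have hrange : ∀ a b : ℕ, a ≤ b → b ≤ 4 * t.inner →
      (∀ k, a ≤ k → k < b → k ≠ (H.posEquiv ht).symm (ℓ i) ∧
        k ≠ (H.posEquiv ht).symm (ℓ (f i))) →
      (M.face ((M.σ * M.involOn T)^[a] r) ∈ S ↔ M.face ((M.σ * M.involOn T)^[b] r) ∈ S) := by
    intro a b hab
    induction b, hab using Nat.le_induction with
    | base => exact fun _ _ => Iff.rfl
    | succ b hab ih =>
      intro hb hk
      rw [ih (by omega) fun k h1 h2 => hk k h1 (by omega), Function.iterate_succ_apply']
      obtain ⟨h1, h2⟩ := hk b hab (by omega)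
      exact hstep _ (hne ⟨b, by omega⟩ i h1) (hne ⟨b, by omega⟩ (f i) h2)
  have hpos : ∀ i', (M.σ * M.involOn T)^[((H.posEquiv ht).symm (ℓ i')).val] r = ℓ i' := fun i' => by
    rw [← H.posEquiv_apply ht, Equiv.apply_symm_apply]
  have hlt : ∀ {i' j'}, i' < j' → ((H.posEquiv ht).symm (ℓ i')).val <
    ((H.posEquiv ht).symm (ℓ j')).val := fun h => hmono h
  have hbd : ∀ i', ((H.posEquiv ht).symm (ℓ i')).val < 4 * t.inner := fun i' => Fin.is_lt _
  have a1 := hlt hij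
  have a2 := hlt hji
  have a3 := hlt hfij
  -- The side is constant from `ℓ j` to `ℓ (f i)`, and from `ℓ (f j)` through the end of the
  -- contour, which is again `r`, to `ℓ i`. The edge of `j` links the two stretches.
  have e1 := hrange _ _ a2.le (hbd _).le fun k h1 h2 => by omega
  have e2 := hrange _ _ (hbd (f j)).le le_rfl fun k h1 h2 => by omega
  have e3 := hrange 0 _ (Nat.zero_le _) (hbd i).le fun k h1 h2 => by omega
  rw [(iterate_rootContour H.sigma_four H.tau_tau H.tau_root ht).2] at e2
  simp only [hpos, Function.iterate_zero, id] at e1 e2 e3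
  have e4 := hS2 (ℓ j) (hleaf j) (fun h0 => by rw [h0] at a1; exact a1.false)
    (fun h0 => by rw [h0] at a2; exact a2.false)
  rw [hf] at e4
  apply hS1
  rw [← e1, e4, e2, e3]

/-- For each arch, the half-edges on the arc of the contour that it encloses form a union of faces,
and without crossings no other arch leaves this arc. So every unvisited edge separates, and the
faces form a tree with `t.inner + 1` edges. -/
theorem card_face_of_not_crossing [Finite D] (H : IsPlaneTree M.σ (M.involOn T) h r)
    (ht : HasRootShape M.σ (M.involOn T) t r)
    (hℓ : List.ofFn ℓ = rootLeafList M.σ (M.involOn T) t r) (hf : ∀ i, M.α (ℓ i) = ℓ (f i))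
    (hnc : ¬ ∃ i j, i < j ∧ j < f i ∧ f i < f j) : Nat.card M.Face = t.inner + 2 := by
  have hmono := H.strictMono_pos ht hℓ
  have hinj := H.leaf_enum_injective ht hℓ
  have hleaf := edge_leaf_notMem H ht hℓ
  have hff : ∀ i, f (f i) = i := fun i => hinj (by rw [← hf, ← hf, M.α_invol])
  have hlt : ∀ {i j}, ((H.posEquiv ht).symm (ℓ i)).val < ((H.posEquiv ht).symm (ℓ j)).val ↔ i < j :=
    fun {i j} => hmono.lt_iff_lt
  have hle : ∀ {i j}, ((H.posEquiv ht).symm (ℓ i)).val ≤ ((H.posEquiv ht).symm (ℓ j)).val ↔ i ≤ j :=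
    fun {i j} => hmono.le_iff_le
  have hsep : ∀ i, i < f i → ∃ S : Set M.Face, M.face (ℓ i) ∉ S ∧ M.face (ℓ (f i)) ∈ S ∧
      ∀ j, j ≠ i → j ≠ f i → (M.face (ℓ j) ∈ S ↔ M.face (ℓ (f j)) ∈ S) := by
    intro i hi
    -- The arc omits its start `ℓ i` and contains its end `ℓ (f i)`, so that the two halves of the
    -- edge lie on different sides.
    set A : D → Prop := fun x => ((H.posEquiv ht).symm (ℓ i)).val < ((H.posEquiv ht).symm x).val ∧
      ((H.posEquiv ht).symm x).val ≤ ((H.posEquiv ht).symm (ℓ (f i))).val with hA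
    have hAi : ¬ A (ℓ i) := fun h0 => h0.1.false
    have hAf : A (ℓ (f i)) := ⟨hlt.2 hi, le_rfl⟩
    have hpos : ∀ x j, x ≠ ℓ j → ((H.posEquiv ht).symm x).val ≠ ((H.posEquiv ht).symm (ℓ j)).val :=
      fun x j hx h0 => hx ((H.posEquiv ht).symm.injective (Fin.ext h0))
    have hψ : ∀ x, x ≠ ℓ i → x ≠ ℓ (f i) → (A x ↔ A (M.σ (M.involOn T x))) := by
      intro x h1 h2
      have h1 := hpos x _ h1
      have h2 := hpos x _ h2
      have h3 := ((H.posEquiv ht).symm x).is_lt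
      have h4 := ((H.posEquiv ht).symm (ℓ (f i))).is_lt
      simp only [hA, H.posEquiv_symm_psi ht]
      split_ifs <;> omega
    have hψi : A (M.σ (M.involOn T (ℓ i))) := by
      have h3 := hlt.2 hi
      have h4 := ((H.posEquiv ht).symm (ℓ (f i))).is_lt
      simp only [hA, H.posEquiv_symm_psi ht]
      split_ifs <;> omega
    have hψf : ¬ A (M.σ (M.involOn T (ℓ (f i)))) := by
      simp only [hA, H.posEquiv_symm_psi ht]
      split_ifs <;> omega
    have harch : ∀ j, j ≠ i → j ≠ f i → (A (ℓ j) ↔ A (ℓ (f j))) := by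
      have : ∀ j, j ≠ i → j ≠ f i → A (ℓ j) → A (ℓ (f j)) := by
        intro j h1 h2 h3
        simp only [hA, hlt, hle] at h3 ⊢
        have h4 := lt_of_le_of_ne h3.2 h2
        constructor
        · by_contra! hc
          have hne : f j ≠ i := fun h0 => h2 (by rw [← h0, hff])
          exact hnc ⟨f j, i, lt_of_le_of_ne hc hne, by rw [hff]; exact h3.1, by rw [hff]; exact h4⟩
        · by_contra! hc
          exact hnc ⟨i, j, h3.1, h4, hc⟩
      intro j h1 h2
      refine ⟨this j h1 h2, fun h3 => ?_⟩
      have := this (f j) (fun h0 => h2 (by rw [← h0, hff])) (fun h0 => h1 (f.injective h0)) h3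
      rwa [hff] at this
    -- At a leaf, `σ * α` jumps to the other end of its arch and then makes a contour step. For the
    -- arch `i` itself, the jump and the step both change sides and compensate each other.
    have hface : ∀ x, A x ↔ A ((M.σ * M.α) x) := by
      intro x
      rw [Perm.mul_apply]
      by_cases hx : M.edge x ∈ T
      · rw [← involOn_of_mem hx]
        exact hψ x (fun h0 => hleaf i (h0 ▸ hx)) (fun h0 => hleaf (f i) (h0 ▸ hx))
      · obtain ⟨j, rfl⟩ := (H.exists_leaf_enum_eq_iff ht hℓ x).2 (involOn_of_notMem hx)
        rw [hf, ← involOn_of_notMem (hleaf (f j))]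
        by_cases h1 : j = i
        · subst h1
          exact iff_of_false hAi hψf
        · by_cases h2 : j = f i
          · subst h2
            rw [hff]
            exact iff_of_true hAf hψi
          · rw [harch j h1 h2]
            exact hψ _ (fun h0 => h2 (by rw [← hinj h0, hff]))
              (fun h0 => h1 (f.injective (hinj h0)))
    have hS : ∀ x, M.face x ∈ {F | ∃ y, A y ∧ M.face y = F} ↔ A x := fun x => by
      constructor
      · rintro ⟨y, hy, hyx⟩
        exact (sameCycle_iff_of_invariant hface (M.face_eq_iff.1 hyx)).1 hy
      · exact fun hx => ⟨x, hx, rfl⟩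
    refine ⟨{F | ∃ y, A y ∧ M.face y = F}, ?_, ?_, ?_⟩
    · rwa [hS]
    · rwa [hS]
    · intro j h1 h2
      rw [hS, hS]
      exact harch j h1 h2
  have := card_eq_of_separating (M.faceGraph_adj_iff_exists_edge (T := T))
    (faceGraph_connected H ht) ?_
  · rw [this, card_compl_edges H ht]
  rintro ⟨e, he⟩
  have hout : ∀ e : M.Edge, M.edge e.out = e := fun e => Quotient.out_eq _
  obtain ⟨i, hi⟩ := (H.exists_leaf_enum_eq_iff ht hℓ e.out).2
    (involOn_of_notMem (by rwa [hout]))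
  have hgen : ∃ i, i < f i ∧ (e.out = ℓ i ∨ e.out = ℓ (f i)) := by
    rcases lt_trichotomy i (f i) with h1 | h1 | h1
    · exact ⟨i, h1, .inl hi.symm⟩
    · have := hf i
      rw [← h1] at this
      exact absurd this (M.α_fixedPointFree _)
    · exact ⟨f i, by rwa [hff], .inr (by rw [hff]; exact hi.symm)⟩
  obtain ⟨i, hlt', hi'⟩ := hgen
  obtain ⟨S, h1, h2, h3⟩ := hsep i hlt'
  refine ⟨S, ?_, ?_⟩
  · rcases hi' with h0 | h0
    · simp only [h0, hf]; tauto
    · simp only [h0, hf, hff]; tauto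
  · rintro ⟨e', he'⟩ hne
    obtain ⟨j, hj⟩ := (H.exists_leaf_enum_eq_iff ht hℓ e'.out).2
      (involOn_of_notMem (by rwa [hout]))
    have hedge : ∀ k, M.edge (ℓ (f k)) = M.edge (ℓ k) := fun k => by rw [← hf, edge_α]
    have he1 : M.edge (ℓ i) = e := by
      rcases hi' with h0 | h0
      · rw [← h0, hout]
      · rw [← hedge, ← h0, hout]
    have hne' : M.edge (ℓ j) ≠ M.edge (ℓ i) := fun h0 => hne (Subtype.ext (by
      rw [he1, hj, hout] at h0; exact h0))
    simp only [← hj, hf]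
    refine h3 j (fun h0 => hne' (by rw [h0])) (fun h0 => hne' (by rw [h0, hedge]))

end CombMap

/-! ### Isomorphisms preserve and are determined by the shape -/

section Equivariance

variable {D D' : Type*} {σ τ : Perm D} {σ' τ' : Perm D'} {r : D} {r' : D'} {t : TernaryTree}

theorem HasShape.map {φ : D ≃ D'} (hσ : ∀ x, φ (σ x) = σ' (φ x)) (hτ : ∀ x, φ (τ x) = τ' (φ x))
    {t : TernaryTree} {d : D} (ht : HasShape σ τ t d) : HasShape σ' τ' t (φ d) := by
  induction t generalizing d with
  | leaf =>
    change τ' (φ d) = φ d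
    rw [← hτ, show τ d = d from ht]
  | node a b c iha ihb ihc =>
    obtain ⟨h0, ha, hb, hc⟩ := ht
    refine ⟨fun h => h0 (φ.injective (by rw [hτ, h])), ?_, ?_, ?_⟩
    · simpa only [hσ, hτ] using iha ha
    · simpa only [hσ, hτ] using ihb hb
    · simpa only [hσ, hτ] using ihc hc

theorem HasRootShape.map {φ : D ≃ D'} (hσ : ∀ x, φ (σ x) = σ' (φ x))
    (hτ : ∀ x, φ (τ x) = τ' (φ x)) (ht : HasRootShape σ τ t r) :
    HasRootShape σ' τ' t (φ r) := by
  cases t with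
  | leaf => exact ht.elim
  | node a b c =>
    obtain ⟨ha, hb, hc⟩ := ht
    refine ⟨?_, ?_, ?_⟩
    · simpa only [hσ, hτ] using ha.map hσ hτ
    · simpa only [hσ, hτ] using hb.map hσ hτ
    · simpa only [hσ, hτ] using hc.map hσ hτ

theorem leafList_map {φ : D ≃ D'} (hσ : ∀ x, φ (σ x) = σ' (φ x)) (hτ : ∀ x, φ (τ x) = τ' (φ x))
    (t : TernaryTree) (d : D) : leafList σ' τ' t (φ d) = (leafList σ τ t d).map φ := by
  induction t generalizing d with
  | leaf => rfl
  | node a b c iha ihb ihc => simp only [leafList, List.map_append, ← hσ, ← hτ, iha, ihb, ihc]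

theorem rootLeafList_map {φ : D ≃ D'} (hσ : ∀ x, φ (σ x) = σ' (φ x))
    (hτ : ∀ x, φ (τ x) = τ' (φ x)) (t : TernaryTree) (d : D) :
    rootLeafList σ' τ' t (φ d) = (rootLeafList σ τ t d).map φ := by
  cases t with
  | leaf => rfl
  | node a b c =>
    simp only [rootLeafList, List.map_append, List.map_cons, ← hσ, leafList_map hσ hτ]

theorem length_contour_eq (t : TernaryTree) (d : D) (d' : D') :
    (contour σ τ t d).length = (contour σ' τ' t d').length := by
  induction t generalizing d d' with
  | leaf => rfl
  | node a b c iha ihb ihc =>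
    simp only [contour, List.length_cons, List.length_append, List.length_nil]
    rw [iha (σ (τ d)) (σ' (τ' d')), ihb (σ (σ (τ d))) (σ' (σ' (τ' d'))),
      ihc (σ (σ (σ (τ d)))) (σ' (σ' (σ' (τ' d'))))]

/-- The shape alone tells which contour positions are exchanged by `τ`, so a bijection that respects
positions commutes with the involutions. -/
theorem tau_comm_of_map_contour (hτ : ∀ x, τ (τ x) = x) (hτ' : ∀ x, τ' (τ' x) = x) (φ : D ≃ D')
    {d : D} {d' : D'} (ht : HasShape σ τ t d) (ht' : HasShape σ' τ' t d')
    (h : (contour σ τ t d).map φ = contour σ' τ' t d') {x : D} (hx : x ∈ contour σ τ t d) :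
    φ (τ x) = τ' (φ x) := by
  induction t generalizing d d' with
  | leaf =>
    simp only [contour, List.map_cons, List.map_nil, List.cons.injEq, and_true,
      List.mem_singleton] at h hx
    rw [hx, show τ d = d from ht, h, show τ' d' = d' from ht']
  | node a b c iha ihb ihc =>
    obtain ⟨-, ha, hb, hc⟩ := ht
    obtain ⟨-, ha', hb', hc'⟩ := ht'
    simp only [contour, List.map_cons, List.map_append, List.cons.injEq, List.map_nil] at h
    obtain ⟨h1, h⟩ := h
    obtain ⟨h, h2⟩ := List.append_inj' h rfl
    obtain ⟨h, h3⟩ := List.append_inj' h (by rw [List.length_map]; exact length_contour_eq _ _ _)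
    obtain ⟨h4, h5⟩ := List.append_inj' h (by rw [List.length_map]; exact length_contour_eq _ _ _)
    have h2 : φ (τ d) = τ' d' := by simpa using h2
    simp only [contour, List.mem_cons, List.mem_append, List.not_mem_nil, or_false] at hx
    rcases hx with rfl | ((hx | hx) | hx) | rfl
    · rw [h1, h2]
    · exact iha ha ha' h4 hx
    · exact ihb hb hb' h5 hx
    · exact ihc hc hc' h3 hx
    · rw [hτ, h1, h2, hτ']

theorem tau_comm_of_map_rootContour (hτ : ∀ x, τ (τ x) = x) (hτ' : ∀ x, τ' (τ' x) = x)
    (hr : τ r = r) (hr' : τ' r' = r') (φ : D ≃ D')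
    (ht : HasRootShape σ τ t r) (ht' : HasRootShape σ' τ' t r')
    (h : (rootContour σ τ t r).map φ = rootContour σ' τ' t r') {x : D}
    (hx : x ∈ rootContour σ τ t r) : φ (τ x) = τ' (φ x) := by
  cases t with
  | leaf => exact ht.elim
  | node a b c =>
    obtain ⟨ha, hb, hc⟩ := ht
    obtain ⟨ha', hb', hc'⟩ := ht'
    simp only [rootContour, List.map_cons, List.map_append, List.cons.injEq] at h
    obtain ⟨h1, h⟩ := h
    obtain ⟨h, h3⟩ := List.append_inj' h (by rw [List.length_map]; exact length_contour_eq _ _ _)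
    obtain ⟨h4, h5⟩ := List.append_inj' h (by rw [List.length_map]; exact length_contour_eq _ _ _)
    simp only [rootContour, List.mem_cons, List.mem_append] at hx
    rcases hx with rfl | (hx | hx) | hx
    · rw [hr, h1, hr']
    · exact tau_comm_of_map_contour hτ hτ' φ ha ha' h4 hx
    · exact tau_comm_of_map_contour hτ hτ' φ hb hb' h5 hx
    · exact tau_comm_of_map_contour hτ hτ' φ hc hc' h3 hx

/-- Plane trees of the same shape are isomorphic. -/
theorem IsPlaneTree.exists_equiv {h : D → ℕ} {h' : D' → ℕ} (H : IsPlaneTree σ τ h r)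
    (H' : IsPlaneTree σ' τ' h' r') (ht : HasRootShape σ τ t r) (ht' : HasRootShape σ' τ' t r') :
    ∃ φ : D ≃ D', φ r = r' ∧ (∀ x, φ (σ x) = σ' (φ x)) ∧ ∀ x, φ (τ x) = τ' (φ x) := by
  set φ : D ≃ D' := (H.posEquiv ht).symm.trans (H'.posEquiv ht') with hφ
  have hφi : ∀ i, φ (H.posEquiv ht i) = H'.posEquiv ht' i := fun i => by simp [hφ]
  have hτ : ∀ x, φ (τ x) = τ' (φ x) := fun x => by
    refine tau_comm_of_map_rootContour H.tau_tau H'.tau_tau H.tau_root H'.tau_root φ ht ht' ?_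
      (H.mem_rootContour ht x)
    rw [H.rootContour_eq_ofFn ht, H'.rootContour_eq_ofFn ht', List.map_ofFn]
    exact congrArg List.ofFn (funext hφi)
  have hψ : ∀ x, φ (σ (τ x)) = σ' (τ' (φ x)) := fun x => by
    -- Both sides are the next contour position, taken cyclically.
    apply (H'.posEquiv ht').symm.injective
    refine Fin.ext ?_
    have h1 : ∀ y, (H'.posEquiv ht').symm (φ y) = (H.posEquiv ht).symm y := fun y => by simp [hφ]
    rw [H'.posEquiv_symm_psi ht', h1, h1, H.posEquiv_symm_psi ht]
  have hpos : 0 < t.inner := by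
    cases t with
    | leaf => exact ht.elim
    | node a b c => simp [TernaryTree.inner]
  refine ⟨φ, hφi ⟨0, by omega⟩, fun x => ?_, hτ⟩
  conv_lhs => rw [← H.tau_tau x]
  rw [hψ, hτ, H'.tau_tau]

end Equivariance

/-! ### The tree and the arch system of a rooted map -/

variable {n : ℕ}

namespace TreeMap

variable (M : TreeMap n)

/-- The involution exchanging the two halves of each tree edge. -/
noncomputable abbrev τ : Perm (Fin (4 * n)) := M.map.involOn M.tree

variable {M}

/-- This separates the inductive relation into a condition on the shape and a computed list, to
which the results on plane trees apply. -/
theorem unfolds_iff {d : Fin (4 * n)} {t : TernaryTree} {L : List (Fin (4 * n))} :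
    M.Unfolds d t L ↔ HasShape M.map.σ M.τ t d ∧ L = leafList M.map.σ M.τ t d := by
  constructor
  · intro hU
    induction hU with
    | leaf d hd => exact ⟨CombMap.involOn_of_notMem hd, rfl⟩
    | node d a b c A B C hd _ _ _ iha ihb ihc =>
      have hτ : M.τ d = M.map.α d := CombMap.involOn_of_mem hd
      simp only [HasShape, leafList, hτ]
      refine ⟨⟨M.map.α_fixedPointFree d, iha.1, ihb.1, ihc.1⟩, ?_⟩
      rw [iha.2, ihb.2, ihc.2]
  · rintro ⟨hs, rfl⟩
    induction t generalizing d with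
    | leaf => exact .leaf d (CombMap.involOn_eq_self_iff.1 hs)
    | node a b c iha ihb ihc =>
      obtain ⟨h0, ha, hb, hc⟩ := hs
      have hd : M.map.edge d ∈ M.tree := by
        by_contra h
        exact h0 (CombMap.involOn_of_notMem h)
      have hτ : M.τ d = M.map.α d := CombMap.involOn_of_mem hd
      have ha' := iha ha
      have hb' := ihb hb
      have hc' := ihc hc
      rw [leafList]
      simp only [hτ] at ha' hb' hc' ⊢
      exact .node d a b c _ _ _ hd ha' hb' hc'

theorem card_vertex (M : TreeMap n) : Nat.card M.map.Vertex = n := by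
  have := M.tetravalent.card_vertex
  rw [Nat.card_fin] at this
  omega

theorem card_face (M : TreeMap n) : Nat.card M.map.Face = n + 2 := by
  rw [M.tetravalent.isPlanar_iff.1 M.planar, M.card_vertex]

theorem isPlaneTree (M : TreeMap n) {r : Fin (4 * n)} (hr : M.map.edge r ∉ M.tree) :
    IsPlaneTree M.map.σ M.τ
      (fun x => (M.map.edgeSetGraph M.tree).dist (M.map.vertex r) (M.map.vertex x)) r :=
  M.isSpanningTree.isPlaneTree M.tetravalent hr

theorem inner_eq {r : Fin (4 * n)} (hr : M.map.edge r ∉ M.tree) {t : TernaryTree}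
    (ht : HasRootShape M.map.σ M.τ t r) : t.inner = n := by
  have := (M.isPlaneTree hr).card_eq ht
  rw [Nat.card_fin] at this
  omega

theorem IsIso.map_τ {M M' : TreeMap n} {φ : Perm (Fin (4 * n))} (h : M.IsIso M' φ)
    (x : Fin (4 * n)) : φ (M.τ x) = M'.τ (φ x) := by
  by_cases hx : M.map.edge x ∈ M.tree
  · rw [CombMap.involOn_of_mem hx, CombMap.involOn_of_mem ((h.map_tree x).1 hx), h.map_α]
  · rw [CombMap.involOn_of_notMem hx,
      CombMap.involOn_of_notMem fun h0 => hx ((h.map_tree x).2 h0)]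

end TreeMap

namespace RootTreeMap

theorem isMadeOf_iff {M : RootTreeMap n} {t : TernaryTree} {f : ArchSystem (n + 1)} :
    M.IsMadeOf t f ↔ HasRootShape M.map.σ M.τ t M.root ∧
      ∃ ℓ : Fin (2 * (n + 1)) → Fin (4 * n),
        List.ofFn ℓ = rootLeafList M.map.σ M.τ t M.root ∧ ∀ i, M.map.α (ℓ i) = ℓ (f.1 i) := by
  constructor
  · rintro ⟨a, b, c, A, B, C, ℓ, rfl, ha, hb, hc, hℓ, hf⟩
    rw [TreeMap.unfolds_iff] at ha hb hc
    obtain ⟨ha, rfl⟩ := ha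
    obtain ⟨hb, rfl⟩ := hb
    obtain ⟨hc, rfl⟩ := hc
    exact ⟨⟨ha, hb, hc⟩, ℓ, hℓ, hf⟩
  · rintro ⟨ht, ℓ, hℓ, hf⟩
    cases t with
    | leaf => exact ht.elim
    | node a b c =>
      obtain ⟨ha, hb, hc⟩ := ht
      exact ⟨a, b, c, _, _, _, ℓ, rfl, TreeMap.unfolds_iff.2 ⟨ha, rfl⟩,
        TreeMap.unfolds_iff.2 ⟨hb, rfl⟩, TreeMap.unfolds_iff.2 ⟨hc, rfl⟩, hℓ, hf⟩

theorem IsMadeOf.unique {M : RootTreeMap n} {t t' : TernaryTree} {f f' : ArchSystem (n + 1)}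
    (h : M.IsMadeOf t f) (h' : M.IsMadeOf t' f') : t = t' ∧ f = f' := by
  rw [isMadeOf_iff] at h h'
  obtain ⟨ht, ℓ, hℓ, hf⟩ := h
  obtain ⟨ht', ℓ', hℓ', hf'⟩ := h'
  obtain rfl := ht.unique ht'
  obtain rfl : ℓ = ℓ' := List.ofFn_injective (hℓ.trans hℓ'.symm)
  refine ⟨rfl, Subtype.ext (Equiv.ext fun i => ?_)⟩
  exact (M.isPlaneTree M.unvisited).leaf_enum_injective ht hℓ (by rw [← hf, ← hf'])

theorem IsMadeOf.inner_eq {M : RootTreeMap n} {t : TernaryTree} {f : ArchSystem (n + 1)}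
    (h : M.IsMadeOf t f) : t.inner = n :=
  TreeMap.inner_eq M.unvisited (isMadeOf_iff.1 h).1

/-- Since `α` permutes the unvisited half-edges, which are the leaves, it induces an involution of
their indices; planarity makes it non-crossing. -/
theorem exists_isMadeOf (M : RootTreeMap n) : ∃ t f, M.IsMadeOf t f := by
  have H := M.isPlaneTree M.unvisited
  obtain ⟨t, ht⟩ := H.exists_hasRootShape
  obtain rfl := TreeMap.inner_eq M.unvisited ht
  obtain ⟨ℓ, hℓ⟩ := ht.exists_leaf_enum
  have hinj := H.leaf_enum_injective ht hℓ
  have hex : ∀ i, ∃ j, ℓ j = M.map.α (ℓ i) := fun i => by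
    rw [H.exists_leaf_enum_eq_iff ht hℓ, CombMap.involOn_eq_self_iff, CombMap.edge_α]
    exact CombMap.edge_leaf_notMem H ht hℓ i
  choose f hf using hex
  have hff : ∀ i, f (f i) = i := fun i => hinj (by rw [hf, hf, M.map.α_invol])
  have hnc := CombMap.not_crossing_of_card_face (f := Function.Involutive.toPerm f hff) H ht hℓ
    (fun i => (hf i).symm) M.card_face
  refine ⟨t, ⟨Function.Involutive.toPerm f hff, hff, fun i h => ?_, hnc⟩,
    isMadeOf_iff.2 ⟨ht, ℓ, hℓ, fun i => (hf i).symm⟩⟩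
  have h1 := hf i
  rw [show f i = i from h] at h1
  exact M.map.α_fixedPointFree _ h1.symm

theorem IsMadeOf.of_equiv {M M' : RootTreeMap n} (hM : M ≈ M') {t : TernaryTree}
    {f : ArchSystem (n + 1)} (h : M.IsMadeOf t f) : M'.IsMadeOf t f := by
  obtain ⟨φ, hφ, hr⟩ := hM
  rw [isMadeOf_iff] at h ⊢
  obtain ⟨ht, ℓ, hℓ, hf⟩ := h
  rw [← hr]
  refine ⟨ht.map hφ.map_σ hφ.map_τ, fun i => φ (ℓ i), ?_, fun i => ?_⟩
  · rw [rootLeafList_map hφ.map_σ hφ.map_τ, ← hℓ, List.map_ofFn]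
    rfl
  · rw [← hφ.map_α, hf]

/-- The isomorphism of the plane trees preserves the order of the leaves. It commutes with `α` on
tree edges, where `α` is `τ`, and on leaves, where `α` is read off the common arch system. -/
theorem equiv_of_isMadeOf {M M' : RootTreeMap n} {t : TernaryTree} {f : ArchSystem (n + 1)}
    (h : M.IsMadeOf t f) (h' : M'.IsMadeOf t f) : M ≈ M' := by
  rw [isMadeOf_iff] at h h'
  obtain ⟨ht, ℓ, hℓ, hf⟩ := h
  obtain ⟨ht', ℓ', hℓ', hf'⟩ := h'
  have H := M.isPlaneTree M.unvisited
  obtain ⟨φ, hr, hσ, hτ⟩ := H.exists_equiv (M'.isPlaneTree M'.unvisited) ht ht'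
  have hℓφ : ∀ i, ℓ' i = φ (ℓ i) := fun i => by
    have : List.ofFn ℓ' = List.ofFn fun i => φ (ℓ i) := by
      rw [hℓ', ← hr, rootLeafList_map hσ hτ, ← hℓ, List.map_ofFn]
      rfl
    exact congrFun (List.ofFn_injective this) i
  have htree : ∀ d, M.map.edge d ∈ M.tree ↔ M'.map.edge (φ d) ∈ M'.tree := fun d => by
    rw [← not_iff_not, ← CombMap.involOn_eq_self_iff, ← CombMap.involOn_eq_self_iff]
    change M.τ d = d ↔ M'.τ (φ d) = φ d
    rw [← hτ, φ.apply_eq_iff_eq]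
  refine ⟨φ, ⟨hσ, fun d => ?_, htree⟩, hr⟩
  by_cases hd : M.map.edge d ∈ M.tree
  · have := hτ d
    rwa [CombMap.involOn_of_mem hd, CombMap.involOn_of_mem ((htree d).1 hd)] at this
  · obtain ⟨i, rfl⟩ := (H.exists_leaf_enum_eq_iff ht hℓ d).2 (CombMap.involOn_of_notMem hd)
    rw [hf, ← hℓφ, ← hℓφ, hf']

end RootTreeMap

/-! ### Gluing a plane tree along arches -/

section Glue

variable {D : Type*} {σ τ : Perm D} {h : D → ℕ} {r : D} {t : TernaryTree} {k : ℕ}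

/-- In a plane tree there is at most one half-edge towards the root at each vertex. -/
theorem IsPlaneTree.inward_unique (H : IsPlaneTree σ τ h r) {x y : D} (hxy : σ.SameCycle x y)
    (hx : h x = h (τ x) + 1) (hy : h y = h (τ y) + 1) : y = x := by
  obtain ⟨h1, h2, h3⟩ := H.outward (τ x) (by rw [H.tau_tau]; exact hx)
  rw [H.tau_tau] at h1 h2 h3
  have hs := H.height_sigma
  rcases eq_of_sameCycle_of_four H.sigma_four hxy with rfl | rfl | rfl | rfl
  · rfl
  · rw [hs] at hy
    rcases h1 with h1 | h1
    · rw [h1, hs] at hy; omega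
    · omega
  · rw [hs, hs] at hy
    rcases h2 with h2 | h2
    · rw [h2, hs, hs] at hy; omega
    · omega
  · rw [hs, hs, hs] at hy
    rcases h3 with h3 | h3
    · rw [h3, hs, hs, hs] at hy; omega
    · omega

/-- Gluing the leaves of a plane tree along a fixed-point-free involution gives a map. -/
theorem IsPlaneTree.exists_combMap (H : IsPlaneTree σ τ h r) (ℓ : Fin k → D)
    (hinj : Function.Injective ℓ) (hℓ : ∀ x, (∃ i, ℓ i = x) ↔ τ x = x) (f : Perm (Fin k))
    (hff : ∀ i, f (f i) = i) (hne : ∀ i, f i ≠ i) :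
    ∃ (M : CombMap D) (T : Set M.Edge), M.σ = σ ∧ M.involOn T = τ ∧ ∀ i, M.α (ℓ i) = ℓ (f i) := by
  classical
  have : Nonempty (Fin k) := ((hℓ r).2 H.tau_root).nonempty
  choose! g hg using fun x => (hℓ x).2
  have hgℓ : ∀ i, g (ℓ i) = i := fun i => hinj (hg _ ((hℓ _).1 ⟨i, rfl⟩))
  have hτℓ : ∀ i, τ (ℓ i) = ℓ i := fun i => (hℓ _).1 ⟨i, rfl⟩
  -- On leaves follow the arch, elsewhere keep the inner edge; `g` is an index of the leaf, with a
  -- junk value off the leaves.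
  set α : D → D := fun x => if τ x = x then ℓ (f (g x)) else τ x with hα
  have hα1 : ∀ i, α (ℓ i) = ℓ (f i) := fun i => by simp [hα, hτℓ, hgℓ]
  have hα2 : ∀ x, τ x ≠ x → α x = τ x := fun x hx => if_neg hx
  have hττ : ∀ x, τ x ≠ x → τ (τ x) ≠ τ x := fun x hx => by
    rw [H.tau_tau]; exact Ne.symm hx
  have hcases : ∀ x, (∃ i, x = ℓ i) ∨ τ x ≠ x := fun x => by
    by_cases hx : τ x = x
    · obtain ⟨i, hi⟩ := (hℓ x).2 hx
      exact .inl ⟨i, hi.symm⟩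
    · exact .inr hx
  have hinv : ∀ x, α (α x) = x := fun x => by
    rcases hcases x with ⟨i, rfl⟩ | hx
    · rw [hα1, hα1, hff]
    · rw [hα2 x hx, hα2 _ (hττ x hx), H.tau_tau]
  have hfpf : ∀ x, α x ≠ x := fun x => by
    rcases hcases x with ⟨i, rfl⟩ | hx
    · rw [hα1]; exact fun h0 => hne i (hinj h0)
    · rwa [hα2 x hx]
  set a : Perm D := Function.Involutive.toPerm α hinv with ha
  -- The tree alone already connects all half-edges to `r`; the glued edges are not needed.
  have hreach : ∀ x, ∃ g ∈ Subgroup.closure ({σ, a} : Set (Perm D)), g r = x := by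
    have hσm : σ ∈ Subgroup.closure ({σ, a} : Set (Perm D)) := Subgroup.subset_closure (by simp)
    have ham : a ∈ Subgroup.closure ({σ, a} : Set (Perm D)) := Subgroup.subset_closure (by simp)
    refine H.transitive {x | ∃ g ∈ Subgroup.closure ({σ, a} : Set (Perm D)), g r = x}
      ⟨1, one_mem _, rfl⟩ ?_ ?_
    · rintro _ ⟨g, hg, rfl⟩
      exact ⟨σ * g, mul_mem hσm hg, rfl⟩
    · rintro _ ⟨g, hg, rfl⟩
      by_cases hx : τ (g r) = g r
      · rw [hx]; exact ⟨g, hg, rfl⟩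
      · exact ⟨a * g, mul_mem ham hg, hα2 _ hx⟩
  let M : CombMap D :=
    { σ := σ
      α := a
      α_invol := hinv
      α_fixedPointFree := hfpf
      connected := fun d d' => by
        obtain ⟨g, hg, rfl⟩ := hreach d
        obtain ⟨g', hg', rfl⟩ := hreach d'
        exact ⟨g' * g⁻¹, mul_mem hg' (inv_mem hg), by simp⟩ }
  have hT : ∀ x, M.edge x ∈ {e | ∃ y, τ y ≠ y ∧ M.edge y = e} ↔ τ x ≠ x := fun x => by
    refine ⟨?_, fun hx => ⟨x, hx, rfl⟩⟩
    rintro ⟨y, hy, hyx⟩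
    rcases M.edge_eq_iff.1 hyx with rfl | rfl
    · exact hy
    · change τ (α y) ≠ α y
      rw [hα2 y hy]
      exact hττ y hy
  refine ⟨M, {e | ∃ y, τ y ≠ y ∧ M.edge y = e}, rfl, ?_, hα1⟩
  refine Equiv.ext fun x => ?_
  by_cases hx : τ x = x
  · rw [CombMap.involOn_of_notMem fun h0 => (hT x).1 h0 hx, hx]
  · rw [CombMap.involOn_of_mem ((hT x).2 hx)]
    exact hα2 x hx

theorem IsPlaneTree.isTetravalent [Finite D] {M : CombMap D} {T : Set M.Edge}
    (H : IsPlaneTree M.σ (M.involOn T) h r) : M.IsTetravalent :=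
  M.isTetravalent_iff.2 fun x => ⟨H.sigma_ne x, H.sigma_two_ne x, H.sigma_four x⟩

/-- The height is a function on vertices that changes by one along tree edges, which excludes loops.
Each vertex has at most one half-edge towards the root, which excludes parallel edges and cycles. -/
theorem IsPlaneTree.isSpanningTree [Finite D] {M : CombMap D} {T : Set M.Edge}
    (H : IsPlaneTree M.σ (M.involOn T) h r) : M.IsSpanningTree T := by
  have hdir : ∀ x, M.edge x ∈ T → h (M.α x) = h x + 1 ∨ h x = h (M.α x) + 1 := fun x hx => by
    have := H.height_tau x
    rw [CombMap.involOn_of_mem hx] at this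
    exact this.resolve_left (M.α_fixedPointFree x)
  have hvert : ∀ {x y}, M.vertex x = M.vertex y → h x = h y := fun {x y} hxy =>
    (sameCycle_iff_of_invariant (p := fun z => h x = h z)
      (fun z => by rw [H.height_sigma]) (M.vertex_eq_iff.1 hxy)).1 rfl
  have hin : ∀ {x y}, M.edge x ∈ T → M.edge y ∈ T → M.vertex x = M.vertex y →
      h x = h (M.α x) + 1 → h y = h (M.α y) + 1 → y = x := fun {x y} hx hy hxy h1 h2 =>
    H.inward_unique (M.vertex_eq_iff.1 hxy) (by rwa [CombMap.involOn_of_mem hx])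
      (by rwa [CombMap.involOn_of_mem hy])
  have hconn : (M.edgeSetGraph T).Connected := by
    have key : ∀ x, (M.edgeSetGraph T).Reachable (M.vertex r) (M.vertex x) := by
      refine H.transitive {x | (M.edgeSetGraph T).Reachable (M.vertex r) (M.vertex x)}
        (SimpleGraph.Reachable.refl _) (fun x hx => ?_) fun x hx => ?_
      · change (M.edgeSetGraph T).Reachable _ _
        rw [M.vertex_σ]
        exact hx
      · by_cases hxT : M.edge x ∈ T
        · rw [CombMap.involOn_of_mem hxT]
          refine SimpleGraph.Reachable.trans hx (SimpleGraph.Adj.reachable ?_)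
          refine CombMap.edgeSetGraph_adj.2 ⟨fun h0 => ?_, x, hxT, rfl, rfl⟩
          have := hvert h0
          have := hdir x hxT
          omega
        · rwa [CombMap.involOn_of_notMem hxT]
    have : Nonempty M.Vertex := ⟨M.vertex r⟩
    refine ⟨fun u v => ?_⟩
    obtain ⟨x, rfl⟩ := M.vertex_surjective u
    obtain ⟨y, rfl⟩ := M.vertex_surjective v
    exact (key x).symm.trans (key y)
  refine ⟨fun d hd h0 => ?_, fun d d' hd hd' h1 h2 => ?_, ?_⟩
  · have := hvert h0
    have := hdir d hd
    omega
  · have e1 := hvert h1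
    have e2 := hvert h2
    rcases hdir d hd with h3 | h3 <;> rcases hdir d' hd' with h4 | h4
    · exact M.α.injective (hin (by rwa [M.edge_α]) (by rwa [M.edge_α]) h2.symm
        (by rwa [M.α_invol]) (by rwa [M.α_invol]))
    · omega
    · omega
    · exact hin hd' hd h1.symm h4 h3
  · refine SimpleGraph.isTree_iff_connected_and_card.2 ⟨hconn, ?_⟩
    -- Orient every edge towards the root. Its tail determines it and is never the root vertex, so
    -- there are at most `V - 1` edges; connectedness gives the reverse bound.
    have hex : ∀ e : (M.edgeSetGraph T).edgeSet, ∃ d, M.edge d ∈ T ∧ h d = h (M.α d) + 1 ∧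
        s(M.vertex d, M.vertex (M.α d)) = e.1 := by
      rintro ⟨⟨u, v⟩, he⟩
      obtain ⟨-, d, hd, rfl, rfl⟩ := CombMap.edgeSetGraph_adj.1 he
      rcases hdir d hd with h3 | h3
      · exact ⟨M.α d, by rwa [M.edge_α], by rwa [M.α_invol], by
          rw [M.α_invol]; exact Sym2.eq_swap⟩
      · exact ⟨d, hd, h3, rfl⟩
    choose φ hφT hφh hφe using hex
    have hroot : ∀ e, M.vertex (φ e) ≠ M.vertex r := fun e h0 => by
      have h1 := hvert h0
      have h2 := hφh e
      rw [H.height_root] at h1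
      omega
    have hinj : Function.Injective fun e =>
        (⟨M.vertex (φ e), hroot e⟩ : {v : M.Vertex // v ≠ M.vertex r}) := fun e e' hee => by
      have := hin (hφT e) (hφT e') (congrArg Subtype.val hee) (hφh e) (hφh e')
      exact Subtype.ext (by rw [← hφe, ← hφe, this])
    have h1 := Nat.card_le_card_of_injective _ hinj
    have h2 := hconn.card_vert_le_card_edgeSet_add_one
    have h3 : Nat.card {v : M.Vertex // v ≠ M.vertex r} + 1 = Nat.card M.Vertex := by
      classical
      have := Fintype.ofFinite M.Vertex
      rw [Nat.card_eq_fintype_card, Nat.card_eq_fintype_card, Fintype.card_subtype_compl]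
      have : 0 < Fintype.card M.Vertex := Fintype.card_pos_iff.2 ⟨M.vertex r⟩
      simp
      omega
    omega

/-- A plane tree and an arch system make a rooted tetravalent planar map with a spanning tree. -/
theorem IsPlaneTree.exists_rootTreeMap {σ τ : Perm (Fin (4 * t.inner))}
    {h : Fin (4 * t.inner) → ℕ} {r : Fin (4 * t.inner)} (H : IsPlaneTree σ τ h r)
    (ht : HasRootShape σ τ t r) (f : ArchSystem (t.inner + 1)) :
    ∃ M : RootTreeMap t.inner, M.IsMadeOf t f := by
  obtain ⟨ℓ, hℓ⟩ := ht.exists_leaf_enum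
  obtain ⟨M, T, rfl, rfl, hf⟩ := H.exists_combMap ℓ (H.leaf_enum_injective ht hℓ)
    (H.exists_leaf_enum_eq_iff ht hℓ) f.1 f.2.1 f.2.2.1
  have h4 := H.isTetravalent
  have hF := CombMap.card_face_of_not_crossing H ht hℓ hf f.2.2.2
  have hV : Nat.card M.Vertex = t.inner := by
    have := h4.card_vertex
    rw [Nat.card_fin] at this
    omega
  refine ⟨⟨⟨M, h4.isPlanar_iff.2 (by rw [hF, hV]), h4, T, H.isSpanningTree⟩, r,
    CombMap.involOn_eq_self_iff.1 H.tau_root⟩, RootTreeMap.isMadeOf_iff.2 ⟨ht, ℓ, hℓ, hf⟩⟩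

theorem IsPlaneTree.map {D' : Type*} (H : IsPlaneTree σ τ h r) (e : D ≃ D') :
    IsPlaneTree (e.permCongr σ) (e.permCongr τ) (fun x => h (e.symm x)) (e r) where
  tau_tau x := by simp [H.tau_tau]
  sigma_four x := by simp [H.sigma_four]
  sigma_ne x h0 := H.sigma_ne (e.symm x) (by rw [Equiv.eq_symm_apply]; simpa using h0)
  sigma_two_ne x h0 := H.sigma_two_ne (e.symm x) (by rw [Equiv.eq_symm_apply]; simpa using h0)
  height_sigma x := by simp [H.height_sigma]
  height_tau x := by simpa [← Equiv.eq_symm_apply] using H.height_tau (e.symm x)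
  outward x hx := by
    have := H.outward (e.symm x) (by simpa using hx)
    simpa using this
  tau_root := by simp [H.tau_root]
  height_root := by simp [H.height_root]
  transitive S hr hσ hτ x := by
    have := H.transitive (e ⁻¹' S) hr (fun x hx => by simpa using hσ _ hx)
      (fun x hx => by simpa using hτ _ hx) (e.symm x)
    simpa using this

end Glue

/-! ### A model plane tree for each ternary tree -/

namespace TernaryTree

/-- The `j`-th child of the root. -/
def child : TernaryTree → Fin 3 → TernaryTree
  | .leaf, _ => .leaf
  | .node a b c, j => ![a, b, c] j

/-- The subtree at an address; addresses are read from right to left. -/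
def sub (t : TernaryTree) : List (Fin 3) → TernaryTree
  | [] => t
  | j :: p => (t.sub p).child j

theorem sub_ne_leaf_of_cons {t : TernaryTree} {j : Fin 3} {p : List (Fin 3)}
    (h : t.sub (j :: p) ≠ .leaf) : t.sub p ≠ .leaf := fun h0 => h (by rw [sub, h0]; rfl)

/-- The half-edges at the inner vertices of a ternary tree: `(p, 0)` is on the side of the root,
`(p, j + 1)` on the side of the `j`-th child. -/
abbrev HalfEdge (t : TernaryTree) : Type := {p : List (Fin 3) // t.sub p ≠ .leaf} × Fin 4

variable (t : TernaryTree)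

/-- The rotation around inner vertices. -/
def rotation : Perm t.HalfEdge := Equiv.prodCongr (Equiv.refl _) (Equiv.addRight 1)

theorem rotation_apply (x : t.HalfEdge) : t.rotation x = (x.1, x.2 + 1) := rfl

open Classical in
/-- The other half of an inner edge. -/
noncomputable def opposite (x : t.HalfEdge) : t.HalfEdge :=
  Fin.cases
    (match x.1 with
      | ⟨[], _⟩ => x
      | ⟨j :: p, h⟩ => (⟨p, sub_ne_leaf_of_cons h⟩, j.succ))
    (fun j => if h : t.sub (j :: x.1.1) ≠ .leaf then (⟨j :: x.1.1, h⟩, 0) else x) x.2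

variable {t}

theorem opposite_nil (h : t.sub [] ≠ .leaf) : t.opposite (⟨[], h⟩, 0) = (⟨[], h⟩, 0) := rfl

theorem opposite_cons {j : Fin 3} {p : List (Fin 3)} (h : t.sub (j :: p) ≠ .leaf) :
    t.opposite (⟨j :: p, h⟩, 0) = (⟨p, sub_ne_leaf_of_cons h⟩, j.succ) := rfl

theorem opposite_succ_of_ne {j : Fin 3} {p : List (Fin 3)} (hp : t.sub p ≠ .leaf)
    (h : t.sub (j :: p) ≠ .leaf) : t.opposite (⟨p, hp⟩, j.succ) = (⟨j :: p, h⟩, 0) := by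
  simp [opposite, h]

theorem opposite_succ_of_eq {j : Fin 3} {p : List (Fin 3)} (hp : t.sub p ≠ .leaf)
    (h : t.sub (j :: p) = .leaf) : t.opposite (⟨p, hp⟩, j.succ) = (⟨p, hp⟩, j.succ) := by
  simp [opposite, h]

theorem opposite_opposite (x : t.HalfEdge) : t.opposite (t.opposite x) = x := by
  obtain ⟨⟨p, hp⟩, i⟩ := x
  refine Fin.cases ?_ (fun j => ?_) i
  · cases p with
    | nil => rw [opposite_nil, opposite_nil]
    | cons j p => rw [opposite_cons, opposite_succ_of_ne _ hp]
  · by_cases h : t.sub (j :: p) = .leaf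
    · rw [opposite_succ_of_eq hp h, opposite_succ_of_eq hp h]
    · rw [opposite_succ_of_ne hp h, opposite_cons]

variable (t) in
/-- The other half of an inner edge, as a permutation. -/
noncomputable def oppositePerm : Perm t.HalfEdge :=
  Function.Involutive.toPerm t.opposite opposite_opposite

theorem oppositePerm_apply (x : t.HalfEdge) : t.oppositePerm x = t.opposite x := rfl

theorem opposite_succ (p : {p : List (Fin 3) // t.sub p ≠ .leaf}) (j : Fin 3) :
    t.opposite (p, j.succ) = (p, j.succ) ∨
      (t.opposite (p, j.succ)).1.1.length = p.1.length + 1 := by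
  obtain ⟨p, hp⟩ := p
  by_cases h : t.sub (j :: p) = .leaf
  · exact .inl (opposite_succ_of_eq hp h)
  · right; rw [opposite_succ_of_ne hp h]; rfl

/-- The height is the length of the address. Only `(p, 0)` points towards the root; `(p, j.succ)` is
a leaf or leads to a longer address. -/
theorem isPlaneTree_halfEdge (ht : t ≠ .leaf) :
    IsPlaneTree t.rotation t.oppositePerm
      (fun x => x.1.1.length) (⟨[], ht⟩, 0) where
  tau_tau := opposite_opposite
  sigma_four x := by
    simp only [rotation_apply, add_assoc]
    exact Prod.ext rfl (add_zero _)
  sigma_ne x h := by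
    have := congrArg Prod.snd h
    simp [rotation_apply] at this
  sigma_two_ne x h := by
    have := congrArg Prod.snd h
    simp only [rotation_apply, add_assoc, add_eq_left] at this
    exact absurd this (by decide)
  height_sigma x := rfl
  height_tau x := by
    obtain ⟨⟨p, hp⟩, i⟩ := x
    refine Fin.cases ?_ (fun j => ?_) i
    · cases p with
      | nil => exact .inl rfl
      | cons j p => exact .inr (.inr rfl)
    · exact (opposite_succ ⟨p, hp⟩ j).imp_right .inl
  outward x := by
    obtain ⟨⟨p, hp⟩, i⟩ := x
    refine Fin.cases ?_ (fun j => ?_) i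
    · intro h
      cases p with
      | nil => exact absurd h (Nat.succ_ne_self _).symm
      | cons j p =>
        change p.length = p.length + 1 + 1 at h
        omega
    · intro h
      by_cases h0 : t.sub (j :: p) = .leaf
      · change (t.opposite (⟨p, hp⟩, j.succ)).1.1.length = p.length + 1 at h
        rw [opposite_succ_of_eq hp h0] at h
        change p.length = p.length + 1 at h
        omega
      · simp only [oppositePerm_apply, opposite_succ_of_ne hp h0]
        exact ⟨opposite_succ _ 0, opposite_succ _ 1, opposite_succ _ 2⟩
  tau_root := rfl
  height_root := rfl
  transitive S hr hσ hτ := by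
    have hrot : ∀ (p : {p : List (Fin 3) // t.sub p ≠ .leaf}), (p, 0) ∈ S → ∀ i, (p, i) ∈ S := by
      intro p hp i
      have h1 : (p, 1) ∈ S := hσ _ hp
      have h2 : (p, 2) ∈ S := hσ _ h1
      have h3 : (p, 3) ∈ S := hσ _ h2
      fin_cases i <;> assumption
    have key : ∀ (p : List (Fin 3)) (hp : t.sub p ≠ .leaf), ((⟨p, hp⟩, 0) : t.HalfEdge) ∈ S := by
      intro p
      induction p with
      | nil => exact fun _ => hr
      | cons j p ih =>
        intro hp
        have := hτ _ (hrot _ (ih (sub_ne_leaf_of_cons hp)) j.succ)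
        simpa only [oppositePerm_apply, opposite_succ_of_ne _ hp] using this
    rintro ⟨⟨p, hp⟩, i⟩
    exact hrot _ (key p hp) i

theorem hasShape_halfEdge (s : TernaryTree) {p : List (Fin 3)} (hp : t.sub p ≠ .leaf) (j : Fin 3)
    (h : t.sub (j :: p) = s) :
    HasShape t.rotation t.oppositePerm s
      (⟨p, hp⟩, j.succ) := by
  induction s generalizing p j with
  | leaf => exact opposite_succ_of_eq hp h
  | node a b c iha ihb ihc =>
    have h0 : t.sub (j :: p) ≠ .leaf := by rw [h]; simp
    simp only [HasShape, oppositePerm_apply, opposite_succ_of_ne hp h0]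
    refine ⟨fun h1 => ?_, iha h0 0 ?_, ihb h0 1 ?_, ihc h0 2 ?_⟩
    · have := congrArg Prod.snd h1
      exact Fin.succ_ne_zero j this.symm
    all_goals rw [sub, h]; rfl

theorem hasRootShape_halfEdge (ht : t ≠ .leaf) :
    HasRootShape t.rotation t.oppositePerm t
      (⟨[], ht⟩, 0) := by
  cases t with
  | leaf => exact (ht rfl).elim
  | node a b c =>
    exact ⟨hasShape_halfEdge a (p := []) ht 0 rfl, hasShape_halfEdge b (p := []) ht 1 rfl,
      hasShape_halfEdge c (p := []) ht 2 rfl⟩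

end TernaryTree

/-! ### The bijection with pairs of a tree and an arch system -/

namespace RootTreeMap

/-- The contour numbering of the model relabels its half-edges by `Fin (4 * n)`. Having an inner
vertex is essential: a bare leaf has no root half-edge in the model. -/
theorem exists_isMadeOf_of_pair {n : ℕ} (hn : 1 ≤ n) {t : TernaryTree} (ht : t.inner = n)
    (f : ArchSystem (n + 1)) : ∃ M : RootTreeMap n, M.IsMadeOf t f := by
  subst ht
  have ht : t ≠ .leaf := fun h => by rw [h] at hn; simp [TernaryTree.inner] at hn
  have H := TernaryTree.isPlaneTree_halfEdge ht
  have hs := TernaryTree.hasRootShape_halfEdge ht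
  exact (H.map (H.posEquiv hs).symm).exists_rootTreeMap
    (hs.map (fun x => by simp) fun x => by simp) f

/-- The bijection between rooted tetravalent planar maps with a spanning tree and pairs of a
ternary tree and an arch system. -/
theorem exists_equiv {n : ℕ} (hn : 1 ≤ n) :
    ∃ e : Quotient (RootTreeMap.setoid n) ≃ {t : TernaryTree // t.inner = n} × ArchSystem (n + 1),
      ∀ M : RootTreeMap n, M.IsMadeOf (e (Quotient.mk _ M)).1.1 (e (Quotient.mk _ M)).2 := by
  choose t f htf using fun M : RootTreeMap n => M.exists_isMadeOf
  let F : Quotient (RootTreeMap.setoid n) →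
      {t : TernaryTree // t.inner = n} × ArchSystem (n + 1) :=
    Quotient.lift (fun M => (⟨t M, (htf M).inner_eq⟩, f M)) fun M M' h => by
      obtain ⟨h1, h2⟩ := ((htf M).of_equiv h).unique (htf M')
      exact Prod.ext (Subtype.ext h1) h2
  have hF : ∀ M : RootTreeMap n, M.IsMadeOf (F (Quotient.mk _ M)).1.1 (F (Quotient.mk _ M)).2 := htf
  refine ⟨Equiv.ofBijective F ⟨?_, ?_⟩, hF⟩
  · rintro ⟨M⟩ ⟨M'⟩ h
    refine Quotient.sound (equiv_of_isMadeOf (hF M) ?_)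
    change F (Quotient.mk _ M) = F (Quotient.mk _ M') at h
    rw [h]
    exact hF M'
  · rintro ⟨⟨s, hs⟩, g⟩
    obtain ⟨M, hM⟩ := exists_isMadeOf_of_pair hn hs g
    obtain ⟨h1, h2⟩ := (hF M).unique hM
    exact ⟨Quotient.mk _ M, Prod.ext (Subtype.ext h1) h2⟩

end RootTreeMap

/-! ### Distances between faces, the marked face and the orientation -/

namespace TreeMap

/-- There are `2 * n` edges, while a spanning tree has only `n - 1`. -/
theorem exists_unvisited (hn : 1 ≤ n) (M : TreeMap n) : ∃ d, M.map.edge d ∉ M.tree := by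
  by_contra! hall
  have h1 := M.map.card_edge
  rw [Nat.card_fin] at h1
  have h2 := (SimpleGraph.isTree_iff_connected_and_card.1 M.isSpanningTree.isTree).2
  rw [M.card_vertex] at h2
  have hout : ∀ e : M.map.Edge, M.map.edge e.out = e := fun e => Quotient.out_eq _
  let φ : M.map.Edge → (M.map.edgeSetGraph M.tree).edgeSet := fun e =>
    ⟨s(M.map.vertex e.out, M.map.vertex (M.map.α e.out)), CombMap.edgeSetGraph_adj.2
      ⟨M.isSpanningTree.no_loop _ (hall _), e.out, hall _, rfl, rfl⟩⟩
  have hφ : Function.Injective φ := fun e e' h => by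
    have h' : s(M.map.vertex e.out, M.map.vertex (M.map.α e.out)) =
      s(M.map.vertex e'.out, M.map.vertex (M.map.α e'.out)) := congrArg Subtype.val h
    rw [← hout e, ← hout e']
    rcases Sym2.eq_iff.1 h' with ⟨h3, h4⟩ | ⟨h3, h4⟩
    · rw [M.isSpanningTree.no_parallel _ _ (hall _) (hall _) h3 h4]
    · rw [M.isSpanningTree.no_parallel e.out (M.map.α e'.out) (hall _) (hall _) h3
        (by rw [M.map.α_invol, h4]), M.map.edge_α]
  have h3 := Nat.card_le_card_of_injective φ hφ
  omega

theorem faceGraph_isTree_and_face_ne (M : TreeMap n) {r : Fin (4 * n)}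
    (hr : M.map.edge r ∉ M.tree) : (M.map.faceGraph M.tree).IsTree ∧
      M.map.face r ≠ M.map.face (M.map.α r) := by
  have H := M.isPlaneTree hr
  obtain ⟨t, ht⟩ := H.exists_hasRootShape
  obtain ⟨h1, h2⟩ := CombMap.faceGraph_isTree_and_separating H ht
    (by rw [M.card_face, inner_eq hr ht])
  refine ⟨h1, fun h0 => ?_⟩
  obtain ⟨S, hS, -⟩ := h2 r hr
  rw [h0] at hS
  exact hS Iff.rfl

/-- In a tree, adjacent vertices are never equidistant from a third one; here the tree is that of
the faces. -/
theorem dist_face (M : TreeMap n) (o : M.map.Face) {d : Fin (4 * n)}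
    (hd : M.map.edge d ∉ M.tree) :
    (M.map.faceGraph M.tree).dist o (M.map.face (M.map.α d)) =
        (M.map.faceGraph M.tree).dist o (M.map.face d) + 1 ∨
      (M.map.faceGraph M.tree).dist o (M.map.face d) =
        (M.map.faceGraph M.tree).dist o (M.map.face (M.map.α d)) + 1 := by
  obtain ⟨h1, h2⟩ := M.faceGraph_isTree_and_face_ne hd
  exact (h1.dist_eq_dist_add_one_of_adj o (CombMap.faceGraph_adj.2 ⟨h2, d, hd, rfl, rfl⟩)).symm

variable {M M' : TreeMap n} {φ : Perm (Fin (4 * n))}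

theorem IsIso.face_eq (h : M.IsIso M' φ) {x y : Fin (4 * n)} (hxy : M.map.face x = M.map.face y) :
    M'.map.face (φ x) = M'.map.face (φ y) :=
  (sameCycle_iff_of_invariant (p := fun z => M'.map.face (φ x) = M'.map.face (φ z))
    (fun z => by rw [Perm.mul_apply, h.map_σ, h.map_α, M'.map.face_σ_α])
    (M.map.face_eq_iff.1 hxy)).1 rfl

theorem IsIso.face_eq_iff (h : M.IsIso M' φ) {x y : Fin (4 * n)} :
    M.map.face x = M.map.face y ↔ M'.map.face (φ x) = M'.map.face (φ y) :=
  ⟨h.face_eq, fun h' => by simpa using h.symm.face_eq h'⟩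

theorem IsIso.edge_eq_iff (h : M.IsIso M' φ) {x y : Fin (4 * n)} :
    M.map.edge x = M.map.edge y ↔ M'.map.edge (φ x) = M'.map.edge (φ y) := by
  rw [CombMap.edge_eq_iff, CombMap.edge_eq_iff, ← h.map_α, φ.apply_eq_iff_eq, φ.apply_eq_iff_eq]

/-- An isomorphism induces a homomorphism of face graphs, which cannot lengthen a geodesic; applied
also to the inverse, this gives invariance of the distance. -/
theorem IsIso.dist_face_le (h : M.IsIso M' φ) {x y : Fin (4 * n)}
    (hc : (M.map.faceGraph M.tree).Connected) :
    (M'.map.faceGraph M'.tree).dist (M'.map.face (φ x)) (M'.map.face (φ y)) ≤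
      (M.map.faceGraph M.tree).dist (M.map.face x) (M.map.face y) := by
  let F : M.map.Face → M'.map.Face :=
    Quotient.lift (fun x => M'.map.face (φ x)) fun x y hxy => h.face_eq (Quotient.sound hxy)
  let G : M.map.faceGraph M.tree →g M'.map.faceGraph M'.tree :=
    { toFun := F
      map_rel' := by
        intro f g hfg
        obtain ⟨hne, d, hd, rfl, rfl⟩ := CombMap.faceGraph_adj.1 hfg
        refine CombMap.faceGraph_adj.2 ⟨fun h0 => hne (h.face_eq_iff.2 h0), φ d,
          fun h0 => hd ((h.map_tree d).2 h0), rfl, ?_⟩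
        rw [← h.map_α]
        rfl }
  obtain ⟨w, hw⟩ := hc.exists_walk_length_eq_dist (M.map.face x) (M.map.face y)
  rw [← hw, ← SimpleGraph.Walk.length_map G w]
  exact SimpleGraph.dist_le (w.map G)

theorem IsIso.dist_face (h : M.IsIso M' φ) (x y : Fin (4 * n))
    (hc : (M.map.faceGraph M.tree).Connected) (hc' : (M'.map.faceGraph M'.tree).Connected) :
    (M'.map.faceGraph M'.tree).dist (M'.map.face (φ x)) (M'.map.face (φ y)) =
      (M.map.faceGraph M.tree).dist (M.map.face x) (M.map.face y) :=
  le_antisymm (h.dist_face_le hc) (by simpa using h.symm.dist_face_le (x := φ x) (y := φ y) hc')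

end TreeMap

/-- The fixed points contain the root and are stable under `σ` and `τ`, which act transitively. -/
theorem RootTreeMap.eq_one_of_isIso (M : RootTreeMap n) {φ : Perm (Fin (4 * n))}
    (h : M.IsIso M.toTreeMap φ) (hr : φ M.root = M.root) (x : Fin (4 * n)) : φ x = x := by
  refine (M.isPlaneTree M.unvisited).transitive {x | φ x = x} hr (fun x hx => ?_)
    (fun x hx => ?_) x
  · change φ _ = _
    rw [h.map_σ, show φ x = x from hx]
  · change φ _ = _
    rw [h.map_τ, show φ x = x from hx]

/-- Choose a representative of each rooted class. By rigidity its `n + 2` faces give pairwise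
non-isomorphic maps with a marked face. -/
theorem card_faceRootTreeMap (hn : 1 ≤ n) : Nat.card (Quotient (FaceRootTreeMap.setoid n)) =
    Nat.card (Quotient (RootTreeMap.setoid n)) * (n + 2) := by
  obtain ⟨e, -⟩ := RootTreeMap.exists_equiv hn
  have : Finite (Quotient (RootTreeMap.setoid n)) := Finite.of_equiv _ e.symm
  have := Fintype.ofFinite (Quotient (RootTreeMap.setoid n))
  let G : (Σ q : Quotient (RootTreeMap.setoid n), q.out.map.Face) →
      Quotient (FaceRootTreeMap.setoid n) := fun q =>
    Quotient.mk _ ⟨q.1.out.toTreeMap, q.2, q.1.out.root, q.1.out.unvisited⟩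
  have hG : Function.Bijective G := by
    constructor
    · rintro ⟨q, o⟩ ⟨q', o'⟩ h
      obtain ⟨φ, h1, h2, h3⟩ := Quotient.exact h
      have hq : q = q' := by
        rw [← q.out_eq, ← q'.out_eq]
        exact Quotient.sound ⟨φ, h1, h3⟩
      subst hq
      obtain ⟨x, rfl⟩ := q.out.map.face_surjective o
      have h4 := (h2 x).1 rfl
      rw [RootTreeMap.eq_one_of_isIso _ h1 h3] at h4
      change q.out.map.face x = o' at h4
      rw [h4]
    · rintro ⟨M⟩
      have hM := Quotient.mk_out (s := RootTreeMap.setoid n) ⟨M.toTreeMap, M.root, M.unvisited⟩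
      obtain ⟨φ, h1, h2⟩ := (RootTreeMap.setoid n).symm hM
      obtain ⟨x, hx⟩ := M.map.face_surjective M.origin
      refine ⟨⟨Quotient.mk _ ⟨M.toTreeMap, M.root, M.unvisited⟩, CombMap.face _ (φ x)⟩,
        ((FaceRootTreeMap.setoid n).symm ?_ |> Quotient.sound)⟩
      refine ⟨φ, h1, fun d => ?_, h2⟩
      rw [← hx]
      exact h1.face_eq_iff
  rw [← Nat.card_congr (Equiv.ofBijective G hG), Nat.card_sigma,
    Finset.sum_congr rfl fun q _ => q.out.card_face, Finset.sum_const, Finset.card_univ,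
    Nat.card_eq_fintype_card, smul_eq_mul]

/-- Whether crossing the root edge leads away from the origin face. -/
def FaceRootTreeMap.LeadsAway (M : FaceRootTreeMap n) : Prop :=
  (M.map.faceGraph M.tree).dist M.origin (M.map.face (M.map.α M.root)) =
    (M.map.faceGraph M.tree).dist M.origin (M.map.face M.root) + 1

/-- The map with the distinguished edge not oriented. -/
def FaceRootTreeMap.unorient (M : FaceRootTreeMap n) : FaceEdgeTreeMap n :=
  ⟨M.toTreeMap, M.origin, M.map.edge M.root, M.unvisited⟩

theorem FaceRootTreeMap.dist_origin {M M' : FaceRootTreeMap n} {φ : Perm (Fin (4 * n))}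
    (h : M.IsIso M'.toTreeMap φ)
    (ho : ∀ d, M.map.face d = M.origin ↔ M'.map.face (φ d) = M'.origin) (x : Fin (4 * n)) :
    (M'.map.faceGraph M'.tree).dist M'.origin (M'.map.face (φ x)) =
      (M.map.faceGraph M.tree).dist M.origin (M.map.face x) := by
  obtain ⟨y, hy⟩ := M.map.face_surjective M.origin
  rw [← hy, ← (ho y).1 hy]
  exact h.dist_face y x (M.faceGraph_isTree_and_face_ne M.unvisited).1.connected
    (M'.faceGraph_isTree_and_face_ne M'.unvisited).1.connected

/-- Recording whether the root leads away from the origin face encodes the orientation by an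
isomorphism invariant. Reversing the edge flips it, so the two orientations are never isomorphic;
`Prop` serves as the set with two elements. -/
theorem card_faceRootTreeMap_eq_two_mul :
    Nat.card (Quotient (FaceRootTreeMap.setoid n)) = count n * 2 := by
  let F : Quotient (FaceRootTreeMap.setoid n) → Quotient (FaceEdgeTreeMap.setoid n) × Prop :=
    Quotient.lift (fun M => (Quotient.mk _ M.unorient, M.LeadsAway)) <| by
      rintro M M' ⟨φ, h1, h2, h3⟩
      refine Prod.ext (Quotient.sound ⟨φ, h1, h2, fun d => ?_⟩) (propext ?_)
      · change M.map.edge d = M.map.edge M.root ↔ M'.map.edge (φ d) = M'.map.edge M'.root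
        rw [← h3]
        exact h1.edge_eq_iff
      · unfold FaceRootTreeMap.LeadsAway
        rw [← h3, ← h1.map_α, FaceRootTreeMap.dist_origin h1 h2, FaceRootTreeMap.dist_origin h1 h2]
  have hF : Function.Bijective F := by
    constructor
    · rintro ⟨M⟩ ⟨M'⟩ h
      obtain ⟨φ, h1, h2, h3⟩ := Quotient.exact (congrArg Prod.fst h)
      have h4 : M.LeadsAway ↔ M'.LeadsAway := iff_of_eq (congrArg Prod.snd h)
      have h5 : M'.map.edge (φ M.root) = M'.map.edge M'.root := (h3 M.root).1 rfl
      refine Quotient.sound ⟨φ, h1, h2, ?_⟩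
      rcases M'.map.edge_eq_iff.1 h5 with h6 | h6
      · exact h6.symm
      -- An isomorphism that reversed the marked edge would exchange the near side and the far side,
      -- although it preserves distances to the origin.
      · exfalso
        have h7 := M.dist_face M.origin M.unvisited
        unfold FaceRootTreeMap.LeadsAway at h4
        have h8 : φ (M.map.α M.root) = M'.map.α (φ M.root) := h1.map_α _
        rw [h6, M'.map.α_invol, FaceRootTreeMap.dist_origin h1 h2, ← h8,
          FaceRootTreeMap.dist_origin h1 h2] at h4
        omega
    · rintro ⟨⟨⟨M, o, m, hd'⟩⟩, b⟩
      obtain ⟨d, rfl⟩ := M.map.edge_surjective m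
      have h7 := M.dist_face o hd'
      let M₁ : FaceRootTreeMap n := ⟨M, o, d, hd'⟩
      let M₂ : FaceRootTreeMap n := ⟨M, o, M.map.α d, by rwa [M.map.edge_α]⟩
      have e2 : M₂.unorient = M₁.unorient := by
        show FaceEdgeTreeMap.mk _ _ _ _ = FaceEdgeTreeMap.mk _ _ _ _
        congr 1
        exact M.map.edge_α d
      have h12 : M₂.LeadsAway ↔ ¬ M₁.LeadsAway := by
        change (M.map.faceGraph M.tree).dist o (M.map.face (M.map.α (M.map.α d))) = _ ↔
          ¬ (M.map.faceGraph M.tree).dist o (M.map.face (M.map.α d)) =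
            (M.map.faceGraph M.tree).dist o (M.map.face d) + 1
        rw [M.map.α_invol]
        change (M.map.faceGraph M.tree).dist o (M.map.face d) =
          (M.map.faceGraph M.tree).dist o (M.map.face (M.map.α d)) + 1 ↔ _
        omega
      by_cases hb : M₁.LeadsAway ↔ b
      · exact ⟨Quotient.mk _ M₁, Prod.ext rfl (propext hb)⟩
      · exact ⟨Quotient.mk _ M₂, Prod.ext (congrArg (Quotient.mk _) e2) (propext (by
          change M₂.LeadsAway ↔ b
          tauto))⟩
  rw [Nat.card_congr (Equiv.ofBijective F hF), Nat.card_prod]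
  simp [count]

theorem factorization (n : ℕ) : ((3 * n).factorial : ℚ) /
      (n.factorial * n.factorial * (n + 1).factorial) =
    (3 * n).factorial / (n.factorial * (2 * n + 1).factorial) *
      ((2 * n + 2).factorial / ((n + 1).factorial * (n + 2).factorial)) * (n + 2) * (1 / 2) := by
  rw [Nat.factorial_succ (2 * n + 1), Nat.factorial_succ (n + 1), Nat.factorial_succ n]
  push_cast
  field_simp
  ring

theorem count_eq (hn : 1 ≤ n) : (count n : ℚ) =
    (3 * n).factorial / (n.factorial * n.factorial * (n + 1).factorial) := by
  obtain ⟨e, -⟩ := RootTreeMap.exists_equiv hn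
  have h1 := card_faceRootTreeMap hn
  rw [card_faceRootTreeMap_eq_two_mul, Nat.card_congr e, Nat.card_prod] at h1
  have h2 : (count n : ℚ) * 2 = Nat.card {t : TernaryTree // t.inner = n} *
      Nat.card (ArchSystem (n + 1)) * (n + 2) := by exact_mod_cast h1
  rw [factorization, ← TernaryTree.card_inner_eq, ← ArchSystem.card_eq, ← h2]
  ring

theorem count_eq_coeff (n : ℕ) : (count (n + 1) : ℝ) = coeff (n + 1) := by
  have := congrArg (fun q : ℚ => (q : ℝ)) (count_eq (n := n + 1) (by omega))
  simpa [coeff] using this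

end SpanningTreeMaps

/-! ### The main theorem -/

theorem mainTheorem4 :
    (∀ n : ℕ, 1 ≤ n →
      -- the number of maps, and its factorization
      (SpanningTreeMaps.count n : ℚ) =
        (3 * n).factorial / (n.factorial * n.factorial * (n + 1).factorial) ∧
      (((3 * n).factorial : ℚ) / (n.factorial * n.factorial * (n + 1).factorial) =
        (3 * n).factorial / (n.factorial * (2 * n + 1).factorial) *
          ((2 * n + 2).factorial / ((n + 1).factorial * (n + 2).factorial)) *
          (n + 2) * (1 / 2)) ∧
      -- first factor: rooted ternary trees with `n` inner vertices and `2 * n + 2` leaves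
      (Nat.card {t : SpanningTreeMaps.TernaryTree // t.inner = n} : ℚ) =
        (3 * n).factorial / (n.factorial * (2 * n + 1).factorial) ∧
      (∀ t : SpanningTreeMaps.TernaryTree, t.inner = n → t.leaves + 1 = 2 * n + 2) ∧
      -- second factor: systems of `n + 1` non-crossing arches
      (Nat.card (SpanningTreeMaps.ArchSystem (n + 1)) : ℚ) =
        (2 * n + 2).factorial / ((n + 1).factorial * (n + 2).factorial) ∧
      -- a map with a spanning tree and an oriented unvisited edge is made of such a pair
      (∃ e : Quotient (SpanningTreeMaps.RootTreeMap.setoid n) ≃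
          {t : SpanningTreeMaps.TernaryTree // t.inner = n} × SpanningTreeMaps.ArchSystem (n + 1),
        ∀ M : SpanningTreeMaps.RootTreeMap n,
          M.IsMadeOf (e (Quotient.mk _ M)).1.1 (e (Quotient.mk _ M)).2) ∧
      -- third factor: the choice of one among `n + 2` faces
      (∀ M : SpanningTreeMaps.TreeMap n, Nat.card M.map.Face = n + 2) ∧
      Nat.card (Quotient (SpanningTreeMaps.FaceRootTreeMap.setoid n)) =
        Nat.card (Quotient (SpanningTreeMaps.RootTreeMap.setoid n)) * (n + 2) ∧
      -- last factor: each unvisited edge has two orientations, which are never equivalent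
      (SpanningTreeMaps.count n : ℚ) =
        (Nat.card (Quotient (SpanningTreeMaps.FaceRootTreeMap.setoid n)) : ℚ) * (1 / 2) ∧
      -- every unvisited edge separates faces at distances `m` and `m + 1` from any origin face
      (∀ M : SpanningTreeMaps.TreeMap n,
        (M.map.faceGraph M.tree).Connected ∧
        ∀ (o : M.map.Face) (d : Fin (4 * n)), M.map.edge d ∉ M.tree →
          (M.map.faceGraph M.tree).dist o (M.map.face (M.map.α d)) =
              (M.map.faceGraph M.tree).dist o (M.map.face d) + 1 ∨
          (M.map.faceGraph M.tree).dist o (M.map.face d) =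
              (M.map.faceGraph M.tree).dist o (M.map.face (M.map.α d)) + 1)) ∧
    -- the generating function converges exactly up to `1 / 27`, with a logarithmic singularity
    (∀ x : ℝ, Summable (fun n : ℕ => (SpanningTreeMaps.count (n + 1) : ℝ) * x ^ (n + 1)) ↔
      |x| ≤ 1 / 27) ∧
    (∃ c : ℝ, c ≠ 0 ∧
      (fun x : ℝ => SpanningTreeMaps.genFun (1 / 27) - SpanningTreeMaps.genFun x)
        ~[𝓝[<] (1 / 27)] (fun x : ℝ => c * ((1 / 27 - x) * Real.log (1 / 27 - x)))) ∧
    SpanningTreeMaps.HasCriticalExponent SpanningTreeMaps.genFun (1 / 27) (-1) := by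
  have hsum : ∀ x : ℝ, SpanningTreeMaps.genFun x =
      ∑' n, SpanningTreeMaps.coeff (n + 1) * x ^ (n + 1) := fun x => by
    simp only [SpanningTreeMaps.genFun, SpanningTreeMaps.count_eq_coeff]
  obtain ⟨c, hc0, hc⟩ := SpanningTreeMaps.isEquivalent_tsum_coeff
  simp only [← hsum] at hc
  refine ⟨fun n hn => ⟨SpanningTreeMaps.count_eq hn, SpanningTreeMaps.factorization n,
    SpanningTreeMaps.TernaryTree.card_inner_eq n, fun t ht => ?_,
    SpanningTreeMaps.ArchSystem.card_eq n, SpanningTreeMaps.RootTreeMap.exists_equiv hn,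
    fun M => M.card_face, SpanningTreeMaps.card_faceRootTreeMap hn, ?_, fun M => ?_⟩,
    fun x => ?_, ⟨c, hc0, hc⟩, SpanningTreeMaps.hasCriticalExponent_of_isEquivalent hc0 hc⟩
  · rw [t.leaves_eq, ht]
  · rw [SpanningTreeMaps.card_faceRootTreeMap_eq_two_mul]
    push_cast
    ring
  · obtain ⟨r, hr⟩ := M.exists_unvisited hn
    exact ⟨(M.faceGraph_isTree_and_face_ne hr).1.connected, fun o d hd => M.dist_face o hd⟩
  · simp only [SpanningTreeMaps.count_eq_coeff]
    exact SpanningTreeMaps.summable_coeff_iff x
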